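/- **Conventions.** Let $[n]=\{1<\dots<n\}$. The *fibre* $[n_i]$ of a map $\sigma:[n]\to[k]$ over $i$ is the ordinal order-isomorphic to $\sigma^{-1}(i)$. A *cocomplete symmetric monoidal category* is a symmetric monoidal category $(V,\otimes,I)$ that has all small colimits and whose tensor product preserves small colimits in each variable. A *left symmetric operad* in $V$ is a covariant functor $A$ from the category of the ordinals $[n]$ and bijections to $V$, with a unit $e:I\to A_1$ and, for every order preserving $\sigma:[n]\to[k]$, a multiplication $\mu_\sigma:A_k\otimes(A_{n_1}\otimes\dots\otimes A_{n_k})\to A_n$. These satisfy associativity for composable order preserving maps, the unit laws for identities and for the maps $[n]\to[1]$, and two equivariance conditions. (1) If $\sigma'\pi=\rho\sigma$ with $\sigma:[n]\to[k]$, $\sigma':[n']\to[k']$ order preserving, $\pi:[n]\to[n']$ and $\rho:[k]\to[k']$ bijections, and $\pi$ order preserving on the fibres of $\sigma$, then $A(\pi)\circ\mu_\sigma=\mu_{\sigma'}\circ(A(\rho)\otimes\tau(\rho))$, where $\tau(\rho)$ is the symmetry that permutes the factors by $\rho$. (2) If $\eta\sigma=\eta'\sigma'$ with $\eta:[n]\to[k]$,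 $\eta':[n']\to[k]$ order preserving and $\sigma:[n'']\to[n]$, $\sigma':[n'']\to[n']$ bijections, and $\sigma_i,\sigma'_i$ are the bijections induced on the fibres over $i$, then $A(\sigma^{-1})\circ\mu_\eta\circ(1\otimes\bigotimes_iA(\sigma_i))=A(\sigma'^{-1})\circ\mu_{\eta'}\circ(1\otimes\bigotimes_iA(\sigma'_i))$. Let $SO_l(V)$ be the category of left symmetric operads, and let $R_\infty:SO_l(V)\to Coll_1(V)=V^{\mathbb N}$ be the forgetful functor to nonsymmetric collections. For $n\ge 0$, an *$n$-tree* is a chain of order preserving maps $T=([k_n]\to[k_{n-1}]\to\dots\to[k_0]=[1])$. Its *tips* are the elements of $[k_n]$, and $|T|=k_n$. A *morphism* $T\to S$ of $n$-trees consists of maps $[k_j]\to[s_j]$, $0\le j\le n$, that commute with the structure maps and preserve the order on each fibre of the structure maps of $T$. The *fibre* over a tip $i$ of $S$ is the $n$-tree formed by the preimages of the ancestors of $i$. Let $U_n=([1]\to\dots\to[1])$. An *$n$-operad* in $V$ is a family of objects $A_T$, indexed by the $n$-trees, with a unit $I\to A_{U_n}$ and, for every $\sigma:T\to S$ with fibres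 $T_1,\dots,T_k$, a multiplication $A_S\otimes A_{T_1}\otimes\dots\otimes A_{T_k}\to A_T$, which satisfy associativity for composable morphisms and the unit laws for identities and for the maps $T\to U_n$. Let $R_n:O_n(V)\to Coll_n(V)$ be the forgetful functor from $n$-operads to families of objects of $V$ indexed by the $n$-trees. Every map $\tau:[n]\to[k]$ factors uniquely as $\tau=\nu(\tau)\circ\pi(\tau)$ with $\nu(\tau)$ order preserving and $\pi(\tau)$ a bijection that preserves the order of the fibres of $\tau$. The *desymmetrisation* $Des_n:SO_l(V)\to O_n(V)$ is given by $Des_n(A)_T=A_{|T|}$, with the unit of $A$ and, for $\sigma:T\to S$ with underlying map of tips $\tau$, the multiplication $A(\pi(\tau)^{-1})\circ\mu_{\nu(\tau)}$. Put $W_n(A)_T=A_{|T|}$; this functor $W_n:Coll_1(V)\to Coll_n(V)$ has the left adjoint $C_n$, $C_n(B)_k=\coprod_{|T|=k}B_T$. **Theorem.** Let $V$ be a cocomplete symmetric monoidal category. 1. The functor $R_\infty:SO_l(V)\to Coll_1(V)$ is monadic; write $F_\infty$ for its left adjoint. 2. For every $n\ge0$ the functor $R_n$ has a left adjoint $F_n$,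 and $R_n\circ Des_n=W_n\circ R_\infty$. 3. For every $n\ge0$ the functor $Des_n$ has a left adjoint $Sym_n$, and the square of left adjoints commutes: there is an isomorphism $Sym_n\circ F_n\cong F_\infty\circ C_n$ that corresponds under the adjunctions to the identity $R_n\circ Des_n=W_n\circ R_\infty$. 4. For $V=Set$ the monad $\mathcal F_\infty=R_\infty F_\infty$ on nonsymmetric collections is finitary (it preserves filtered colimits) and cartesian (it preserves pullbacks, and the naturality squares of its unit and of its multiplication are pullbacks). For every $n\geq 0$ let $\mathcal F_n=R_nF_n$. For $X\in Coll_n(Set)$, the unit $X\to W_nR_\infty F_\infty C_n(X)=R_nDes_nF_\infty C_n(X)$ extends to a map of $n$-operads $F_n(X)\to Des_nF_\infty C_n(X)$; the map $F_\infty C_n\mathcal F_n(X)\to F_\infty C_n(X)$ that corresponds, under $F_\infty C_n\dashv W_nR_\infty$, to the underlying map of collections $\mathcal F_n(X)\to W_nR_\infty F_\infty C_n(X)$ is natural in $X$ and is a right action of the monad $\mathcal F_n$ on the functor $F_\infty C_n$. This action is cartesian: all its naturality squares are pullbacks. -/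

import Mathlib

open CategoryTheory MonoidalCategory Limits

universe w v u

namespace HigherOperads

section Tensor

variable {V : Type u} [Category.{v} V] [MonoidalCategory V]

/-- The iterated tensor product `X 0 ⊗ (X 1 ⊗ (⋯ ⊗ (X (k-1) ⊗ 𝟙)))`. -/
abbrev tens : (k : ℕ) → (Fin k → V) → V
  | 0, _ => 𝟙_ V
  | k + 1, X => X 0 ⊗ tens k (fun i => X i.succ)

/-- Functoriality of the iterated tensor product. -/
def tensMap : (k : ℕ) → {X Y : Fin k → V} → (∀ i, X i ⟶ Y i) → (tens k X ⟶ tens k Y)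
  | 0, _, _, _ => 𝟙 _
  | k + 1, _, _, f => f 0 ⊗ₘ tensMap k (fun i => f i.succ)

@[simp] lemma tensMap_id (k : ℕ) (X : Fin k → V) :
    tensMap k (fun i => 𝟙 (X i)) = 𝟙 (tens k X) := by
  induction k with
  | zero => rfl
  | succ k ih => simp [tensMap, ih, tens]

lemma tensMap_comp (k : ℕ) {X Y Z : Fin k → V} (f : ∀ i, X i ⟶ Y i) (g : ∀ i, Y i ⟶ Z i) :
    tensMap k f ≫ tensMap k g = tensMap k (fun i => f i ≫ g i) := by
  induction k with
  | zero => exact Category.id_comp _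
  | succ k ih =>
    exact (tensorHom_comp_tensorHom _ _ _ _).trans (congrArg (f 0 ≫ g 0 ⊗ₘ ·) (ih _ _))

/-- The canonical isomorphism `𝟙 ⊗ (⋯ ⊗ 𝟙) ⟶ 𝟙`. -/
def tensUnit : (k : ℕ) → (tens k (fun _ => 𝟙_ V) ⟶ 𝟙_ V)
  | 0 => 𝟙 _
  | k + 1 => (λ_ _).hom ≫ tensUnit k

/-- The canonical isomorphism `Y ⟶ Y ⊗ 𝟙` onto a one-fold iterated tensor product. -/
def tensOne (Y : V) : (k : ℕ) → k = 1 → (Y ⟶ tens k (fun _ => Y))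
  | _, rfl => (ρ_ Y).inv

end Tensor

/-! ### Canonical symmetries

A `Word J` is a formal tensor expression whose factors are labelled by `J`. If two expressions
contain the same labels, each of them once, then there is a canonical isomorphism `can` between
their values, composed of associativity, unit and symmetry isomorphisms. -/

section Coherence

inductive Word (J : Type) : Type
  | leaf : J → Word J
  | tensor : Word J → Word J → Word J
  | prod : (k : ℕ) → (Fin k → Word J) → Word J

variable {J J' : Type}

/-- Concatenation of `k` lists. -/
abbrev concat : (k : ℕ) → (Fin k → List J) → List J
  | 0, _ => []
  | k + 1, g => g 0 ++ concat k (fun i => g i.succ)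

/-- The labels of a formal expression, from left to right. -/
abbrev Word.leaves : Word J → List J
  | .leaf j => [j]
  | .tensor w w' => w.leaves ++ w'.leaves
  | .prod k f => concat k (fun i => (f i).leaves)

/-- Relabelling. -/
abbrev Word.map (θ : J → J') : Word J → Word J'
  | .leaf j => .leaf (θ j)
  | .tensor w w' => .tensor (w.map θ) (w'.map θ)
  | .prod k f => .prod k (fun i => (f i).map θ)

lemma mem_concat (k : ℕ) (g : Fin k → List J) (a : J) : a ∈ concat k g ↔ ∃ i, a ∈ g i := by
  induction k with
  | zero => simp [concat]
  | succ k ih => simp [concat, ih, Fin.exists_fin_succ]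

lemma nodup_concat (k : ℕ) (g : Fin k → List J) (h : ∀ i, (g i).Nodup)
    (hd : ∀ i i' a, a ∈ g i → a ∈ g i' → i = i') : (concat k g).Nodup := by
  induction k with
  | zero => simp [concat]
  | succ k ih =>
    rw [concat, List.nodup_append]
    refine ⟨h 0, ih _ (fun i => h _) (fun i i' a ha ha' => Fin.succ_injective _ (hd _ _ a ha ha')),
      ?_⟩
    rintro a ha b hb rfl
    obtain ⟨i, hi⟩ := (mem_concat _ _ _).1 hb
    exact absurd (hd _ _ a ha hi) (Fin.succ_ne_zero i).symm

lemma map_concat (θ : J → J') (k : ℕ) (g : Fin k → List J) :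
    (concat k g).map θ = concat k (fun i => (g i).map θ) := by
  induction k with
  | zero => rfl
  | succ k ih => simp [concat, ih]

lemma Word.leaves_map (θ : J → J') (w : Word J) :
    (w.map θ).leaves = w.leaves.map θ := by
  induction w with
  | leaf j => rfl
  | tensor w w' ih ih' => simp [Word.leaves, ih, ih']
  | prod k f ih => simp [Word.leaves, ih, map_concat]

/-- `Ins a l l'`: the list `l'` is `l` with `a` inserted at a certain position. -/
inductive Ins (a : J) : List J → List J → Type
  | here (l : List J) : Ins a l (a :: l)
  | there (b : J) {l l' : List J} : Ins a l l' → Ins a (b :: l) (b :: l')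

/-- Permutations from one list to another. -/
inductive LPerm : List J → List J → Type
  | nil : LPerm [] []
  | cons (a : J) {l l₁ l₂ : List J} : LPerm l l₁ → Ins a l₁ l₂ → LPerm (a :: l) l₂

variable {V : Type u} [Category.{v} V] [MonoidalCategory V]

/-- The value of a formal expression. -/
abbrev Word.eval (X : J → V) : Word J → V
  | .leaf j => X j
  | .tensor w w' => w.eval X ⊗ w'.eval X
  | .prod k f => tens k (fun i => (f i).eval X)

/-- The tensor product over a list of labels. -/
abbrev listTens (X : J → V) : List J → V
  | [] => 𝟙_ V
  | a :: l => X a ⊗ listTens X l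

/-- `listTens` takes concatenation to tensor product. -/
def appIso (X : J → V) : (l l' : List J) → (listTens X l ⊗ listTens X l' ≅ listTens X (l ++ l'))
  | [], _ => λ_ _
  | a :: l, l' => α_ _ _ _ ≪≫ whiskerLeftIso (X a) (appIso X l l')

/-- Removing the brackets in an iterated tensor product of bracketed expressions. -/
def concatIso (X : J → V) : (k : ℕ) → (g : Fin k → List J) → (Y : Fin k → V) →
    (∀ i, Y i ≅ listTens X (g i)) → (tens k Y ≅ listTens X (concat k g))
  | 0, _, _, _ => Iso.refl _
  | k + 1, g, _, e => (e 0 ⊗ᵢ concatIso X k (fun i => g i.succ) _ (fun i => e i.succ)) ≪≫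
      appIso X _ _

/-- Removing the brackets in a formal expression. -/
def Word.norm (X : J → V) : (w : Word J) → (w.eval X ≅ listTens X w.leaves)
  | .leaf _ => (ρ_ _).symm
  | .tensor w w' => (w.norm X ⊗ᵢ w'.norm X) ≪≫ appIso X _ _
  | .prod k f => concatIso X k _ _ (fun i => (f i).norm X)

variable [SymmetricCategory V]

/-- The symmetry that exchanges the first two factors. -/
def swap (A B C : V) : A ⊗ (B ⊗ C) ⟶ B ⊗ (A ⊗ C) :=
  (α_ A B C).inv ≫ (β_ A B).hom ▷ C ≫ (α_ B A C).hom

/-- Moving the first factor to another place. -/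
def insHom (X : J → V) {a : J} : {l l' : List J} → Ins a l l' →
    (X a ⊗ listTens X l ⟶ listTens X l')
  | _, _, .here _ => 𝟙 _
  | _, _, .there b i => swap _ _ _ ≫ X b ◁ insHom X i

/-- The symmetry given by a permutation. -/
def permHom (X : J → V) : {l l' : List J} → LPerm l l' → (listTens X l ⟶ listTens X l')
  | _, _, .nil => 𝟙 _
  | _, _, .cons a p i => X a ◁ permHom X p ≫ insHom X i

lemma swap_swap (A B C : V) : swap A B C ≫ swap B A C = 𝟙 _ := by
  simp only [swap, Category.assoc, Iso.hom_inv_id_assoc]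
  rw [← comp_whiskerRight_assoc, SymmetricCategory.symmetry]
  simp

lemma swap_nat {A A' B B' C C' : V} (f : A ⟶ A') (g : B ⟶ B') (h : C ⟶ C') :
    (f ⊗ₘ (g ⊗ₘ h)) ≫ swap A' B' C' = swap A B C ≫ (g ⊗ₘ (f ⊗ₘ h)) := by
  have h1 : (f ⊗ₘ (g ⊗ₘ h)) ≫ (α_ A' B' C').inv = (α_ A B C).inv ≫ ((f ⊗ₘ g) ⊗ₘ h) :=
    associator_inv_naturality f g h
  have h2 : ((f ⊗ₘ g) ⊗ₘ h) ≫ (β_ A' B').hom ▷ C' = (β_ A B).hom ▷ C ≫ ((g ⊗ₘ f) ⊗ₘ h) := by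
    rw [← tensorHom_id, ← tensorHom_id, tensorHom_comp_tensorHom, tensorHom_comp_tensorHom,
      BraidedCategory.braiding_naturality, Category.comp_id, Category.id_comp]
  have h3 : ((g ⊗ₘ f) ⊗ₘ h) ≫ (α_ B' A' C').hom = (α_ B A C).hom ≫ (g ⊗ₘ (f ⊗ₘ h)) :=
    associator_naturality g f h
  simp only [swap, Category.assoc]
  rw [reassoc_of% h1, reassoc_of% h2, h3]

lemma swap_braid (A B C D : V) :
    A ◁ swap B C D ≫ swap A C (B ⊗ D) ≫ C ◁ swap A B D =
      swap A B (C ⊗ D) ≫ B ◁ swap A C D ≫ swap B C (A ⊗ D) := by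
  have h := congrArg (fun t => t ▷ D) (BraidedCategory.yang_baxter A B C)

  have h1 : A ◁ swap B C D ≫ swap A C (B ⊗ D) ≫ C ◁ swap A B D =
      𝟙 _ ⊗≫ (A ◁ (β_ B C).hom ≫ (α_ A C B).inv ≫ (β_ A C).hom ▷ B ≫ (α_ C A B).hom ≫ C ◁ (β_ A B).hom) ▷ D ⊗≫ 𝟙 _ := by
    simp only [swap]; monoidal
  have h2 : swap A B (C ⊗ D) ≫ B ◁ swap A C D ≫ swap B C (A ⊗ D) =
      𝟙 _ ⊗≫ ((α_ A B C).inv ≫ (β_ A B).hom ▷ C ≫ (α_ B A C).hom ≫ B ◁ (β_ A C).hom ≫ (α_ B C A).inv ≫ (β_ B C).hom ▷ A ≫ (α_ C B A).hom) ▷ D ⊗≫ 𝟙 _ := by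
    simp only [swap]; monoidal
  rw [h1, h2, h]

lemma insHom_insHom (X : J → V) {a b : J} {l l₁ l₂ : List J} (j : Ins b l₁ l₂) (i : Ins a l l₁) :
    ∃ (l' : List J) (j' : Ins b l l') (i' : Ins a l' l₂),
      X b ◁ insHom X i ≫ insHom X j =
        swap (X b) (X a) (listTens X l) ≫ X a ◁ insHom X j' ≫ insHom X i' := by
  induction j generalizing l with
  | here l₁ =>
    refine ⟨_, .here l, .there b i, ?_⟩
    simp only [insHom, whiskerLeft_id, Category.id_comp]
    rw [← Category.assoc, swap_swap]
    exact (Category.comp_id _).trans (Category.id_comp _).symm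
  | there c j0 ih =>
    cases i with
    | here => exact ⟨_, j0, .here _, by
        simp only [insHom, whiskerLeft_id]
        exact (Category.id_comp _).trans (congrArg _ (Category.comp_id _).symm)⟩
    | there _ i0 =>
      rename_i m
      obtain ⟨l', j', i', h⟩ := ih i0
      refine ⟨_, .there c j', .there c i', ?_⟩
      have n1 := swap_nat (𝟙 (X b)) (𝟙 (X c)) (insHom X i0)
      have n2 := swap_nat (𝟙 (X a)) (𝟙 (X c)) (insHom X j')
      simp only [id_tensorHom] at n1 n2
      have h' := congrArg (fun t => X c ◁ t) h
      simp only [MonoidalCategory.whiskerLeft_comp] at h'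
      have hb := swap_braid (X b) (X a) (X c) (listTens X m)
      simp only [insHom, MonoidalCategory.whiskerLeft_comp, Category.assoc]
      rw [reassoc_of% n1, h', reassoc_of% hb, ← reassoc_of% n2]

/-- Two permutations compose. -/
lemma insHom_permHom (X : J → V) {a : J} {l l' l₃ : List J} (i : Ins a l l') (q : LPerm l' l₃) :
    ∃ (l₄ : List J) (q' : LPerm l l₄) (j : Ins a l₄ l₃),
      insHom X i ≫ permHom X q = X a ◁ permHom X q' ≫ insHom X j := by
  induction i generalizing l₃ with
  | here l =>
    cases q with
    | cons _ q j => exact ⟨_, q, j, Category.id_comp _⟩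
  | there b i ih =>
    cases q with
    | cons _ q j =>
      obtain ⟨m, q', j', h⟩ := ih q
      obtain ⟨m', j'', i'', h'⟩ := insHom_insHom X j j'
      refine ⟨m', .cons b q' j'', i'', ?_⟩
      have n1 := swap_nat (𝟙 (X a)) (𝟙 (X b)) (permHom X q')
      simp only [id_tensorHom] at n1
      have h1 := congrArg (fun t => X b ◁ t) h
      simp only [MonoidalCategory.whiskerLeft_comp] at h1
      simp only [insHom, permHom, MonoidalCategory.whiskerLeft_comp, Category.assoc]
      have hs := swap_swap (X a) (X b) (listTens X m)
      rw [reassoc_of% h1, h', ← reassoc_of% n1, reassoc_of% hs]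

lemma permHom_comp (X : J → V) {l₁ l₂ l₃ : List J} (p : LPerm l₁ l₂) (q : LPerm l₂ l₃) :
    ∃ r : LPerm l₁ l₃, permHom X p ≫ permHom X q = permHom X r := by
  induction p generalizing l₃ with
  | nil => exact ⟨q, Category.id_comp _⟩
  | cons a p i ih =>
    obtain ⟨m, q', j, h⟩ := insHom_permHom X i q
    obtain ⟨r, hr⟩ := ih q'
    refine ⟨.cons a r j, ?_⟩
    simp only [permHom, Category.assoc]
    rw [h, ← hr, MonoidalCategory.whiskerLeft_comp, Category.assoc]

lemma permHom_id (X : J → V) (l : List J) : ∃ p : LPerm l l, permHom X p = 𝟙 _ := by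
  induction l with
  | nil => exact ⟨.nil, rfl⟩
  | cons a l ih =>
    obtain ⟨p, hp⟩ := ih
    refine ⟨.cons a p (.here l), ?_⟩
    simp only [permHom, insHom, hp, whiskerLeft_id]
    exact Category.id_comp _

lemma Ins.mem {a : J} {l l' : List J} (i : Ins a l l') (x : J) : x ∈ l' ↔ x = a ∨ x ∈ l := by
  induction i with
  | here l => simp
  | there b i ih => simp [ih]; tauto

lemma Ins.unique {a : J} {l m l' : List J} (i : Ins a l l') (j : Ins a m l') (h : l'.Nodup) :
    ∃ e : l = m, e ▸ i = j := by
  induction i generalizing m with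
  | here l =>
    cases j with
    | here => exact ⟨rfl, rfl⟩
    | there _ j => exact absurd ((j.mem a).2 (Or.inl rfl)) (List.nodup_cons.1 h).1
  | there b i ih =>
    cases j with
    | here => exact absurd ((i.mem a).2 (Or.inl rfl)) (List.nodup_cons.1 h).1
    | there _ j =>
      obtain ⟨e, he⟩ := ih j (List.nodup_cons.1 h).2
      subst e
      subst he
      exact ⟨rfl, rfl⟩

lemma Ins.nodup {a : J} {l l' : List J} (i : Ins a l l') (h : l'.Nodup) : l.Nodup := by
  induction i with
  | here l => exact (List.nodup_cons.1 h).2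
  | there b i ih =>
    rw [List.nodup_cons] at h ⊢
    exact ⟨fun hb => h.1 ((i.mem b).2 (Or.inr hb)), ih h.2⟩

/-- There is only one permutation between two lists without repetitions. -/
lemma LPerm.unique {l l' : List J} (p q : LPerm l l') (h : l'.Nodup) : p = q := by
  induction p with
  | nil => cases q; rfl
  | cons a p i ih =>
    cases q with
    | cons _ q j =>
      obtain ⟨e, he⟩ := i.unique j h
      subst e
      subst he
      rw [ih q (i.nodup h)]

lemma LPerm.exists_ins {a : J} {l' : List J} (h : a ∈ l') : ∃ l, Nonempty (Ins a l l') := by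
  induction l' with
  | nil => simp at h
  | cons b l ih =>
    by_cases hb : a = b
    · subst hb; exact ⟨l, ⟨.here l⟩⟩
    · obtain ⟨m, ⟨i⟩⟩ := ih (by simpa [hb] using h)
      exact ⟨_, ⟨.there b i⟩⟩

lemma LPerm.exists_perm {l l' : List J} (h : l.Nodup) (h' : l'.Nodup)
    (hm : ∀ j, j ∈ l ↔ j ∈ l') : Nonempty (LPerm l l') := by
  induction l generalizing l' with
  | nil =>
    have : l' = [] := List.eq_nil_iff_forall_not_mem.2 fun j hj => by simpa using (hm j).2 hj
    subst this
    exact ⟨.nil⟩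
  | cons a l ih =>
    obtain ⟨m, ⟨i⟩⟩ := LPerm.exists_ins ((hm a).1 (by simp))
    have ha : a ∉ m := by
      clear ih hm
      induction i with
      | here l => exact (List.nodup_cons.1 h').1
      | there b i ih =>
        rw [List.nodup_cons] at h'
        have : a ≠ b := by rintro rfl; exact h'.1 ((i.mem _).2 (Or.inl rfl))
        simp [this, ih h'.2]
    obtain ⟨p⟩ := ih (List.nodup_cons.1 h).2 (i.nodup h') (fun j => by
      have h1 := hm j
      have h2 := i.mem j
      have h3 := (List.nodup_cons.1 h).1
      rw [h2, List.mem_cons] at h1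
      by_cases hj : j = a
      · subst hj; simp [h3, ha]
      · simpa [hj] using h1)
    exact ⟨.cons a p i⟩

lemma insHom_append (X : J → V) {a : J} {l l' : List J} (i : Ins a l l') (m : List J) :
    ∃ j : Ins a (l ++ m) (l' ++ m),
      insHom X i ▷ listTens X m ≫ (appIso X l' m).hom =
        (α_ _ _ _).hom ≫ X a ◁ (appIso X l m).hom ≫ insHom X j := by
  induction i with
  | here l =>
    refine ⟨.here _, ?_⟩
    simp [insHom, appIso]
  | there b i ih =>
    obtain ⟨j, hj⟩ := ih
    refine ⟨.there b j, ?_⟩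
    rename_i l l'
    have hn := swap_nat (𝟙 (X a)) (𝟙 (X b)) (appIso X l m).hom
    simp only [id_tensorHom] at hn
    have h1 := congrArg (fun t => X b ◁ t) hj
    simp only [MonoidalCategory.whiskerLeft_comp] at h1
    have hs : swap (X a) (X b) (listTens X l) ▷ listTens X m ≫ (α_ _ _ _).hom ≫
        X b ◁ (α_ _ _ _).hom = (α_ _ _ _).hom ≫ X a ◁ (α_ _ _ _).hom ≫ swap _ _ _ := by
      simp only [swap]; monoidal
    simp only [insHom, appIso, comp_whiskerRight, Iso.trans_hom, whiskerLeftIso_hom,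
      Category.assoc, MonoidalCategory.whiskerLeft_comp]
    rw [associator_naturality_middle_assoc, h1, reassoc_of% hs]
    exact congrArg _ (congrArg _ (by rw [← Category.assoc, ← hn, Category.assoc]; rfl))

lemma permHom_append (X : J → V) {l₁ l₂ m₁ m₂ : List J} (p : LPerm l₁ l₂) (q : LPerm m₁ m₂) :
    ∃ r : LPerm (l₁ ++ m₁) (l₂ ++ m₂),
      (permHom X p ⊗ₘ permHom X q) ≫ (appIso X l₂ m₂).hom =
        (appIso X l₁ m₁).hom ≫ permHom X r := by
  induction p with
  | nil => exact ⟨q, by simp [permHom, appIso]⟩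
  | cons a p i ih =>
    obtain ⟨r, hr⟩ := ih
    obtain ⟨j, hj⟩ := insHom_append X i m₂
    refine ⟨.cons a r j, ?_⟩
    have h1 := congrArg (fun t => X a ◁ t) hr
    simp only [MonoidalCategory.whiskerLeft_comp] at h1
    simp only [permHom, appIso, Iso.trans_hom, whiskerLeftIso_hom, Category.assoc]
    rw [← reassoc_of% h1, tensorHom_def', tensorHom_def']
    simp only [comp_whiskerRight, Category.assoc, MonoidalCategory.whiskerLeft_comp]
    rw [hj]
    monoidal

/-- Two formal expressions that contain the same labels, each of them once. -/
structure Word.SameLeaves (w w' : Word J) : Prop where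
  nodup_left : w.leaves.Nodup
  nodup_right : w'.leaves.Nodup
  mem_iff : ∀ j, j ∈ w.leaves ↔ j ∈ w'.leaves

/-- The canonical isomorphism between the values of two formal expressions that contain the same
labels, each of them once. -/
noncomputable def can (X : J → V) (w w' : Word J) (h : w.SameLeaves w') : w.eval X ⟶ w'.eval X :=
  (w.norm X).hom ≫
    permHom X (Classical.choice (LPerm.exists_perm h.nodup_left h.nodup_right h.mem_iff)) ≫
    (w'.norm X).inv

lemma can_eq (X : J → V) (w w' : Word J) (h : w.SameLeaves w') (p : LPerm w.leaves w'.leaves) :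
    can X w w' h = (w.norm X).hom ≫ permHom X p ≫ (w'.norm X).inv := by
  have : Classical.choice (LPerm.exists_perm h.nodup_left h.nodup_right h.mem_iff) = p :=
    LPerm.unique _ p h.nodup_right
  rw [can, this]

lemma Word.SameLeaves.trans {w w' w'' : Word J} (h : w.SameLeaves w') (h' : w'.SameLeaves w'') :
    w.SameLeaves w'' :=
  ⟨h.1, h'.2, fun j => (h.3 j).trans (h'.3 j)⟩

lemma Word.SameLeaves.exists_perm {w w' : Word J} (h : w.SameLeaves w') :
    ∃ _ : LPerm w.leaves w'.leaves, True :=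
  ⟨Classical.choice (LPerm.exists_perm h.nodup_left h.nodup_right h.mem_iff), trivial⟩

lemma can_self (X : J → V) (w : Word J) (h : w.SameLeaves w) : can X w w h = 𝟙 _ := by
  obtain ⟨p, hp⟩ := permHom_id X w.leaves
  rw [can_eq X w w h p, hp]
  simp

lemma can_comp (X : J → V) {w w' w'' : Word J} (h : w.SameLeaves w') (h' : w'.SameLeaves w'') :
    can X w w' h ≫ can X w' w'' h' = can X w w'' (h.trans h') := by
  obtain ⟨p, -⟩ := h.exists_perm
  obtain ⟨q, -⟩ := h'.exists_perm
  obtain ⟨r, hr⟩ := permHom_comp X p q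
  rw [can_eq X w w' h p, can_eq X w' w'' h' q, can_eq X w w'' _ r, ← hr]
  simp

lemma can_tensor (X : J → V) {w₁ w₂ w₁' w₂' : Word J} (h₁ : w₁.SameLeaves w₁')
    (h₂ : w₂.SameLeaves w₂') (h : (w₁.tensor w₂).SameLeaves (w₁'.tensor w₂')) :
    can X (w₁.tensor w₂) (w₁'.tensor w₂') h = can X w₁ w₁' h₁ ⊗ₘ can X w₂ w₂' h₂ := by
  obtain ⟨p, -⟩ := h₁.exists_perm
  obtain ⟨q, -⟩ := h₂.exists_perm
  obtain ⟨r, hr⟩ := permHom_append X p q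
  rw [can_eq X _ _ h₁ p, can_eq X _ _ h₂ q, can_eq X _ _ h r]
  simp only [Word.norm, Iso.trans_hom, Iso.trans_inv, tensorIso_hom, tensorIso_inv, Category.assoc,
    ← tensorHom_comp_tensorHom]
  rw [← reassoc_of% hr, Iso.hom_inv_id_assoc]

lemma concatIso_nat (X : J → V) (k : ℕ) (g g' : Fin k → List J) (Y Y' : Fin k → V)
    (e : ∀ i, Y i ≅ listTens X (g i)) (e' : ∀ i, Y' i ≅ listTens X (g' i))
    (p : ∀ i, LPerm (g i) (g' i)) (f : ∀ i, Y i ⟶ Y' i)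
    (hf : ∀ i, f i = (e i).hom ≫ permHom X (p i) ≫ (e' i).inv) :
    ∃ r : LPerm (concat k g) (concat k g'),
      tensMap k f = (concatIso X k g Y e).hom ≫ permHom X r ≫ (concatIso X k g' Y' e').inv := by
  induction k with
  | zero => exact ⟨.nil, by simp [tensMap, permHom, concatIso]⟩
  | succ k ih =>
    obtain ⟨r, hr⟩ := ih _ _ _ _ (fun i => e i.succ) (fun i => e' i.succ) (fun i => p i.succ)
      (fun i => f i.succ) (fun i => hf i.succ)
    obtain ⟨s, hs⟩ := permHom_append X (p 0) r
    refine ⟨s, ?_⟩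
    simp only [tensMap, concatIso, Iso.trans_hom, Iso.trans_inv, tensorIso_hom, tensorIso_inv,
      Category.assoc]
    rw [← reassoc_of% hs, Iso.hom_inv_id_assoc, hr, hf]
    simp only [tensorHom_comp_tensorHom]

lemma can_prod (X : J → V) (k : ℕ) (f f' : Fin k → Word J) (hf : ∀ i, (f i).SameLeaves (f' i))
    (h : (Word.prod k f).SameLeaves (Word.prod k f')) :
    can X (.prod k f) (.prod k f') h = tensMap k (fun i => can X (f i) (f' i) (hf i)) := by
  choose p hp using fun i => (hf i).exists_perm
  obtain ⟨r, hr⟩ := concatIso_nat X k _ _ _ _ (fun i => (f i).norm X) (fun i => (f' i).norm X) p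
    (fun i => can X (f i) (f' i) (hf i)) (fun i => can_eq X _ _ (hf i) (p i))
  rw [hr, can_eq X _ _ h r]
  rfl

/-! Naturality in the family of objects. -/

/-- Functoriality of the value of a formal expression. -/
def Word.evalMap {X Y : J → V} (f : ∀ j, X j ⟶ Y j) : (w : Word J) → (w.eval X ⟶ w.eval Y)
  | .leaf j => f j
  | .tensor w w' => w.evalMap f ⊗ₘ w'.evalMap f
  | .prod k g => tensMap k (fun i => (g i).evalMap f)

def listMap {X Y : J → V} (f : ∀ j, X j ⟶ Y j) : (l : List J) → (listTens X l ⟶ listTens Y l)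
  | [] => 𝟙 _
  | a :: l => f a ⊗ₘ listMap f l

lemma insHom_nat {X Y : J → V} (f : ∀ j, X j ⟶ Y j) {a : J} {l l' : List J} (i : Ins a l l') :
    (f a ⊗ₘ listMap f l) ≫ insHom Y i = insHom X i ≫ listMap f l' := by
  induction i with
  | here l => simp [insHom, listMap]
  | there b i ih =>
    simp only [insHom, listMap, Category.assoc]
    rw [← Category.assoc, swap_nat, Category.assoc, ← id_tensorHom, ← id_tensorHom,
      tensorHom_comp_tensorHom, tensorHom_comp_tensorHom, ih, Category.id_comp, Category.comp_id]

lemma permHom_nat {X Y : J → V} (f : ∀ j, X j ⟶ Y j) {l l' : List J} (p : LPerm l l') :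
    listMap f l ≫ permHom Y p = permHom X p ≫ listMap f l' := by
  induction p with
  | nil => simp [permHom, listMap]
  | cons a p i ih =>
    simp only [permHom, listMap, Category.assoc]
    rw [← insHom_nat, ← id_tensorHom, ← id_tensorHom, ← Category.assoc, ← Category.assoc,
      tensorHom_comp_tensorHom, tensorHom_comp_tensorHom, ih, Category.id_comp, Category.comp_id]

lemma appIso_nat {X Y : J → V} (f : ∀ j, X j ⟶ Y j) (l l' : List J) :
    (listMap f l ⊗ₘ listMap f l') ≫ (appIso Y l l').hom =
      (appIso X l l').hom ≫ listMap f (l ++ l') := by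
  induction l with
  | nil => simp [listMap, appIso]
  | cons a l ih =>
    simp only [listMap, appIso, Iso.trans_hom, whiskerLeftIso_hom, Category.assoc]
    rw [associator_naturality_assoc, ← id_tensorHom, ← id_tensorHom, tensorHom_comp_tensorHom, ih]
    simp only [Category.comp_id]
    exact congrArg _ ((tensorHom_comp_tensorHom _ _ _ _).trans (by rw [Category.id_comp]; rfl)).symm

lemma concatIso_map {X Y : J → V} (f : ∀ j, X j ⟶ Y j) (k : ℕ) (g : Fin k → List J)
    (A B : Fin k → V) (e : ∀ i, A i ≅ listTens X (g i)) (e' : ∀ i, B i ≅ listTens Y (g i))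
    (φ : ∀ i, A i ⟶ B i) (h : ∀ i, φ i ≫ (e' i).hom = (e i).hom ≫ listMap f (g i)) :
    tensMap k φ ≫ (concatIso Y k g B e').hom = (concatIso X k g A e).hom ≫ listMap f _ := by
  induction k with
  | zero => simp [tensMap, concatIso, listMap, concat]
  | succ k ih =>
    simp only [tensMap, concatIso, Iso.trans_hom, tensorIso_hom, Category.assoc, concat]
    rw [← appIso_nat, tensorHom_comp_tensorHom_assoc, h, ih _ _ _ _ _ _ (fun i => h i.succ),
      tensorHom_comp_tensorHom_assoc]

lemma norm_nat {X Y : J → V} (f : ∀ j, X j ⟶ Y j) (w : Word J) :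
    w.evalMap f ≫ (w.norm Y).hom = (w.norm X).hom ≫ listMap f w.leaves := by
  induction w with
  | leaf j => simp [Word.evalMap, Word.norm, Word.leaves, listMap]
  | tensor w w' ih ih' =>
    simp only [Word.evalMap, Word.norm, Iso.trans_hom, tensorIso_hom, Category.assoc, Word.leaves]
    rw [← appIso_nat, tensorHom_comp_tensorHom_assoc, ih, ih', tensorHom_comp_tensorHom_assoc]
  | prod k g ih => exact concatIso_map f k _ _ _ _ _ _ ih

lemma can_nat {X Y : J → V} (f : ∀ j, X j ⟶ Y j) {w w' : Word J} (h : w.SameLeaves w') :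
    w.evalMap f ≫ can Y w w' h = can X w w' h ≫ w'.evalMap f := by
  obtain ⟨p, -⟩ := h.exists_perm
  rw [can_eq X _ _ h p, can_eq Y _ _ h p, ← cancel_mono (w'.norm Y).hom]
  simp only [Category.assoc, Iso.inv_hom_id, Category.comp_id]
  rw [norm_nat, Iso.inv_hom_id_assoc, ← permHom_nat, reassoc_of% (norm_nat f w)]

/-! Compatibility with relabelling. -/

/-- The identity from the value of a formal expression to the value of its relabelling. -/
def Word.relabel (X : J' → V) (θ : J → J') :
    (w : Word J) → (w.eval (fun j => X (θ j)) ⟶ (w.map θ).eval X)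
  | .leaf _ => 𝟙 _
  | .tensor w w' => w.relabel X θ ⊗ₘ w'.relabel X θ
  | .prod k g => tensMap k (fun i => (g i).relabel X θ)

def listRelabel (X : J' → V) (θ : J → J') :
    (l : List J) → (listTens (fun j => X (θ j)) l ⟶ listTens X (l.map θ))
  | [] => 𝟙 _
  | a :: l => X (θ a) ◁ listRelabel X θ l

lemma insHom_relabel (X : J' → V) (θ : J → J') {a : J} {l l' : List J} (i : Ins a l l') :
    ∃ j : Ins (θ a) (l.map θ) (l'.map θ),
      X (θ a) ◁ listRelabel X θ l ≫ insHom X j =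
        insHom (fun j => X (θ j)) i ≫ listRelabel X θ l' := by
  induction i with
  | here l => exact ⟨.here _, by simp [insHom, listRelabel]⟩
  | there b i ih =>
    rename_i m _
    obtain ⟨j, hj⟩ := ih
    refine ⟨.there _ j, ?_⟩
    have h1 := congrArg (fun t => X (θ b) ◁ t) hj
    simp only [MonoidalCategory.whiskerLeft_comp] at h1
    have hn := swap_nat (𝟙 (X (θ a))) (𝟙 (X (θ b))) (listRelabel X θ m)
    simp only [id_tensorHom] at hn
    simp only [insHom, listRelabel, Category.assoc]
    rw [reassoc_of% hn, h1]

lemma permHom_relabel (X : J' → V) (θ : J → J') {l l' : List J} (p : LPerm l l') :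
    ∃ q : LPerm (l.map θ) (l'.map θ),
      listRelabel X θ l ≫ permHom X q =
        permHom (fun j => X (θ j)) p ≫ listRelabel X θ l' := by
  induction p with
  | nil => exact ⟨.nil, by simp [permHom, listRelabel]⟩
  | cons a p i ih =>
    obtain ⟨q, hq⟩ := ih
    obtain ⟨j, hj⟩ := insHom_relabel X θ i
    refine ⟨.cons _ q j, ?_⟩
    have h1 := congrArg (fun t => X (θ a) ◁ t) hq
    simp only [MonoidalCategory.whiskerLeft_comp] at h1
    simp only [permHom, listRelabel, Category.assoc]
    rw [reassoc_of% h1, hj]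

lemma appIso_cast (X : J → V) {l₁ l₂ m₁ m₂ : List J} (h : l₁ = l₂) (h' : m₁ = m₂)
    (e : listTens X (l₁ ++ m₁) = listTens X (l₂ ++ m₂)) :
    (eqToHom (congrArg (listTens X) h) ⊗ₘ eqToHom (congrArg (listTens X) h')) ≫
      (appIso X l₂ m₂).hom = (appIso X l₁ m₁).hom ≫ eqToHom e := by
  subst h
  subst h'
  simp

lemma appIso_relabel (X : J' → V) (θ : J → J') (l m : List J)
    (e : listTens X (l.map θ ++ m.map θ) = listTens X ((l ++ m).map θ)) :
    (listRelabel X θ l ⊗ₘ listRelabel X θ m) ≫ (appIso X (l.map θ) (m.map θ)).hom ≫ eqToHom e =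
      (appIso (fun j => X (θ j)) l m).hom ≫ listRelabel X θ (l ++ m) := by
  induction l with
  | nil =>
    change (𝟙 _ ⊗ₘ listRelabel X θ m) ≫ (λ_ _).hom ≫ 𝟙 _ = (λ_ _).hom ≫ listRelabel X θ m
    simp
  | cons a l ih =>
    have h0 : l.map θ ++ m.map θ = (l ++ m).map θ := List.map_append.symm
    have h1 : eqToHom e = X (θ a) ◁ eqToHom (congrArg (listTens X) h0) := by
      rw [whiskerLeft_eqToHom]
    have ih := congrArg (fun t => X (θ a) ◁ t) (ih (congrArg (listTens X) h0))
    simp only [MonoidalCategory.whiskerLeft_comp] at ih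
    rw [h1]
    change ((X (θ a) ◁ listRelabel X θ l) ⊗ₘ listRelabel X θ m) ≫ ((α_ _ _ _).hom ≫
      X (θ a) ◁ (appIso X (l.map θ) (m.map θ)).hom) ≫ _ = ((α_ _ _ _).hom ≫
      X (θ a) ◁ (appIso (fun j => X (θ j)) l m).hom) ≫ X (θ a) ◁ listRelabel X θ (l ++ m)
    simp only [Category.assoc]
    rw [← id_tensorHom, associator_naturality_assoc, id_tensorHom]
    exact congrArg _ ih

lemma concatIso_relabel (X : J' → V) (θ : J → J') (k : ℕ) (g : Fin k → List J)
    (g' : Fin k → List J') (hg : ∀ i, (g i).map θ = g' i) (A B : Fin k → V)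
    (e : ∀ i, A i ≅ listTens (fun j => X (θ j)) (g i)) (e' : ∀ i, B i ≅ listTens X (g' i))
    (φ : ∀ i, A i ⟶ B i)
    (h : ∀ i, φ i ≫ (e' i).hom =
      (e i).hom ≫ listRelabel X θ (g i) ≫ eqToHom (congrArg (listTens X) (hg i)))
    (hc : listTens X ((concat k g).map θ) = listTens X (concat k g')) :
    tensMap k φ ≫ (concatIso X k g' B e').hom =
      (concatIso _ k g A e).hom ≫ listRelabel X θ _ ≫ eqToHom hc := by
  obtain rfl : (fun i => (g i).map θ) = g' := funext hg
  induction k with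
  | zero => simp [tensMap, concatIso, listRelabel, concat]
  | succ k ih =>
    have h0 := map_concat θ k (fun i => g i.succ)
    have ih := ih (fun i => g i.succ) _ _ (fun i => e i.succ) (fun i => φ i.succ)
      (fun i => rfl) (fun i => e' i.succ) (fun i => h i.succ) (congrArg (listTens X) h0)
    have hh := h 0
    have h2 := appIso_relabel X θ (g 0) (concat k (fun i => g i.succ))
      (congrArg (listTens X) List.map_append.symm)
    have h3 := appIso_cast X (rfl : (g 0).map θ = _) h0 (by rw [h0])
    simp only [eqToHom_refl, Category.comp_id] at hh h3
    simp only [tensMap, concatIso, Iso.trans_hom, tensorIso_hom, Category.assoc, concat]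
    rw [← reassoc_of% h2, tensorHom_comp_tensorHom_assoc, ih, hh, ← tensorHom_comp_tensorHom,
      Category.assoc]
    refine congrArg _ ?_
    rw [eqToHom_trans, ← Category.comp_id (listRelabel X θ (g 0)), ← tensorHom_comp_tensorHom,
      Category.assoc, h3, Category.comp_id]

lemma norm_relabel (X : J' → V) (θ : J → J') (w : Word J) :
    w.relabel X θ ≫ ((w.map θ).norm X).hom = (w.norm (fun j => X (θ j))).hom ≫
      listRelabel X θ w.leaves ≫ eqToHom (congrArg (listTens X) (w.leaves_map θ).symm) := by
  induction w with
  | leaf j => simp [Word.relabel, Word.norm, listRelabel, Word.map]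
  | tensor w w' ih ih' =>
    have h2 := appIso_relabel X θ w.leaves w'.leaves (congrArg (listTens X) List.map_append.symm)
    have h3 := appIso_cast X (w.leaves_map θ).symm (w'.leaves_map θ).symm
      (by rw [w.leaves_map, w'.leaves_map])
    simp only [Word.relabel, Word.norm, Iso.trans_hom, tensorIso_hom, Category.assoc, Word.leaves,
      Word.map]
    rw [← reassoc_of% h2, tensorHom_comp_tensorHom_assoc, ih, ih', ← tensorHom_comp_tensorHom,
      Category.assoc]
    refine congrArg _ ?_
    rw [← tensorHom_comp_tensorHom, Category.assoc, h3]
    refine congrArg _ (congrArg _ (eqToHom_trans _ _).symm)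
  | prod k g ih =>
    exact concatIso_relabel X θ k _ _ (fun i => ((g i).leaves_map θ).symm) _ _ _ _ _ ih _

lemma permHom_cast (X : J → V) {l₁ l₂ m₁ m₂ : List J} (h : l₁ = l₂) (h' : m₁ = m₂)
    (p : LPerm l₁ m₁) : ∃ q : LPerm l₂ m₂,
      eqToHom (congrArg (listTens X) h) ≫ permHom X q =
        permHom X p ≫ eqToHom (congrArg (listTens X) h') := by
  subst h
  subst h'
  exact ⟨p, by simp⟩

lemma can_relabel (X : J' → V) (θ : J → J') {w w' : Word J} (h : w.SameLeaves w')
    (h' : (w.map θ).SameLeaves (w'.map θ)) :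
    w.relabel X θ ≫ can X _ _ h' = can (fun j => X (θ j)) _ _ h ≫ w'.relabel X θ := by
  obtain ⟨p, -⟩ := h.exists_perm
  obtain ⟨q, hq⟩ := permHom_relabel X θ p
  obtain ⟨r, hr⟩ := permHom_cast X (w.leaves_map θ).symm (w'.leaves_map θ).symm q
  rw [can_eq _ _ _ h p, can_eq X _ _ h' r, ← cancel_mono ((w'.map θ).norm X).hom]
  simp only [Category.assoc, Iso.inv_hom_id, Category.comp_id]
  rw [norm_relabel, reassoc_of% (norm_relabel X θ w), hr, Iso.inv_hom_id_assoc, reassoc_of% hq]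

lemma Word.SameLeaves.map {θ : J → J'} (hθ : Function.Injective θ) {w w' : Word J}
    (h : w.SameLeaves w') : (w.map θ).SameLeaves (w'.map θ) where
  nodup_left := by rw [Word.leaves_map]; exact h.1.map hθ
  nodup_right := by rw [Word.leaves_map]; exact h.2.map hθ
  mem_iff j := by simp only [Word.leaves_map, List.mem_map, h.3]

lemma Word.SameLeaves.cons {a : J} {w w' : Word J} (h : w.SameLeaves w') (ha : a ∉ w.leaves) :
    (Word.tensor (.leaf a) w).SameLeaves (.tensor (.leaf a) w') where
  nodup_left := List.nodup_cons.2 ⟨ha, h.1⟩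
  nodup_right := List.nodup_cons.2 ⟨fun h' => ha ((h.3 a).2 h'), h.2⟩
  mem_iff j := by simp [h.3]

lemma Word.SameLeaves.refl {w : Word J} (h : w.leaves.Nodup) : w.SameLeaves w :=
  ⟨h, h, fun _ => Iff.rfl⟩

lemma can_relabel_leaves (X : J → V) (k : ℕ) (g g' : Fin k → J) (hg : ∀ i, g i = g' i)
    (w : Word J) (h : (Word.prod k (fun i => .leaf (g i))).SameLeaves w)
    (h' : (Word.prod k (fun i => .leaf (g' i))).SameLeaves w) :
    can X _ _ h = tensMap k (fun i => eqToHom (congrArg X (hg i))) ≫ can X _ _ h' := by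
  obtain rfl : g = g' := funext hg
  simp

end Coherence

section Fibres

/-! ### Fibres of maps between the ordinals `[n] = Fin n` -/

variable {n n' k k' : ℕ}

/-- The cardinality of the fibre of `f` over `i`. -/
def fibCard (f : Fin n → Fin k) (i : Fin k) : ℕ :=
  (Finset.univ.filter (fun a => f a = i)).card

/-- The order preserving inclusion of the fibre, `[n_i] → [n]`. -/
def fibIncl (f : Fin n → Fin k) (i : Fin k) (a : Fin (fibCard f i)) : Fin n :=
  Finset.orderEmbOfFin (Finset.univ.filter (fun a => f a = i)) rfl a

/-- The position in its fibre of an element. -/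
def fibIdx (f : Fin n → Fin k) (i : Fin k) (a : Fin n) (h : f a = i) : Fin (fibCard f i) :=
  (Finset.orderIsoOfFin (Finset.univ.filter (fun a => f a = i)) rfl).symm ⟨a, by simp [h]⟩

lemma fibIncl_strictMono (f : Fin n → Fin k) (i : Fin k) : StrictMono (fibIncl f i) :=
  (Finset.orderEmbOfFin _ _).strictMono

lemma fibIncl_injective (f : Fin n → Fin k) (i : Fin k) : Function.Injective (fibIncl f i) :=
  (fibIncl_strictMono f i).injective

lemma apply_fibIncl (f : Fin n → Fin k) (i : Fin k) (a : Fin (fibCard f i)) :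
    f (fibIncl f i a) = i := by
  have := Finset.orderEmbOfFin_mem (Finset.univ.filter (fun a => f a = i)) rfl a
  exact (Finset.mem_filter.1 this).2

@[simp] lemma fibIncl_fibIdx (f : Fin n → Fin k) (i : Fin k) (a : Fin n) (h : f a = i) :
    fibIncl f i (fibIdx f i a h) = a := by
  have := (Finset.orderIsoOfFin (Finset.univ.filter (fun a => f a = i)) rfl).apply_symm_apply
    ⟨a, by simp [h]⟩
  exact congrArg Subtype.val this

lemma fibIncl_congr (f : Fin n → Fin k) {i i' : Fin k} (h : i = i') (a : Fin (fibCard f i))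
    (b : Fin (fibCard f i')) (hab : a.val = b.val) : fibIncl f i a = fibIncl f i' b := by
  subst h
  rw [Fin.ext hab]

/-- The map between fibres that is induced by a map. -/
def fibMap (f : Fin n → Fin k) (i : Fin k) (f' : Fin n' → Fin k') (i' : Fin k')
    (h : Fin n → Fin n') (hh : ∀ a, f a = i → f' (h a) = i') (a : Fin (fibCard f i)) :
    Fin (fibCard f' i') :=
  fibIdx f' i' (h (fibIncl f i a)) (hh _ (apply_fibIncl f i a))

@[simp] lemma fibIncl_fibMap (f : Fin n → Fin k) (i : Fin k) (f' : Fin n' → Fin k') (i' : Fin k')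
    (h : Fin n → Fin n') (hh : ∀ a, f a = i → f' (h a) = i') (a : Fin (fibCard f i)) :
    fibIncl f' i' (fibMap f i f' i' h hh a) = h (fibIncl f i a) :=
  fibIncl_fibIdx _ _ _ _

/-- The bijection between fibres that is induced by a bijection. -/
def fibEquiv (f : Fin n → Fin k) (i : Fin k) (f' : Fin n' → Fin k') (i' : Fin k')
    (e : Fin n ≃ Fin n') (he : ∀ a, f a = i ↔ f' (e a) = i') :
    Fin (fibCard f i) ≃ Fin (fibCard f' i') where
  toFun := fibMap f i f' i' e (fun a => (he a).1)
  invFun := fibMap f' i' f i e.symm (fun a h => (he _).2 (by simpa using h))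
  left_inv a := fibIncl_injective _ _ (by simp)
  right_inv a := fibIncl_injective _ _ (by simp)

@[simp] lemma fibIncl_fibEquiv (f : Fin n → Fin k) (i : Fin k) (f' : Fin n' → Fin k')
    (i' : Fin k') (e : Fin n ≃ Fin n') (he : ∀ a, f a = i ↔ f' (e a) = i')
    (a : Fin (fibCard f i)) :
    fibIncl f' i' (fibEquiv f i f' i' e he a) = e (fibIncl f i a) :=
  fibIncl_fibMap f i f' i' e (fun a => (he a).1) a

lemma fibEquiv_eq (f : Fin n → Fin k) (i : Fin k) (f' : Fin n' → Fin k') (i' : Fin k')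
    (e : Fin n ≃ Fin n') (he : ∀ a, f a = i ↔ f' (e a) = i')
    (d : Fin (fibCard f i) ≃ Fin (fibCard f' i'))
    (h : ∀ a, fibIncl f' i' (d a) = e (fibIncl f i a)) : fibEquiv f i f' i' e he = d :=
  Equiv.ext fun a => fibIncl_injective _ _ ((fibIncl_fibEquiv f i f' i' e he a).trans (h a).symm)

lemma fibEquiv_trans {n'' k'' : ℕ} (f : Fin n → Fin k) (i : Fin k) (f' : Fin n' → Fin k')
    (i' : Fin k') (f'' : Fin n'' → Fin k'') (i'' : Fin k'') (e : Fin n ≃ Fin n')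
    (he : ∀ a, f a = i ↔ f' (e a) = i') (e' : Fin n' ≃ Fin n'')
    (he' : ∀ a, f' a = i' ↔ f'' (e' a) = i'') (e'' : Fin n ≃ Fin n'')
    (he'' : ∀ a, f a = i ↔ f'' (e'' a) = i'') (h : ∀ a, e'' a = e' (e a)) :
    (fibEquiv f i f' i' e he).trans (fibEquiv f' i' f'' i'' e' he') =
      fibEquiv f i f'' i'' e'' he'' :=
  (fibEquiv_eq _ _ _ _ _ _ _ fun a => by
    rw [Equiv.trans_apply, fibIncl_fibEquiv, fibIncl_fibEquiv, h]).symm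

lemma fibCard_congr (f : Fin n → Fin k) (i : Fin k) (f' : Fin n' → Fin k') (i' : Fin k')
    (e : Fin n ≃ Fin n') (he : ∀ a, f a = i ↔ f' (e a) = i') : fibCard f i = fibCard f' i' := by
  simpa using Fintype.card_congr (fibEquiv f i f' i' e he)

/-- A bijection that preserves the order of the fibres induces identities on the fibres. -/
lemma fibEquiv_eq_finCongr (f : Fin n → Fin k) (i : Fin k) (f' : Fin n' → Fin k')
    (i' : Fin k') (e : Fin n ≃ Fin n') (he : ∀ a, f a = i ↔ f' (e a) = i')
    (hm : ∀ a b, f a = i → f b = i → a ≤ b → e a ≤ e b) (h : fibCard f i = fibCard f' i') :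
    fibEquiv f i f' i' e he = finCongr h := by
  have mono : Monotone (fibEquiv f i f' i' e he) := fun a b hab =>
    (fibIncl_strictMono f' i').le_iff_le.1 (by
      simpa using hm _ _ (apply_fibIncl _ _ _) (apply_fibIncl _ _ _) ((fibIncl_strictMono f i).monotone hab))
  have sm := mono.strictMono_of_injective (fibEquiv f i f' i' e he).injective
  let o : Fin (fibCard f i) ≃o Fin (fibCard f' i') := sm.orderIsoOfSurjective _ (Equiv.surjective _)
  have : o = Fin.castOrderIso h := Subsingleton.elim _ _
  ext a
  exact congrArg Fin.val (congrArg (fun t : Fin (fibCard f i) ≃o Fin (fibCard f' i') => t a) this)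

lemma fibCard_id (i : Fin n) : fibCard (fun a => a) i = 1 := by
  simp [fibCard, Finset.filter_eq']

lemma fibCard_of_subsingleton (f : Fin n → Fin k) (hk : k = 1) (i : Fin k) : fibCard f i = n := by
  subst hk
  simp [fibCard, Subsingleton.elim _ i]

/-- The elements of the fibres are the elements of `[n]`. -/
lemma fibIncl_bijective (f : Fin n → Fin k) :
    Function.Bijective (fun p : Σ i, Fin (fibCard f i) => fibIncl f p.1 p.2) := by
  constructor
  · rintro ⟨i, a⟩ ⟨j, b⟩ h
    have hi : i = j := by simpa [apply_fibIncl] using congrArg f h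
    subst hi
    simpa using fibIncl_injective _ _ h
  · intro a
    exact ⟨⟨f a, fibIdx f _ a rfl⟩, by simp⟩

lemma fibMap_mono (f : Fin n → Fin k) (i : Fin k) (f' : Fin n' → Fin k') (i' : Fin k')
    (h : Fin n → Fin n') (hh : ∀ a, f a = i → f' (h a) = i')
    (hm : ∀ a b, f a = i → f b = i → a ≤ b → h a ≤ h b) : Monotone (fibMap f i f' i' h hh) :=
  fun a b hab => (fibIncl_strictMono f' i').le_iff_le.1 (by
    rw [fibIncl_fibMap, fibIncl_fibMap]
    exact hm _ _ (apply_fibIncl _ _ _) (apply_fibIncl _ _ _)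
      ((fibIncl_strictMono f i).monotone hab))

/-- The fibres of the map that is induced between fibres. -/
lemma fibCard_fibMap (f : Fin n → Fin k) (g : Fin k → Fin k') (i : Fin k')
    (j : Fin (fibCard g i)) :
    fibCard (fibMap (fun a => g (f a)) i g i f (fun _ h => h)) j = fibCard f (fibIncl g i j) := by
  refine Finset.card_bij (fun x _ => fibIncl (fun a => g (f a)) i x) ?_ ?_ ?_
  · intro x hx
    simp only [Finset.mem_filter, Finset.mem_univ, true_and] at hx ⊢
    rw [← hx, fibIncl_fibMap]
  · intro x _ y _ h
    exact fibIncl_injective _ _ h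
  · intro a ha
    simp only [Finset.mem_filter, Finset.mem_univ, true_and] at ha
    refine ⟨fibIdx (fun a => g (f a)) i a (by simp only [ha, apply_fibIncl]), ?_,
      fibIncl_fibIdx _ _ _ _⟩
    simp only [Finset.mem_filter, Finset.mem_univ, true_and]
    exact fibIncl_injective _ _ (by rw [fibIncl_fibMap, fibIncl_fibIdx, ha])

lemma fibIncl_cast_fibMap (f : Fin n → Fin k) (g : Fin k → Fin k') (i : Fin k')
    (j : Fin (fibCard g i)) (a : Fin (fibCard (fibMap (fun a => g (f a)) i g i f (fun _ h => h)) j)) :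
    fibIncl f (fibIncl g i j) (finCongr (fibCard_fibMap f g i j) a) =
      fibIncl (fun a => g (f a)) i (fibIncl (fibMap (fun a => g (f a)) i g i f (fun _ h => h)) j a) := by
  let d : Fin (fibCard f (fibIncl g i j)) → Fin n := fun a =>
    fibIncl (fun a => g (f a)) i (fibIncl (fibMap (fun a => g (f a)) i g i f (fun _ h => h)) j
      ((finCongr (fibCard_fibMap f g i j)).symm a))
  have hd : d = fibIncl f (fibIncl g i j) := by
    refine Finset.orderEmbOfFin_unique
      (s := Finset.univ.filter (fun a => f a = fibIncl g i j)) rfl (fun x => ?_) ?_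
    · simp only [Finset.mem_filter, Finset.mem_univ, true_and, d]
      have h := apply_fibIncl (fibMap (fun a => g (f a)) i g i f (fun _ h => h)) j
        ((finCongr (fibCard_fibMap f g i j)).symm x)
      have h' := congrArg (fibIncl g i) h
      rwa [fibIncl_fibMap] at h'
    · exact (fibIncl_strictMono _ _).comp ((fibIncl_strictMono _ _).comp
        (Fin.castOrderIso (fibCard_fibMap f g i j).symm).strictMono)
  rw [← hd]
  simp [d]

end Fibres

/-! ### Operads over a category with fibres -/

/-- A small category whose objects have a finite ordinal of tips and whose maps have fibres over
the tips of the codomain, which are again objects of the category. This is the common shape of the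
ordinals with order preserving maps and of the trees of a given height. -/
class FibredCategory (O : Type) extends Category.{0} O where
  /-- the number of tips -/
  card : O → ℕ
  /-- the action of a map on tips -/
  tips {T S : O} (f : T ⟶ S) : Fin (card T) → Fin (card S)
  tips_id (T : O) (a : Fin (card T)) : tips (𝟙 T) a = a
  tips_comp {T S R : O} (f : T ⟶ S) (g : S ⟶ R) (a : Fin (card T)) :
    tips (f ≫ g) a = tips g (tips f a)
  /-- the fibre over a tip -/
  fib {T S : O} (f : T ⟶ S) (i : Fin (card S)) : O
  card_fib {T S : O} (f : T ⟶ S) (i : Fin (card S)) : card (fib f i) = fibCard (tips f) i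
  /-- the map induced between the fibres over a tip -/
  fibMor {T S R : O} (f : T ⟶ S) (g : S ⟶ R) (i : Fin (card R)) : fib (f ≫ g) i ⟶ fib g i
  tips_fibMor {T S R : O} (f : T ⟶ S) (g : S ⟶ R) (i : Fin (card R))
    (a : Fin (card (fib (f ≫ g) i))) :
    fibIncl (tips g) i (Fin.cast (card_fib g i) (tips (fibMor f g i) a)) =
      tips f (fibIncl (tips (f ≫ g)) i (Fin.cast (card_fib (f ≫ g) i) a))
  fib_fibMor {T S R : O} (f : T ⟶ S) (g : S ⟶ R) (i : Fin (card R)) (j : Fin (card (fib g i))) :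
    fib (fibMor f g i) j = fib f (fibIncl (tips g) i (Fin.cast (card_fib g i) j))
  /-- the linear object -/
  U : O
  card_U : card U = 1
  fib_id (T : O) (i : Fin (card T)) : fib (𝟙 T) i = U
  /-- the map to the linear object -/
  toU (T : O) : T ⟶ U
  fib_toU (T : O) (i : Fin (card U)) : fib (toU T) i = T

namespace FibredCategory

variable {O : Type} [FibredCategory O]

/-- The inclusion of the tips of a fibre. -/
def fibTip {T S : O} (f : T ⟶ S) (i : Fin (card S)) (a : Fin (card (fib f i))) : Fin (card T) :=
  fibIncl (tips f) i (Fin.cast (card_fib f i) a)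

lemma fibTip_bijective {T S : O} (f : T ⟶ S) :
    Function.Bijective (fun p : Σ i, Fin (card (fib f i)) => fibTip f p.1 p.2) := by
  have := (fibIncl_bijective (tips f)).comp
    (Equiv.sigmaCongrRight fun i => finCongr (card_fib f i)).bijective
  exact this

end FibredCategory

section Shuffle

variable {V : Type u} [Category.{v} V] [MonoidalCategory V] [SymmetricCategory V]

lemma sameLeaves_perm {k k' : ℕ} (ρ : Fin k ≃ Fin k') :
    (Word.prod k (fun i => .leaf (ρ i))).SameLeaves (Word.prod k' (fun i => .leaf i)) where
  nodup_left := nodup_concat _ _ (by simp) (by simp)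
  nodup_right := nodup_concat _ _ (by simp) (by simp)
  mem_iff j := by
    simp only [Word.leaves, mem_concat, List.mem_singleton]
    exact ⟨fun _ => ⟨j, rfl⟩, fun _ => ⟨ρ.symm j, by simp⟩⟩

/-- The map `X 1 ⊗ ⋯ ⊗ X k ⟶ X' 1 ⊗ ⋯ ⊗ X' k'` that is given by `f i : X i ⟶ X' (ρ i)` and by the
symmetry of the permutation `ρ`. -/
noncomputable def tensPerm {k k' : ℕ} (ρ : Fin k ≃ Fin k') {X : Fin k → V} {X' : Fin k' → V}
    (f : ∀ i, X i ⟶ X' (ρ i)) : tens k X ⟶ tens k' X' :=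
  tensMap k f ≫ can X' (.prod k (fun i => .leaf (ρ i))) (.prod k' (fun i => .leaf i))
    (sameLeaves_perm ρ)

lemma tensPerm_refl {k : ℕ} {X X' : Fin k → V} (f : ∀ i, X i ⟶ X' i) :
    tensPerm (Equiv.refl _) f = tensMap k f := by
  have := can_self X' (.prod k (fun i => .leaf i)) (sameLeaves_perm (Equiv.refl _))
  exact (congrArg (fun t => tensMap k f ≫ t) this).trans (Category.comp_id _)

lemma tensPerm_comp {k k' k'' : ℕ} (ρ : Fin k ≃ Fin k') (ρ' : Fin k' ≃ Fin k'') {X : Fin k → V}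
    {X' : Fin k' → V} {X'' : Fin k'' → V} (f : ∀ i, X i ⟶ X' (ρ i))
    (g : ∀ i, X' i ⟶ X'' (ρ' i)) :
    tensPerm ρ f ≫ tensPerm ρ' g = tensPerm (ρ.trans ρ') (fun i => f i ≫ g (ρ i)) := by
  have hs : ((Word.prod k (fun i => .leaf (ρ i))).map ρ').SameLeaves
      ((Word.prod k' (fun i => .leaf i)).map ρ') :=
    ((sameLeaves_perm (ρ.trans ρ')).trans
      ⟨(sameLeaves_perm ρ').2, (sameLeaves_perm ρ').1, fun j => ((sameLeaves_perm ρ').3 j).symm⟩)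
  have h1 := can_nat g (sameLeaves_perm ρ)
  have h2 := can_relabel X'' ρ' (sameLeaves_perm ρ) hs
  have h3 := can_comp X'' hs (sameLeaves_perm ρ')
  simp only [Word.relabel, tensMap_id, Category.id_comp, Category.comp_id] at h2
  simp only [Word.evalMap] at h1
  simp only [tensPerm, Category.assoc]
  rw [← reassoc_of% h1, ← h2, h3, ← Category.assoc]
  exact congrArg (fun t => t ≫ can X'' (.prod k (fun i => .leaf (ρ' (ρ i))))
    (.prod k'' (fun i => .leaf i)) (sameLeaves_perm (ρ.trans ρ')))
    (tensMap_comp k f (fun i => g (ρ i)))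

lemma tensMap_tensPerm {k k' : ℕ} (ρ : Fin k ≃ Fin k') {X Y : Fin k → V} {X' : Fin k' → V}
    (g : ∀ i, X i ⟶ Y i) (f : ∀ i, Y i ⟶ X' (ρ i)) :
    tensMap k g ≫ tensPerm ρ f = tensPerm ρ (fun i => g i ≫ f i) := by
  rw [tensPerm, tensPerm, ← tensMap_comp, Category.assoc]

lemma tensPerm_tensMap {k k' : ℕ} (ρ : Fin k ≃ Fin k') {X : Fin k → V} {X' Y : Fin k' → V}
    (f : ∀ i, X i ⟶ X' (ρ i)) (g : ∀ i, X' i ⟶ Y i) :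
    tensPerm ρ f ≫ tensMap k' g = tensPerm ρ (fun i => f i ≫ g (ρ i)) := by
  rw [← tensPerm_refl]
  exact tensPerm_comp ρ (Equiv.refl _) f g

section

variable {k l : ℕ} (m : Fin k → ℕ) (inc : ∀ i, Fin (m i) → Fin l)

/-- The expression `Y ⊗ ((X 1 ⊗ Z 11 ⊗ Z 12 ⊗ ⋯) ⊗ (X 2 ⊗ Z 21 ⊗ Z 22 ⊗ ⋯) ⊗ ⋯)`. -/
abbrev shuffleSource : Word (Unit ⊕ (Fin k ⊕ Fin l)) :=
  .tensor (.leaf (.inl ())) (.prod k fun i => .tensor (.leaf (.inr (.inl i)))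
    (.prod (m i) fun j => .leaf (.inr (.inr (inc i j)))))

/-- The expression `(Y ⊗ (X 1 ⊗ X 2 ⊗ ⋯)) ⊗ (Z 1 ⊗ Z 2 ⊗ ⋯)`. -/
abbrev shuffleTarget (k l : ℕ) : Word (Unit ⊕ (Fin k ⊕ Fin l)) :=
  .tensor (.tensor (.leaf (.inl ())) (.prod k fun i => .leaf (.inr (.inl i))))
    (.prod l fun s => .leaf (.inr (.inr s)))

variable {m inc}

lemma sameLeaves_shuffle
    (hinc : Function.Bijective (fun p : Σ i, Fin (m i) => inc p.1 p.2)) :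
    (shuffleSource m inc).SameLeaves (shuffleTarget k l) where
  nodup_left := by
    simp only [Word.leaves, List.singleton_append, List.nodup_cons, mem_concat]
    refine ⟨by simp [mem_concat], nodup_concat _ _ (fun i => ?_) ?_⟩
    · rw [List.nodup_cons]
      refine ⟨by simp [mem_concat], nodup_concat _ _ (by simp) ?_⟩
      intro j j' a ha ha'
      simp only [List.mem_singleton] at ha ha'
      have h : inc i j = inc i j' := by simpa using ha.symm.trans ha'
      simpa using hinc.1 (a₁ := ⟨i, j⟩) (a₂ := ⟨i, j'⟩) h
    · intro i i' a ha ha'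
      simp only [List.mem_cons, mem_concat, List.not_mem_nil, or_false] at ha ha'
      rcases ha with rfl | ⟨j, rfl⟩
      · rcases ha' with ha' | ⟨j', ha'⟩
        · simpa using ha'
        · simp at ha'
      · rcases ha' with ha' | ⟨j', ha'⟩
        · simp at ha'
        · have h : inc i j = inc i' j' := by simpa using ha'
          exact congrArg Sigma.fst (hinc.1 (a₁ := ⟨i, j⟩) (a₂ := ⟨i', j'⟩) h)
  nodup_right := by
    simp only [Word.leaves, List.cons_append, List.nodup_cons]
    refine ⟨by simp [mem_concat], ?_⟩
    rw [List.nodup_append]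
    refine ⟨nodup_concat _ _ (by simp) (by simp), nodup_concat _ _ (by simp) (by simp), ?_⟩
    rintro a ha b hb rfl
    obtain ⟨i, hi⟩ := (mem_concat _ _ _).1 ha
    obtain ⟨j, hj⟩ := (mem_concat _ _ _).1 hb
    simp only [List.mem_singleton] at hi hj
    simp [hi] at hj
  mem_iff a := by
    have h1 : a ∈ (shuffleSource m inc).leaves ↔ a = .inl () ∨ ∃ i, a = .inr (.inl i) ∨
        ∃ j, a = .inr (.inr (inc i j)) := by simp [mem_concat]
    have h2 : a ∈ (shuffleTarget k l).leaves ↔ a = .inl () ∨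
        (∃ i, a = .inr (.inl i)) ∨ ∃ s, a = .inr (.inr s) := by simp [mem_concat]
    rw [h1, h2]
    refine or_congr Iff.rfl ?_
    constructor
    · rintro ⟨i, rfl | ⟨j, rfl⟩⟩
      · exact Or.inl ⟨i, rfl⟩
      · exact Or.inr ⟨_, rfl⟩
    · rintro (⟨i, rfl⟩ | ⟨s, rfl⟩)
      · exact ⟨i, Or.inl rfl⟩
      · obtain ⟨⟨i, j⟩, rfl⟩ := hinc.2 s
        exact ⟨i, Or.inr ⟨j, rfl⟩⟩

/-- The canonical isomorphism from `Y ⊗ ((X 1 ⊗ Z 11 ⊗ Z 12 ⊗ ⋯) ⊗ (X 2 ⊗ Z 21 ⊗ Z 22 ⊗ ⋯) ⊗ ⋯)` to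
`(Y ⊗ (X 1 ⊗ X 2 ⊗ ⋯)) ⊗ (Z 1 ⊗ Z 2 ⊗ ⋯)`, where the families `Z i1, Z i2, …` form a partition of the
family `Z` according to `inc`. -/
noncomputable def shuffle (hinc : Function.Bijective (fun p : Σ i, Fin (m i) => inc p.1 p.2))
    (Y : V) (X : Fin k → V) (Z : Fin l → V) :
    Y ⊗ tens k (fun i => X i ⊗ tens (m i) (fun j => Z (inc i j))) ⟶
      (Y ⊗ tens k X) ⊗ tens l Z :=
  can (Sum.elim (fun _ => Y) (Sum.elim X Z)) (shuffleSource m inc) (shuffleTarget k l)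
    (sameLeaves_shuffle hinc)

end

lemma shuffle_nat {k l l' : ℕ} {m m' : Fin k → ℕ} {inc : ∀ i, Fin (m i) → Fin l}
    {inc' : ∀ i, Fin (m' i) → Fin l'}
    (hinc : Function.Bijective (fun p : Σ i, Fin (m i) => inc p.1 p.2))
    (hinc' : Function.Bijective (fun p : Σ i, Fin (m' i) => inc' p.1 p.2))
    {Y Y' : V} (y : Y ⟶ Y') {X X' : Fin k → V} (x : ∀ i, X i ⟶ X' i) {Z : Fin l → V}
    {Z' : Fin l' → V} (ρ : Fin l ≃ Fin l') (ρi : ∀ i, Fin (m i) ≃ Fin (m' i))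
    (hρ : ∀ i j, inc' i (ρi i j) = ρ (inc i j)) (z : ∀ s, Z s ⟶ Z' (ρ s))
    (zi : ∀ i j, Z (inc i j) ⟶ Z' (inc' i (ρi i j)))
    (hz : ∀ i j, zi i j = z (inc i j) ≫ eqToHom (congrArg Z' (hρ i j).symm)) :
    (y ⊗ₘ tensMap k (fun i => x i ⊗ₘ tensPerm (ρi i) (zi i))) ≫ shuffle hinc' Y' X' Z' =
      shuffle hinc Y X Z ≫ ((y ⊗ₘ tensMap k x) ⊗ₘ tensPerm ρ z) := by
  let θ : Unit ⊕ (Fin k ⊕ Fin l) → Unit ⊕ (Fin k ⊕ Fin l') := Sum.map id (Sum.map id ρ)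
  let W : Unit ⊕ (Fin k ⊕ Fin l) → V := Sum.elim (fun _ => Y) (Sum.elim X Z)
  let W' : Unit ⊕ (Fin k ⊕ Fin l') → V := Sum.elim (fun _ => Y') (Sum.elim X' Z')
  let F : ∀ j, W j ⟶ W' (θ j) := fun j =>
    match j with
    | .inl _ => y
    | .inr (.inl i) => x i
    | .inr (.inr s) => z s
  have hθ : Function.Injective θ :=
    Function.Injective.sumMap Function.injective_id
      (Function.Injective.sumMap Function.injective_id ρ.injective)
  have hw := sameLeaves_shuffle hinc
  have hw' := sameLeaves_shuffle hinc'
  have hT0 : (Word.prod l (fun i => .leaf (ρ i)) : Word (Fin l')).SameLeaves _ :=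
    sameLeaves_perm ρ
  have hT : ((shuffleTarget k l).map θ).SameLeaves (shuffleTarget k l') := by
    refine ⟨?_, hw'.2, ?_⟩
    · rw [Word.leaves_map]
      exact hw.2.map hθ
    · rintro (a | i | s)
      · simp [θ]
      · simp [mem_concat, θ]
      · simp [mem_concat, θ, ρ.exists_congr_left]
  have hw2 : ((shuffleSource m inc).map θ).SameLeaves ((shuffleTarget k l).map θ) := hw.map hθ
  have hS : ((shuffleSource m inc).map θ).SameLeaves (shuffleSource m' inc') :=
    (hw2.trans hT).trans ⟨hw'.2, hw'.1, fun j => (hw'.3 j).symm⟩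
  have e1 : (y ⊗ₘ tensMap k (fun i => x i ⊗ₘ tensPerm (ρi i) (zi i))) =
      (shuffleSource m inc).evalMap F ≫ can W' _ _ hS := by
    have hi : ∀ i, (Word.prod (m i) (fun j => .leaf (.inr (.inr (inc' i (ρi i j))))) :
        Word (Unit ⊕ (Fin k ⊕ Fin l'))).SameLeaves
        (.prod (m' i) (fun j => .leaf (.inr (.inr (inc' i j))))) := fun i =>
      (sameLeaves_perm (ρi i)).map
        (θ := fun s => (.inr (.inr (inc' i s)) : Unit ⊕ (Fin k ⊕ Fin l')))
        (Sum.inr_injective.comp (Sum.inr_injective.comp fun a b h => by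
          simpa using hinc'.1 (a₁ := ⟨i, a⟩) (a₂ := ⟨i, b⟩) h))
    have hi' : ∀ i, (Word.prod (m i) (fun j => .leaf (.inr (.inr (ρ (inc i j))))) :
        Word (Unit ⊕ (Fin k ⊕ Fin l'))).SameLeaves
        (.prod (m' i) (fun j => .leaf (.inr (.inr (inc' i j))))) := fun i => by
      simpa only [hρ] using hi i
    have hj : ∀ i, (Word.tensor (.leaf (.inr (.inl i)))
        (.prod (m i) (fun j => .leaf (.inr (.inr (ρ (inc i j)))))) :
        Word (Unit ⊕ (Fin k ⊕ Fin l'))).SameLeaves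
        (.tensor (.leaf (.inr (.inl i))) (.prod (m' i) (fun j => .leaf (.inr (.inr (inc' i j)))))) :=
      fun i => (hi' i).cons (by simp [mem_concat])
    have hk : (Word.prod k (fun i => .tensor (.leaf (.inr (.inl i)))
        (.prod (m i) (fun j => .leaf (.inr (.inr (ρ (inc i j))))))) :
        Word (Unit ⊕ (Fin k ⊕ Fin l'))).SameLeaves
        (.prod k fun i => .tensor (.leaf (.inr (.inl i)))
          (.prod (m' i) (fun j => .leaf (.inr (.inr (inc' i j)))))) :=
      ⟨(List.nodup_cons.1 hS.1).2, (List.nodup_cons.1 hS.2).2, fun a => by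
        simp only [Word.leaves, mem_concat]
        exact exists_congr fun i => (hj i).3 a⟩
    have c1 : can W' _ _ hS = can W' _ _ (Word.SameLeaves.refl (by simp)) ⊗ₘ can W' _ _ hk :=
      can_tensor W' _ hk hS
    have c2 := can_prod W' k _ _ hj hk
    have c3 : ∀ i, can W' _ _ (hj i) =
        can W' _ _ (Word.SameLeaves.refl (by simp)) ⊗ₘ can W' _ _ (hi' i) :=
      fun i => can_tensor W' _ (hi' i) (hj i)
    have c4 : ∀ i, can W' _ _ (hi' i) = tensMap (m i)
        (X := fun j => Z' (ρ (inc i j))) (Y := fun j => Z' (inc' i (ρi i j)))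
        (fun j => eqToHom (congrArg Z' (hρ i j).symm)) ≫ can W' _ _ (hi i) := fun i =>
      can_relabel_leaves W' (m i) (fun j => .inr (.inr (ρ (inc i j))))
        (fun j => .inr (.inr (inc' i (ρi i j)))) (fun j => by rw [hρ]) _ (hi' i) (hi i)
    have c5 : ∀ i, can W' _ _ (hi i) = can (fun s => Z' (inc' i s)) _ _ (sameLeaves_perm (ρi i)) :=
      fun i => by
        have := can_relabel W' (fun s => .inr (.inr (inc' i s))) (sameLeaves_perm (ρi i)) (hi i)
        simp only [Word.relabel, tensMap_id, Category.id_comp, Category.comp_id] at this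
        exact this
    rw [c1, can_self, c2]
    refine Eq.trans ?_ (tensorHom_comp_tensorHom _ _ _ _).symm
    refine congrArg₂ (fun a b => a ⊗ₘ b) (Category.comp_id _).symm ?_
    refine Eq.trans ?_ (tensMap_comp k _ _).symm
    refine congrArg (tensMap k) (funext fun i => ?_)
    rw [c3, can_self]
    refine Eq.trans ?_ (tensorHom_comp_tensorHom _ _ _ _).symm
    refine congrArg₂ (fun a b => a ⊗ₘ b) (Category.comp_id _).symm ?_
    rw [c4, c5]
    refine Eq.trans ?_ (Category.assoc _ _ _)
    refine congrArg (fun t => t ≫ can (fun s => Z' (inc' i s)) _ _ (sameLeaves_perm (ρi i))) ?_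
    refine Eq.trans ?_ (tensMap_comp (m i) _ _).symm
    exact congrArg (tensMap (m i)) (funext fun j => hz i j)
  have e2 : ((y ⊗ₘ tensMap k x) ⊗ₘ tensPerm ρ z) =
      (shuffleTarget k l).evalMap F ≫ can W' _ _ hT := by
    have hA : (Word.tensor (.leaf (.inl ())) (.prod k fun i => .leaf (.inr (.inl i))) :
        Word (Unit ⊕ (Fin k ⊕ Fin l'))).SameLeaves _ := Word.SameLeaves.refl (by
      have := hw'.2
      simp only [Word.leaves] at this
      exact (List.nodup_append.1 this).1)
    have hB := hT0.map (θ := fun s => (.inr (.inr s) : Unit ⊕ (Fin k ⊕ Fin l')))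
      (Sum.inr_injective.comp Sum.inr_injective)
    have c1 : can W' _ _ hT = can W' _ _ hA ⊗ₘ can W' _ _ hB := can_tensor W' hA hB hT
    have c2 := can_relabel W' (fun s => .inr (.inr s)) hT0 hB
    simp only [Word.relabel, tensMap_id, Category.id_comp, Category.comp_id] at c2
    rw [c1, can_self, c2]
    refine Eq.trans ?_ (tensorHom_comp_tensorHom _ _ _ _).symm
    exact congrArg (fun t => t ⊗ₘ tensPerm ρ z) (Category.comp_id _).symm
  have h1 := can_nat F hw
  have h2 := can_relabel W' θ hw hw2
  have r1 : (shuffleSource m inc).relabel W' θ = 𝟙 _ := by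
    simp only [Word.relabel, tensMap_id, id_tensorHom_id]
  have r2 : (shuffleTarget k l).relabel W' θ = 𝟙 _ := by
    simp only [Word.relabel, tensMap_id, id_tensorHom_id]
  have h2' : can (fun j => W' (θ j)) _ _ hw = can W' _ _ hw2 := by
    rw [r1, r2] at h2
    exact (Category.comp_id _).symm.trans (h2.symm.trans (Category.id_comp _))
  refine (congrArg (fun t => t ≫ can W' _ _ hw') e1).trans (Eq.trans ?_
    (congrArg (fun t => can W _ _ hw ≫ t) e2.symm))
  calc ((shuffleSource m inc).evalMap F ≫ can W' _ _ hS) ≫ can W' _ _ hw'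
      = (shuffleSource m inc).evalMap F ≫ can W' _ _ (hS.trans hw') := by
        rw [Category.assoc, can_comp]
    _ = (shuffleSource m inc).evalMap F ≫ can W' _ _ hw2 ≫ can W' _ _ hT := by
        rw [can_comp]
    _ = ((shuffleSource m inc).evalMap F ≫ can (fun j => W' (θ j)) _ _ hw) ≫ can W' _ _ hT := by
        rw [h2', Category.assoc]
    _ = can W _ _ hw ≫ (shuffleTarget k l).evalMap F ≫ can W' _ _ hT := by
        rw [h1, Category.assoc]

end Shuffle

open FibredCategory

section OperadDefs

variable {V : Type u} [Category.{v} V] [MonoidalCategory V] [SymmetricCategory V]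

/-- An operad structure on a collection of objects that is indexed by the objects of `O`. -/
structure OperadStr (O : Type) [FibredCategory O] (A : O → V) where
  /-- the unit -/
  unit : 𝟙_ V ⟶ A U
  /-- the multiplication, one for each map -/
  mul {T S : O} (f : T ⟶ S) : A S ⊗ tens (card S) (fun i => A (fib f i)) ⟶ A T
  assoc {T S R : O} (f : T ⟶ S) (g : S ⟶ R) :
    shuffle (fibTip_bijective g) (A R) (fun i => A (fib g i)) (fun s => A (fib f s)) ≫
        (mul g ▷ _) ≫ mul f =
      (A R ◁ tensMap (card R) (fun i =>
        (A (fib g i) ◁ tensMap _ (fun j => eqToHom (congrArg A (fib_fibMor f g i j).symm))) ≫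
          mul (fibMor f g i))) ≫ mul (f ≫ g)
  mul_id (T : O) :
    (A T ◁ tensMap (card T) (fun i => unit ≫ eqToHom (congrArg A (fib_id T i).symm))) ≫
        mul (𝟙 T) = (A T ◁ tensUnit (card T)) ≫ (ρ_ (A T)).hom
  mul_toU (T : O) :
    (unit ⊗ₘ (tensOne (A T) (card (U : O)) card_U ≫
        tensMap _ (fun i => eqToHom (congrArg A (fib_toU T i).symm)))) ≫ mul (toU T) =
      (λ_ (A T)).hom

variable (V) in
/-- Operads over `O` in `V`. -/
structure Operad (O : Type) [FibredCategory O] where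
  obj : O → V
  str : OperadStr O obj

/-- A levelwise map that preserves the unit and the multiplication. -/
structure OperadStr.IsHom {O : Type} [FibredCategory O] {A B : O → V} (a : OperadStr O A)
    (b : OperadStr O B) (f : ∀ T, A T ⟶ B T) : Prop where
  unit : a.unit ≫ f U = b.unit
  mul {T S : O} (h : T ⟶ S) :
    a.mul h ≫ f T = (f S ⊗ₘ tensMap (card S) (fun i => f (fib h i))) ≫ b.mul h

lemma OperadStr.IsHom.comp {O : Type} [FibredCategory O] {A B C : O → V} {a : OperadStr O A}
    {b : OperadStr O B} {c : OperadStr O C} {f : ∀ T, A T ⟶ B T} {g : ∀ T, B T ⟶ C T}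
    (hf : a.IsHom b f) (hg : b.IsHom c g) : a.IsHom c (fun T => f T ≫ g T) where
  unit := by rw [← Category.assoc, hf.unit, hg.unit]
  mul h := by
    rw [← Category.assoc, hf.mul, Category.assoc, hg.mul, ← Category.assoc,
      tensorHom_comp_tensorHom, tensMap_comp]

lemma OperadStr.IsHom.id {O : Type} [FibredCategory O] {A : O → V} (a : OperadStr O A) :
    a.IsHom a (fun T => 𝟙 _) where
  unit := by simp
  mul h := by simp

/-- Morphisms of operads. -/
@[ext]
structure Operad.Hom {O : Type} [FibredCategory O] (A B : Operad V O) where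
  app (T : O) : A.obj T ⟶ B.obj T
  isHom : OperadStr.IsHom A.str B.str app

instance {O : Type} [FibredCategory O] : Category (Operad V O) where
  Hom := Operad.Hom
  id A := ⟨fun T => 𝟙 _, .id _⟩
  comp f g := ⟨fun T => f.app T ≫ g.app T, f.isHom.comp g.isHom⟩
  id_comp f := Operad.Hom.ext (funext fun T => Category.id_comp _)
  comp_id f := Operad.Hom.ext (funext fun T => Category.comp_id _)
  assoc f g h := Operad.Hom.ext (funext fun T => Category.assoc _ _ _)

variable (V) in
/-- The forgetful functor from operads to collections, i.e. families of objects. -/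
def Operad.forget (O : Type) [FibredCategory O] : Operad V O ⥤ (O → V) where
  obj A := A.obj
  map f := f.app

/-! ### Left symmetric operads -/

/-- The ordinals `[n]`, with bijections as morphisms. -/
structure FinBij : Type where
  len : ℕ

instance : Category FinBij where
  Hom a b := Fin a.len ≃ Fin b.len
  id a := Equiv.refl _
  comp e e' := e.trans e'

/-- The ordinals `[n]`, with order preserving maps as morphisms. -/
@[ext]
structure FinMono : Type where
  len : ℕ

/-- The fibres of an order preserving map `[n] → [k]` are the ordinals `[n_i]`. -/
instance : FibredCategory FinMono where
  Hom a b := Fin a.len →o Fin b.len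
  id a := OrderHom.id
  comp f g := g.comp f
  card a := a.len
  tips f := f
  tips_id _ _ := rfl
  tips_comp _ _ _ := rfl
  fib f i := ⟨fibCard f i⟩
  card_fib _ _ := rfl
  fibMor f g i := ⟨fibMap (fun a => g (f a)) i g i f (fun _ h => h),
    fibMap_mono _ _ _ _ _ _ (fun _ _ _ _ h => f.monotone h)⟩
  tips_fibMor f g i a := fibIncl_fibMap (fun a => g (f a)) i g i f (fun _ h => h) a
  fib_fibMor f g i j := congrArg FinMono.mk (fibCard_fibMap f g i j)
  U := ⟨1⟩
  card_U := rfl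
  fib_id T i := congrArg FinMono.mk (fibCard_id i)
  toU a := ⟨fun _ => 0, fun _ _ _ => le_rfl⟩
  fib_toU T i := congrArg FinMono.mk (fibCard_of_subsingleton _ rfl i)

variable (V) in
/-- Left symmetric operads in `V`: a functor from the category of the ordinals `[n]` and bijections,
together with a unit and a multiplication for each order preserving map, which satisfy the
associativity and the unit axioms and two equivariance conditions. -/
structure SymOperad where
  coll : FinBij ⥤ V
  str : OperadStr FinMono (fun a => coll.obj ⟨a.len⟩)
  /-- Equivariance with respect to permutations of the fibres. -/
  equivariance_base {n n' k k' : ℕ} (σ : Fin n →o Fin k) (σ' : Fin n' →o Fin k')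
    (π : Fin n ≃ Fin n') (ρ : Fin k ≃ Fin k') (h : ∀ a, σ' (π a) = ρ (σ a))
    (hπ : ∀ a b, σ a = σ b → a ≤ b → π a ≤ π b) :
    str.mul (T := ⟨n⟩) (S := ⟨k⟩) σ ≫ coll.map (X := ⟨n⟩) (Y := ⟨n'⟩) π =
      (coll.map (X := ⟨k⟩) (Y := ⟨k'⟩) ρ ⊗ₘ tensPerm ρ (fun i =>
        eqToHom (congrArg (fun m => coll.obj ⟨m⟩)
          (fibCard_congr σ i σ' (ρ i) π (fun a => by simp [h]))))) ≫
      str.mul (T := ⟨n'⟩) (S := ⟨k'⟩) σ'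
  /-- Equivariance with respect to permutations inside the fibres. -/
  equivariance_fib {n n' n'' k : ℕ} (η : Fin n →o Fin k) (η' : Fin n' →o Fin k)
    (σ : Fin n'' ≃ Fin n) (σ' : Fin n'' ≃ Fin n') (h : ∀ a, η (σ a) = η' (σ' a)) :
    (coll.obj ⟨k⟩ ◁ tensMap k (fun i => coll.map (X := ⟨_⟩) (Y := ⟨_⟩)
        (fibEquiv (fun a => η (σ a)) i η i σ (fun _ => Iff.rfl)))) ≫
        str.mul (T := ⟨n⟩) (S := ⟨k⟩) η ≫ coll.map (X := ⟨n⟩) (Y := ⟨n''⟩) σ.symm =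
      (coll.obj ⟨k⟩ ◁ tensMap k (fun i => coll.map (X := ⟨_⟩) (Y := ⟨_⟩)
        (fibEquiv (fun a => η (σ a)) i η' i σ' (fun a => by rw [h])))) ≫
        str.mul (T := ⟨n'⟩) (S := ⟨k⟩) η' ≫ coll.map (X := ⟨n'⟩) (Y := ⟨n''⟩) σ'.symm

namespace SymOperad

/-- Morphisms of left symmetric operads. -/
@[ext]
structure Hom (A B : SymOperad V) where
  app : A.coll ⟶ B.coll
  isHom : OperadStr.IsHom A.str B.str (fun a => app.app ⟨a.len⟩)

instance : Category (SymOperad V) where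
  Hom := Hom
  id A := ⟨𝟙 _, .id _⟩
  comp f g := ⟨f.app ≫ g.app, f.isHom.comp g.isHom⟩
  id_comp f := Hom.ext (Category.id_comp _)
  comp_id f := Hom.ext (Category.comp_id _)
  assoc f g h := Hom.ext (Category.assoc _ _ _)

variable (V) in
/-- The forgetful functor from left symmetric operads to nonsymmetric collections. -/
def forget : SymOperad V ⥤ (ℕ → V) where
  obj A := fun n => A.coll.obj ⟨n⟩
  map {A B} f := fun n => (show Hom A B from f).app.app ⟨n⟩

variable (A : SymOperad V)

/-- The object `A_n`. -/
abbrev ob (n : ℕ) : V := A.coll.obj ⟨n⟩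

/-- The action of a bijection. -/
abbrev act {n m : ℕ} (e : Fin n ≃ Fin m) : A.ob n ⟶ A.ob m := A.coll.map (X := ⟨n⟩) (Y := ⟨m⟩) e

/-- The multiplication for an order preserving map. -/
abbrev monoMul {n k : ℕ} (η : Fin n → Fin k) (h : Monotone η) :
    A.ob k ⊗ tens k (fun i => A.ob (fibCard η i)) ⟶ A.ob n :=
  A.str.mul (T := ⟨n⟩) (S := ⟨k⟩) ⟨η, h⟩

lemma act_trans {n m l : ℕ} (e : Fin n ≃ Fin m) (e' : Fin m ≃ Fin l) :
    A.act e ≫ A.act e' = A.act (e.trans e') :=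
  (A.coll.map_comp (X := ⟨n⟩) (Y := ⟨m⟩) (Z := ⟨l⟩) e e').symm

lemma act_refl (n : ℕ) : A.act (Equiv.refl (Fin n)) = 𝟙 _ := A.coll.map_id ⟨n⟩

lemma act_finCongr {n m : ℕ} (h : n = m) :
    A.act (finCongr h) = eqToHom (congrArg A.ob h) := by
  subst h
  exact A.act_refl n

/-- The bijection `[n] → [n']`, `n' = n`, which is denoted by `π(τ)` in the factorisation
`τ = ν(τ) ∘ π(τ)` into a bijection that preserves the order of the fibres of `τ`, followed by an
order preserving map. -/
def piPart {n k : ℕ} (τ : Fin n → Fin k) : Fin n ≃ Fin n := (Tuple.sort τ).symm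

/-- The order preserving map `ν(τ)` of the factorisation `τ = ν(τ) ∘ π(τ)`. -/
def nuPart {n k : ℕ} (τ : Fin n → Fin k) : Fin n → Fin k := fun a => τ ((piPart τ).symm a)

lemma nuPart_piPart {n k : ℕ} (τ : Fin n → Fin k) (a : Fin n) : nuPart τ (piPart τ a) = τ a := by
  simp [nuPart]

lemma nuPart_mono {n k : ℕ} (τ : Fin n → Fin k) : Monotone (nuPart τ) := Tuple.monotone_sort τ

lemma piPart_mono {n k : ℕ} (τ : Fin n → Fin k) (a b : Fin n) (h : τ a = τ b) (hab : a ≤ b) :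
    piPart τ a ≤ piPart τ b := by
  by_contra hlt
  have := (Tuple.eq_sort_iff.1 (rfl : Tuple.sort τ = Tuple.sort τ)).2 _ _ (not_le.1 hlt)
    (by simpa [piPart] using h.symm)
  simp only [piPart, Equiv.apply_symm_apply] at this
  exact absurd hab (not_le.2 this)

lemma fibCard_nuPart {n k : ℕ} (τ : Fin n → Fin k) (i : Fin k) :
    fibCard τ i = fibCard (nuPart τ) i :=
  fibCard_congr _ _ _ _ (piPart τ) (fun a => by rw [nuPart_piPart])

/-- The multiplication for an arbitrary map `τ : [n] → [k]`: the composite of the multiplication for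
`ν(τ)` and the action of the inverse of `π(τ)`. -/
def mapMul {n k : ℕ} (τ : Fin n → Fin k) :
    A.ob k ⊗ tens k (fun i => A.ob (fibCard τ i)) ⟶ A.ob n :=
  (A.ob k ◁ tensMap k (fun i => eqToHom (congrArg A.ob (fibCard_nuPart τ i)))) ≫
    A.monoMul (nuPart τ) (nuPart_mono τ) ≫ A.act (piPart τ).symm

/-- The multiplication for `τ` can be computed from any factorisation of `τ`. -/
lemma mapMul_eq {n n' k : ℕ} (τ : Fin n → Fin k) (η : Fin n' → Fin k) (hη : Monotone η)
    (σ : Fin n ≃ Fin n') (h : ∀ a, τ a = η (σ a)) :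
    A.mapMul τ = (A.ob k ◁ tensMap k (fun i =>
      A.act (fibEquiv τ i η i σ (fun a => by rw [h])))) ≫ A.monoMul η hη ≫ A.act σ.symm := by
  obtain rfl : τ = fun a => η (σ a) := funext h
  have := A.equivariance_fib ⟨η, hη⟩ ⟨nuPart (fun a => η (σ a)), nuPart_mono _⟩ σ
    (piPart (fun a => η (σ a))) (fun a => (nuPart_piPart (fun a => η (σ a)) a).symm)
  refine Eq.trans ?_ this.symm
  rw [mapMul]
  congr 3
  funext i
  exact (A.act_finCongr (fibCard_nuPart _ i)).symm.trans (congrArg A.act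
    (fibEquiv_eq_finCongr _ _ _ _ (piPart _) (fun a => by rw [nuPart_piPart])
      (fun a b ha hb hab => piPart_mono _ a b (ha.trans hb.symm) hab) (fibCard_nuPart _ i)).symm)

lemma mapMul_mono {n k : ℕ} (η : Fin n → Fin k) (hη : Monotone η) :
    A.mapMul η = A.monoMul η hη := by
  have h : ∀ i, A.act (fibEquiv η i η i (Equiv.refl _) (fun _ => Iff.rfl)) = 𝟙 _ := fun i =>
    (congrArg A.act (fibEquiv_eq η i η i _ _ (Equiv.refl _) fun a => rfl)).trans (A.act_refl _)
  have h' : A.act (Equiv.refl (Fin n)).symm = 𝟙 _ := A.act_refl n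
  rw [A.mapMul_eq η η hη (Equiv.refl _) (fun _ => rfl), h', Category.comp_id]
  refine Eq.trans (congrArg (fun t => (A.ob k ◁ tensMap k t) ≫ A.monoMul η hη) (funext h)) ?_
  rw [tensMap_id, whiskerLeft_id, Category.id_comp]

/-- Equivariance for arbitrary maps. -/
lemma mapMul_equivariance {n n' k k' : ℕ} (τ : Fin n → Fin k) (τ' : Fin n' → Fin k')
    (π : Fin n ≃ Fin n') (ρ : Fin k ≃ Fin k') (h : ∀ a, τ' (π a) = ρ (τ a)) :
    A.mapMul τ ≫ A.act π =
      (A.act ρ ⊗ₘ tensPerm ρ (X' := fun i => A.ob (fibCard τ' i)) (fun i =>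
        A.act (fibEquiv τ i τ' (ρ i) π (fun a => by simp [h])))) ≫ A.mapMul τ' := by
  let σ := piPart τ
  let η := nuPart τ
  have hσ : ∀ a, τ a = η (σ a) := fun a => (nuPart_piPart τ a).symm
  let κ := piPart (fun a => ρ (η a))
  let η' := nuPart (fun a => ρ (η a))
  have hκ : ∀ a, η' (κ a) = ρ (η a) := nuPart_piPart (fun a => ρ (η a))
  let σ' : Fin n' ≃ Fin n := π.symm.trans (σ.trans κ)
  have hσ' : ∀ a, τ' a = η' (σ' a) := fun a => by
    obtain ⟨b, rfl⟩ := π.surjective a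
    simp only [h, σ', Equiv.trans_apply, Equiv.symm_apply_apply, hκ, hσ]
  have hb := A.equivariance_base ⟨η, nuPart_mono _⟩ ⟨η', nuPart_mono _⟩ κ ρ hκ
    (fun a b hab => piPart_mono _ a b (congrArg ρ hab))
  have e1 : A.act σ.symm ≫ A.act π = A.act κ ≫ A.act σ'.symm := by
    rw [act_trans, act_trans]
    congr 1
    ext a
    simp [σ']
  rw [A.mapMul_eq τ η (nuPart_mono _) σ hσ, A.mapMul_eq τ' η' (nuPart_mono _) σ' hσ',
    Category.assoc, Category.assoc, e1]
  refine (congrArg (fun t => (A.ob k ◁ tensMap k (fun i =>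
      A.act (fibEquiv τ i η i σ (fun a => by rw [hσ])))) ≫ t)
    ((Category.assoc _ _ _).symm.trans
    ((congrArg (fun t => t ≫ A.act σ'.symm) hb).trans (Category.assoc _ _ _)))).trans ?_
  refine (Category.assoc _ _ _).symm.trans (Eq.trans ?_ (Category.assoc _ _ _))
  refine congrArg (fun t => t ≫ A.monoMul η' (nuPart_mono _) ≫ A.act σ'.symm) ?_
  rw [← id_tensorHom, ← id_tensorHom, tensorHom_comp_tensorHom, tensorHom_comp_tensorHom,
    tensMap_tensPerm, tensPerm_tensMap, Category.id_comp, Category.comp_id]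
  refine congrArg (fun t => A.act ρ ⊗ₘ tensPerm ρ t) (funext fun i => ?_)
  have hc : fibCard η i = fibCard η' (ρ i) := fibCard_congr η i η' (ρ i) κ (fun a => by simp [hκ])
  have := A.act_finCongr hc
  refine (congrArg (fun t => A.act (fibEquiv τ i η i σ (fun a => by rw [hσ])) ≫ t)
    this.symm).trans ?_
  rw [act_trans, act_trans, ← fibEquiv_eq_finCongr η i η' (ρ i) κ (fun a => by simp [hκ])
    (fun a b ha hb hab => piPart_mono _ a b (congrArg ρ (ha.trans hb.symm)) hab),
    fibEquiv_trans _ _ _ _ _ _ _ _ _ _ (σ.trans κ) (fun a => by simp [hκ, hσ]) (fun _ => rfl),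
    fibEquiv_trans _ _ _ _ _ _ _ _ _ _ (σ.trans κ) (fun a => by simp [hκ, hσ])
      (fun _ => by simp [σ'])]

end SymOperad

end OperadDefs

namespace SymOperad
variable {V : Type u} [Category.{v} V] [MonoidalCategory V] [SymmetricCategory V] (A : SymOperad V)

/-- The map between the fibres of `ω ∘ σ` and `ω`. -/
abbrev fibRes {n l k : ℕ} (σ : Fin n → Fin l) (ω : Fin l → Fin k) (i : Fin k) :
    Fin (fibCard (fun a => ω (σ a)) i) → Fin (fibCard ω i) :=
  fibMap (fun a => ω (σ a)) i ω i σ (fun _ h => h)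

/-- Associativity of the multiplication for a pair of composable maps. -/
def AssocAt {n l k : ℕ} (σ : Fin n → Fin l) (ω : Fin l → Fin k) : Prop :=
  shuffle (fibIncl_bijective ω) (A.ob k) (fun i => A.ob (fibCard ω i))
      (fun s => A.ob (fibCard σ s)) ≫ (A.mapMul ω ▷ _) ≫ A.mapMul σ =
    (A.ob k ◁ tensMap k (fun i => (A.ob (fibCard ω i) ◁ tensMap _ (fun j =>
      eqToHom (congrArg A.ob (fibCard_fibMap σ ω i j).symm))) ≫ A.mapMul (fibRes σ ω i))) ≫
      A.mapMul (fun a => ω (σ a))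

lemma assocAt_of_mono {n l k : ℕ} (σ : Fin n → Fin l) (ω : Fin l → Fin k) (hσ : Monotone σ)
    (hω : Monotone ω) : A.AssocAt σ ω := by
  have h := A.str.assoc (T := ⟨n⟩) (S := ⟨l⟩) (R := ⟨k⟩) ⟨σ, hσ⟩ ⟨ω, hω⟩
  have hi : ∀ i, A.mapMul (fibRes σ ω i) = A.monoMul (fibRes σ ω i)
    (fibMap_mono _ _ _ _ _ _ (fun _ _ _ _ h => hσ h)) := fun i => A.mapMul_mono _ _
  rw [AssocAt, A.mapMul_mono ω hω, A.mapMul_mono σ hσ,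
    A.mapMul_mono (fun a => ω (σ a)) (fun _ _ h => hω (hσ h))]
  simp only [hi]
  exact h

instance {n m : ℕ} (e : Fin n ≃ Fin m) : IsIso (A.act e) :=
  ⟨A.act e.symm, by rw [act_trans, Equiv.self_trans_symm, act_refl],
    by rw [act_trans, Equiv.symm_trans_self, act_refl]⟩

lemma mapMul_equivariance_refl {n n' k : ℕ} (τ : Fin n → Fin k) (τ' : Fin n' → Fin k)
    (π : Fin n ≃ Fin n') (h : ∀ a, τ' (π a) = τ a) :
    A.mapMul τ ≫ A.act π =
      (A.ob k ◁ tensMap k (fun i =>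
        A.act (fibEquiv τ i τ' i π (fun a => by rw [h])))) ≫ A.mapMul τ' := by
  have e := A.mapMul_equivariance τ τ' π (Equiv.refl _) h
  have hr : A.act (Equiv.refl (Fin k)) = 𝟙 _ := A.act_refl k
  rw [hr, id_tensorHom] at e
  exact e.trans (congrArg (fun t => (A.ob k ◁ t) ≫ A.mapMul τ') (tensPerm_refl
    (X := fun i => A.ob (fibCard τ i)) (X' := fun i => A.ob (fibCard τ' i)) _))

lemma act_eqToHom {n m m' : ℕ} (e : Fin n ≃ Fin m) (h : m = m') :
    A.act e ≫ eqToHom (congrArg A.ob h) = A.act (e.trans (finCongr h)) := by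
  rw [← act_finCongr, act_trans]

lemma eqToHom_act {n n' m : ℕ} (h : n' = n) (e : Fin n ≃ Fin m) :
    eqToHom (congrArg A.ob h) ≫ A.act e = A.act ((finCongr h).trans e) := by
  rw [← act_finCongr, act_trans]

lemma assocAt_all {n l k : ℕ} (σ : Fin n → Fin l) (ω : Fin l → Fin k) : A.AssocAt σ ω := by
  let ρ := piPart ω
  let ω' := nuPart ω
  have hρ : ∀ a, ω' (ρ a) = ω a := nuPart_piPart ω
  let π := piPart (fun a => ρ (σ a))
  let σ' := nuPart (fun a => ρ (σ a))
  have hπ : ∀ a, σ' (π a) = ρ (σ a) := nuPart_piPart (fun a => ρ (σ a))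
  have hωσ : ∀ a, ω' (σ' (π a)) = ω (σ a) := fun a => by rw [hπ, hρ]
  have hm := A.assocAt_of_mono σ' ω' (nuPart_mono _) (nuPart_mono _)
  let ρi : ∀ i, Fin (fibCard ω i) ≃ Fin (fibCard ω' i) := fun i =>
    fibEquiv ω i ω' i ρ (fun a => by rw [hρ])
  let πi : ∀ i, Fin (fibCard (fun a => ω (σ a)) i) ≃ Fin (fibCard (fun a => ω' (σ' a)) i) :=
    fun i => fibEquiv (fun a => ω (σ a)) i (fun a => ω' (σ' a)) i π (fun a => by rw [hωσ])
  have hi : ∀ i a, fibRes σ' ω' i (πi i a) = ρi i (fibRes σ ω i a) := fun i a =>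
    fibIncl_injective _ _ (by
      simp only [fibRes, πi, ρi]
      rw [fibIncl_fibMap, fibIncl_fibEquiv, fibIncl_fibEquiv, fibIncl_fibMap, hπ])
  have Eσ := A.mapMul_equivariance σ σ' π ρ hπ
  have Eω := A.mapMul_equivariance_refl ω ω' ρ hρ
  have Eωσ := A.mapMul_equivariance_refl (fun a => ω (σ a)) (fun a => ω' (σ' a)) π hωσ
  have Ei := fun i => A.mapMul_equivariance (fibRes σ ω i) (fibRes σ' ω' i) (πi i) (ρi i) (hi i)
  have hinc : ∀ i j, fibIncl ω' i (ρi i j) = ρ (fibIncl ω i j) := fun i j =>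
    fibIncl_fibEquiv _ _ _ _ _ _ _
  let z : ∀ s, A.ob (fibCard σ s) ⟶ A.ob (fibCard σ' (ρ s)) := fun s =>
    A.act (fibEquiv σ s σ' (ρ s) π (fun a => by simp [hπ]))
  have hn := shuffle_nat (fibIncl_bijective ω) (fibIncl_bijective ω') (𝟙 (A.ob k))
    (fun i => A.act (ρi i)) (Z' := fun s => A.ob (fibCard σ' s)) ρ ρi hinc z _ (fun _ _ => rfl)
  rw [AssocAt, ← cancel_mono (A.act π)]
  refine Eq.trans (b := (A.ob k ◁ tensMap k (fun i => A.act (ρi i) ⊗ₘ tensPerm (ρi i)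
    (X' := fun j => A.ob (fibCard σ' (fibIncl ω' i j))) (fun j => z (fibIncl ω i j) ≫
    eqToHom (congrArg (fun s => A.ob (fibCard σ' s)) (hinc i j).symm)))) ≫
    shuffle (fibIncl_bijective ω') (A.ob k) (fun i => A.ob (fibCard ω' i))
      (fun s => A.ob (fibCard σ' s)) ≫ (A.mapMul ω' ▷ _) ≫ A.mapMul σ') ?_ ?_
  · rw [id_tensorHom] at hn
    rw [Category.assoc, Category.assoc, Eσ, reassoc_of% hn]
    refine congrArg (fun t => shuffle _ _ _ _ ≫ t) ?_
    rw [← Category.assoc, ← Category.assoc]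
    refine congrArg (fun t => t ≫ A.mapMul σ') ?_
    rw [← tensorHom_id, ← tensorHom_id, tensorHom_comp_tensorHom, tensorHom_comp_tensorHom, Eω,
      Category.id_comp, Category.comp_id, id_tensorHom]
  · rw [hm]
    rw [Category.assoc, Eωσ, ← Category.assoc, ← Category.assoc]
    refine congrArg (fun t => t ≫ A.mapMul (fun a => ω' (σ' a))) ?_
    rw [← whiskerLeft_comp, ← whiskerLeft_comp, tensMap_comp, tensMap_comp]
    refine congrArg (fun t => A.ob k ◁ tensMap k t) (funext fun i => ?_)
    rw [Category.assoc, Ei, ← Category.assoc, ← Category.assoc]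
    refine congrArg (fun t => t ≫ A.mapMul (fibRes σ' ω' i)) ?_
    rw [← id_tensorHom, ← id_tensorHom, tensorHom_comp_tensorHom, tensorHom_comp_tensorHom,
      Category.id_comp, Category.comp_id, tensMap_tensPerm, tensPerm_tensMap]
    refine congrArg (fun t => A.act (ρi i) ⊗ₘ tensPerm (ρi i) t) (funext fun j => ?_)
    rw [Category.assoc, eqToHom_trans]
    have hc : fibCard σ' (ρ (fibIncl ω i j)) = fibCard (fibRes σ' ω' i) (ρi i j) := by
      rw [fibCard_fibMap, hinc]
    refine (A.act_eqToHom _ hc).trans (Eq.trans ?_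
      (A.eqToHom_act (fibCard_fibMap σ ω i j).symm _).symm)
    refine congrArg A.act (Equiv.ext fun a => ?_)
    obtain ⟨b, rfl⟩ := (finCongr (fibCard_fibMap σ ω i j)).surjective a
    refine fibIncl_injective _ _ (fibIncl_injective _ _ ?_)
    simp only [fibRes, Equiv.trans_apply]
    rw [← fibIncl_cast_fibMap]
    refine (fibIncl_congr σ' (hinc i j) _ (fibEquiv σ (fibIncl ω i j) σ' (ρ (fibIncl ω i j)) π
      (fun a => by simp [hπ]) (finCongr (fibCard_fibMap σ ω i j) b)) rfl).trans ?_
    rw [fibIncl_fibEquiv, fibIncl_cast_fibMap]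
    refine Eq.trans ?_ (congrArg (fibIncl (fun a => ω' (σ' a)) i)
      (fibIncl_fibEquiv (fibRes σ ω i) j (fibRes σ' ω' i) (ρi i j) (πi i) _ b)).symm
    exact (fibIncl_fibEquiv _ _ _ _ _ _ _).symm

lemma mapMul_congr {n k : ℕ} {τ τ' : Fin n → Fin k} (h : ∀ a, τ a = τ' a)
    (hf : ∀ i, fibCard τ i = fibCard τ' i) :
    A.mapMul τ = (A.ob k ◁ tensMap k (fun i => eqToHom (congrArg A.ob (hf i)))) ≫
      A.mapMul τ' := by
  obtain rfl : τ = τ' := funext h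
  simp

lemma mapMul_id {n : ℕ} (τ : Fin n → Fin n) (h : ∀ a, τ a = a) (hf : ∀ i, 1 = fibCard τ i) :
    (A.ob n ◁ tensMap n (fun i => A.str.unit ≫ eqToHom (congrArg A.ob (hf i)))) ≫ A.mapMul τ =
      (A.ob n ◁ tensUnit n) ≫ (ρ_ (A.ob n)).hom := by
  obtain rfl : τ = fun a => a := funext h
  rw [A.mapMul_mono (fun a => a) monotone_id]
  exact A.str.mul_id ⟨n⟩

lemma mapMul_toU {n k : ℕ} (τ : Fin n → Fin k) (hk : k = 1) (hf : ∀ i, n = fibCard τ i) :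
    ((A.str.unit ≫ eqToHom (congrArg A.ob hk.symm)) ⊗ₘ (tensOne (A.ob n) k hk ≫
        tensMap k (fun i => eqToHom (congrArg A.ob (hf i))))) ≫ A.mapMul τ =
      (λ_ (A.ob n)).hom := by
  subst hk
  obtain rfl : τ = fun _ => 0 := funext fun _ => Subsingleton.elim _ _
  rw [A.mapMul_mono _ (fun _ _ _ => le_rfl)]
  refine Eq.trans ?_ (A.str.mul_toU ⟨n⟩)
  rw [eqToHom_refl, Category.comp_id]
  rfl

section Des

variable (O : Type) [FibredCategory O]

open FibredCategory

/-- The multiplication of the desymmetrisation, for a map `f : T ⟶ S`: the multiplication for the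
map between the sets of tips. -/
def desMul {T S : O} (f : T ⟶ S) :
    A.ob (card S) ⊗ tens (card S) (fun i => A.ob (card (fib f i))) ⟶ A.ob (card T) :=
  (A.ob (card S) ◁ tensMap _ (fun i => eqToHom (congrArg A.ob (card_fib f i)))) ≫
    A.mapMul (tips f)

lemma desMul_assoc {T S R : O} (f : T ⟶ S) (g : S ⟶ R) :
    shuffle (fibTip_bijective g) (A.ob (card R)) (fun i => A.ob (card (fib g i)))
        (fun s => A.ob (card (fib f s))) ≫ (A.desMul O g ▷ _) ≫ A.desMul O f =
      (A.ob (card R) ◁ tensMap (card R) (fun i =>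
        (A.ob (card (fib g i)) ◁ tensMap _ (fun j =>
          eqToHom (congrArg A.ob (congrArg card (fib_fibMor f g i j).symm)))) ≫
          A.desMul O (fibMor f g i))) ≫ A.desMul O (f ≫ g) := by
  let ρi : ∀ i, Fin (card (fib g i)) ≃ Fin (fibCard (tips g) i) := fun i => finCongr (card_fib g i)
  have hz : ∀ i j, fibTip g i j = fibIncl (tips g) i (ρi i j) := fun _ _ => rfl
  have hcf : ∀ i, fibCard (tips (f ≫ g)) i = fibCard (fun a => tips g (tips f a)) i := fun i =>
    congrArg (fun t => fibCard t i) (funext (tips_comp f g))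
  let πi : ∀ i, Fin (card (fib (f ≫ g) i)) ≃ Fin (fibCard (fun a => tips g (tips f a)) i) :=
    fun i => finCongr ((card_fib (f ≫ g) i).trans (hcf i))
  have hfi : ∀ (i) (a : Fin (fibCard (tips (f ≫ g)) i)),
      fibIncl (fun a => tips g (tips f a)) i (Fin.cast (hcf i) a) =
        fibIncl (tips (f ≫ g)) i a := by
    have : ∀ (u w : Fin (card T) → Fin (card R)) (i) (a : Fin (fibCard u i))
      (h : fibCard u i = fibCard w i), u = w → fibIncl w i (Fin.cast h a) = fibIncl u i a := by
      rintro u w i a h rfl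
      rfl
    exact fun i a => this _ _ i a _ (funext (tips_comp f g))
  have hi : ∀ i a, fibRes (tips f) (tips g) i (πi i a) = ρi i (tips (fibMor f g i) a) :=
    fun i a => fibIncl_injective _ _ (by
      rw [fibRes, fibIncl_fibMap]
      exact (congrArg (tips f) (hfi i (Fin.cast (card_fib (f ≫ g) i) a))).trans
        (tips_fibMor f g i a).symm)
  have Ei := fun i => A.mapMul_equivariance (tips (fibMor f g i)) (fibRes (tips f) (tips g) i)
    (πi i) (ρi i) (hi i)
  have hn := shuffle_nat (fibTip_bijective g) (fibIncl_bijective (tips g)) (𝟙 (A.ob (card R)))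
    (fun i => eqToHom (congrArg A.ob (card_fib g i))) (Z' := fun s => A.ob (fibCard (tips f) s))
    (Equiv.refl _) ρi (fun i j => rfl) (fun s => eqToHom (congrArg A.ob (card_fib f s))) _
    (fun _ _ => rfl)
  have hπ : ∀ i, A.act (πi i) = eqToHom (congrArg A.ob ((card_fib (f ≫ g) i).trans (hcf i))) :=
    fun i => A.act_finCongr _
  have hρ : ∀ i, A.act (ρi i) = eqToHom (congrArg A.ob (card_fib g i)) :=
    fun i => A.act_finCongr _
  have hr := tensPerm_refl (X := fun s => A.ob (card (fib f s)))
    (X' := fun s => A.ob (fibCard (tips f) s)) (fun s => eqToHom (congrArg A.ob (card_fib f s)))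
  replace hn := hn.trans (congrArg (fun t => shuffle _ _ _ _ ≫ (_ ⊗ₘ t)) hr)
  rw [id_tensorHom] at hn
  refine Eq.trans (b := (A.ob (card R) ◁ tensMap (card R) (fun i =>
    eqToHom (congrArg A.ob (card_fib g i)) ⊗ₘ tensPerm (ρi i)
    (X' := fun j => A.ob (fibCard (tips f) (fibIncl (tips g) i j))) (fun j =>
      eqToHom (congrArg A.ob (card_fib f (fibTip g i j))) ≫
        eqToHom (congrArg (fun s => A.ob (fibCard (tips f) s))
          (hz i j))))) ≫
    shuffle (fibIncl_bijective (tips g)) (A.ob (card R)) (fun i => A.ob (fibCard (tips g) i))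
      (fun s => A.ob (fibCard (tips f) s)) ≫ (A.mapMul (tips g) ▷ _) ≫ A.mapMul (tips f)) ?_ ?_
  · refine Eq.trans ?_ ((congrArg (fun t => t ≫ (A.mapMul (tips g) ▷ _) ≫ A.mapMul (tips f))
      hn.symm).trans (Category.assoc _ _ _))
    rw [Category.assoc]
    refine congrArg (fun t => shuffle _ _ _ _ ≫ t) ?_
    rw [desMul, desMul, ← Category.assoc, ← Category.assoc]
    refine congrArg (fun t => t ≫ A.mapMul (tips f)) ?_
    rw [← tensorHom_id, ← tensorHom_id, ← id_tensorHom, ← id_tensorHom, tensorHom_comp_tensorHom,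
      tensorHom_comp_tensorHom, Category.id_comp, Category.comp_id]
    exact congrArg (fun t => _ ⊗ₘ t) (Category.comp_id _).symm
  · have hd : A.desMul O (f ≫ g) = (A.ob (card R) ◁ tensMap _ (fun i =>
        eqToHom (congrArg A.ob (card_fib (f ≫ g) i)))) ≫ A.mapMul (tips (f ≫ g)) := rfl
    rw [A.assocAt_all (tips f) (tips g), hd, A.mapMul_congr (tips_comp f g) hcf]
    rw [← Category.assoc, ← Category.assoc, ← Category.assoc]
    refine congrArg (fun t => t ≫ A.mapMul (fun a => tips g (tips f a))) ?_
    rw [← whiskerLeft_comp, ← whiskerLeft_comp, ← whiskerLeft_comp, tensMap_comp, tensMap_comp,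
      tensMap_comp]
    refine congrArg (fun t => A.ob (card R) ◁ tensMap (card R) t) (funext fun i => ?_)
    rw [Category.assoc, Category.assoc, eqToHom_trans, ← hπ, desMul, Category.assoc, Ei,
      ← Category.assoc, ← Category.assoc, ← Category.assoc]
    refine congrArg (fun t => t ≫ A.mapMul (fibRes (tips f) (tips g) i)) ?_
    rw [← id_tensorHom, ← id_tensorHom, ← id_tensorHom, tensorHom_comp_tensorHom,
      tensorHom_comp_tensorHom, tensorHom_comp_tensorHom,
      Category.id_comp, Category.id_comp, Category.comp_id, tensMap_comp, tensMap_tensPerm,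
      tensPerm_tensMap, hρ]
    refine congrArg (fun t => eqToHom (congrArg A.ob (card_fib g i)) ⊗ₘ tensPerm (ρi i) t)
      (funext fun j => ?_)
    have hc : fibCard (tips (fibMor f g i)) j =
        fibCard (fibRes (tips f) (tips g) i) (ρi i j) :=
      fibCard_congr _ _ _ _ (πi i) (fun a => by rw [hi, (ρi i).apply_eq_iff_eq])
    have he := (congrArg A.act (fibEquiv_eq_finCongr (tips (fibMor f g i)) j
      (fibRes (tips f) (tips g) i) (ρi i j) (πi i)
      (fun a => by rw [hi, (ρi i).apply_eq_iff_eq]) (fun a b _ _ hab => hab) hc)).trans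
      (A.act_finCongr hc)
    rw [he]
    simp only [eqToHom_trans]
    rfl

/-- The desymmetrisation of a left symmetric operad. -/
def desStr : OperadStr O (fun T => A.ob (card T)) where
  unit := A.str.unit ≫ eqToHom (congrArg A.ob card_U.symm)
  mul f := A.desMul O f
  assoc f g := A.desMul_assoc O f g
  mul_id T := by
    rw [desMul, ← Category.assoc, ← whiskerLeft_comp, tensMap_comp]
    simp only [Category.assoc, eqToHom_trans]
    refine A.mapMul_id _ (tips_id T) (fun i => ?_)
    rw [← card_fib, fib_id, card_U]
  mul_toU T := by
    rw [desMul, ← id_tensorHom, ← Category.assoc, tensorHom_comp_tensorHom, Category.comp_id,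
      Category.assoc, tensMap_comp]
    simp only [eqToHom_trans]
    refine A.mapMul_toU _ card_U (fun i => ?_)
    rw [← card_fib, fib_toU]

variable {A} in
lemma monoMul_hom {B : SymOperad V} (f : A ⟶ B) {n k : ℕ} (η : Fin n → Fin k) (hη : Monotone η) :
    A.monoMul η hη ≫ f.app.app ⟨n⟩ =
      (f.app.app ⟨k⟩ ⊗ₘ tensMap k (fun i => f.app.app ⟨fibCard η i⟩)) ≫ B.monoMul η hη :=
  f.isHom.mul (T := ⟨n⟩) (S := ⟨k⟩) ⟨η, hη⟩

variable {A} in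
lemma eqToHom_hom {B : SymOperad V} (f : A ⟶ B) {n m : ℕ} (h : n = m) :
    eqToHom (congrArg A.ob h) ≫ f.app.app ⟨m⟩ = f.app.app ⟨n⟩ ≫ eqToHom (congrArg B.ob h) := by
  subst h
  simp

variable {A} in
lemma mapMul_hom {B : SymOperad V} (f : A ⟶ B) {n k : ℕ} (τ : Fin n → Fin k) :
    A.mapMul τ ≫ f.app.app ⟨n⟩ =
      (f.app.app ⟨k⟩ ⊗ₘ tensMap k (fun i => f.app.app ⟨fibCard τ i⟩)) ≫ B.mapMul τ := by
  have h1 : A.act (piPart τ).symm ≫ f.app.app ⟨n⟩ = f.app.app ⟨n⟩ ≫ B.act (piPart τ).symm :=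
    f.app.naturality (X := ⟨n⟩) (Y := ⟨n⟩) (piPart τ).symm
  rw [mapMul, mapMul, Category.assoc, Category.assoc, h1, reassoc_of% (monoMul_hom f),
    ← id_tensorHom, ← id_tensorHom, tensorHom_comp_tensorHom_assoc,
    tensorHom_comp_tensorHom_assoc, tensMap_comp, tensMap_comp, Category.id_comp, Category.comp_id]
  simp only [eqToHom_hom f (fibCard_nuPart τ _)]

variable (V) in
/-- Desymmetrisation. -/
def des : SymOperad V ⥤ Operad V O where
  obj A := ⟨_, A.desStr O⟩
  map {A B} f := ⟨fun T => f.app.app ⟨card T⟩, by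
    have h := eqToHom_hom f (card_U (O := O)).symm
    change (A.str.unit ≫ eqToHom _) ≫ _ = B.str.unit ≫ eqToHom _
    rw [Category.assoc, h, ← Category.assoc]
    exact congrArg (fun t => t ≫ _) f.isHom.unit, fun {T S} h => by
    change A.desMul O h ≫ _ = _ ≫ B.desMul O h
    rw [desMul, desMul, Category.assoc, mapMul_hom, ← Category.assoc, ← Category.assoc,
      ← id_tensorHom, ← id_tensorHom, tensorHom_comp_tensorHom, tensorHom_comp_tensorHom,
      tensMap_comp, tensMap_comp, Category.id_comp, Category.comp_id]
    simp only [eqToHom_hom f (card_fib h _)]⟩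

end Des

end SymOperad

/-- Trees of height `n`: chains of order preserving maps of ordinals
`[k_n] → [k_{n-1}] → ⋯ → [k_0] = [1]`. -/
structure LevelTree (n : ℕ) : Type where
  size : Fin (n + 1) → ℕ
  root : size 0 = 1
  par (i : Fin n) : Fin (size i.succ) →o Fin (size i.castSucc)

namespace LevelTree

variable {n : ℕ}

/-- Morphisms of trees: levelwise maps that commute with the structure maps and preserve the order
of the fibres of the structure maps. -/
@[ext]
structure Hom (T S : LevelTree n) : Type where
  app (j : Fin (n + 1)) : Fin (T.size j) → Fin (S.size j)
  comm (i : Fin n) (a : Fin (T.size i.succ)) :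
    app i.castSucc (T.par i a) = S.par i (app i.succ a)
  mono (i : Fin n) (a b : Fin (T.size i.succ)) (h : T.par i a = T.par i b) (hab : a ≤ b) :
    app i.succ a ≤ app i.succ b

/-- The category of trees of height `n`. -/
instance : Category (LevelTree n) where
  Hom := Hom
  id T := ⟨fun _ a => a, fun _ _ => rfl, fun _ _ _ _ h => h⟩
  comp {T S R} f g := ⟨fun j a => Hom.app g j (Hom.app f j a),
    fun i a => by rw [Hom.comm, Hom.comm],
    fun i a b h hab => Hom.mono g i _ _ (by rw [← Hom.comm, ← Hom.comm, h]) (Hom.mono f i a b h hab)⟩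

/-- The levelwise map of a morphism. -/
abbrev app {T S : LevelTree n} (f : T ⟶ S) (j : Fin (n + 1)) : Fin (T.size j) → Fin (S.size j) :=
  Hom.app f j

lemma app_par {T S : LevelTree n} (f : T ⟶ S) (i : Fin n) (a : Fin (T.size i.succ)) :
    app f i.castSucc (T.par i a) = S.par i (app f i.succ a) :=
  Hom.comm f i a

/-- The ancestor at level `j` of a vertex of the highest level. -/
def anc (T : LevelTree n) (t : Fin (T.size (Fin.last n))) (j : Fin (n + 1)) : Fin (T.size j) :=
  Fin.reverseInduction (motive := fun j => Fin (T.size j)) t (fun i a => T.par i a) j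

lemma anc_last (T : LevelTree n) (t : Fin (T.size (Fin.last n))) : T.anc t (Fin.last n) = t :=
  Fin.reverseInduction_last ..

lemma anc_castSucc (T : LevelTree n) (t : Fin (T.size (Fin.last n))) (i : Fin n) :
    T.anc t i.castSucc = T.par i (T.anc t i.succ) :=
  Fin.reverseInduction_castSucc ..

lemma anc_unique (T : LevelTree n) (t : Fin (T.size (Fin.last n))) (x : ∀ j, Fin (T.size j))
    (h : x (Fin.last n) = t) (h' : ∀ i : Fin n, x i.castSucc = T.par i (x i.succ))
    (j : Fin (n + 1)) : x j = T.anc t j := by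
  induction j using Fin.reverseInduction with
  | last => rw [h, anc_last]
  | cast i ih => rw [h', ih, anc_castSucc]

/-- The fibre of a morphism over a vertex of the highest level. -/
def fib {T S : LevelTree n} (f : T ⟶ S) (t : Fin (S.size (Fin.last n))) : LevelTree n where
  size j := fibCard (app f j) (S.anc t j)
  root := (fibCard_of_subsingleton _ S.root _).trans T.root
  par i := ⟨fibMap (app f i.succ) (S.anc t i.succ) (app f i.castSucc) (S.anc t i.castSucc) (T.par i)
      (fun a h => by rw [app_par, h, anc_castSucc]),
    fibMap_mono _ _ _ _ _ _ (fun _ _ _ _ h => (T.par i).monotone h)⟩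

/-- The inclusion of the fibre. -/
def incl {T S : LevelTree n} (f : T ⟶ S) (t : Fin (S.size (Fin.last n))) (j : Fin (n + 1)) :
    Fin ((fib f t).size j) → Fin (T.size j) :=
  fibIncl (app f j) (S.anc t j)

section

variable {T S : LevelTree n} (f : T ⟶ S) (t : Fin (S.size (Fin.last n)))

lemma incl_strictMono (j : Fin (n + 1)) : StrictMono (incl f t j) := fibIncl_strictMono _ _

lemma app_incl (j : Fin (n + 1)) (a : Fin ((fib f t).size j)) :
    app f j (incl f t j a) = S.anc t j :=
  apply_fibIncl _ _ _

lemma exists_incl (j : Fin (n + 1)) (a : Fin (T.size j)) (h : app f j a = S.anc t j) :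
    ∃ b, incl f t j b = a :=
  ⟨fibIdx _ _ a h, fibIncl_fibIdx _ _ _ _⟩

lemma par_incl (i : Fin n) (a : Fin ((fib f t).size i.succ)) :
    T.par i (incl f t i.succ a) = incl f t i.castSucc ((fib f t).par i a) :=
  (fibIncl_fibMap (app f i.succ) (S.anc t i.succ) (app f i.castSucc) (S.anc t i.castSucc) (T.par i)
    (fun a h => by rw [app_par, h, anc_castSucc]) a).symm

lemma size_fib : (fib f t).size (Fin.last n) = fibCard (app f (Fin.last n)) t :=
  congrArg (fibCard (app f (Fin.last n))) (anc_last _ t)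

lemma incl_last (a : Fin ((fib f t).size (Fin.last n))) :
    fibIncl (app f (Fin.last n)) t (Fin.cast (size_fib f t) a) = incl f t (Fin.last n) a :=
  fibIncl_congr _ (anc_last S t).symm _ _ rfl

end

/-- Subtrees with the same vertices are equal. -/
lemma eq_of_incl (X X' T : LevelTree n) (ι : ∀ j, Fin (X.size j) → Fin (T.size j))
    (ι' : ∀ j, Fin (X'.size j) → Fin (T.size j)) (hι : ∀ j, StrictMono (ι j))
    (hι' : ∀ j, StrictMono (ι' j)) (hp : ∀ i a, T.par i (ι i.succ a) = ι i.castSucc (X.par i a))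
    (hp' : ∀ i a, T.par i (ι' i.succ a) = ι' i.castSucc (X'.par i a))
    (hr : ∀ j a, (∃ b, ι j b = a) ↔ ∃ b, ι' j b = a) : X = X' := by
  obtain ⟨s, hs, p⟩ := X
  obtain ⟨s', hs', p'⟩ := X'
  have h : s = s' := by
    funext j
    have h1 := Set.card_range_of_injective (hι j).injective
    have h2 := Set.card_range_of_injective (hι' j).injective
    have h3 : Set.range (ι j) = Set.range (ι' j) := Set.ext fun a => hr j a
    simp only [Fintype.card_fin] at h1 h2
    rw [← h1, ← h2]
    exact Fintype.card_congr (Equiv.setCongr h3)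
  subst h
  have h : ∀ j, ι j = ι' j := fun j =>
    ((hι j).range_inj (hι' j)).1 (Set.ext fun a => hr j a)
  obtain rfl : ι = ι' := funext h
  congr 1
  funext i
  ext a : 2
  exact (hι _).injective ((hp i a).symm.trans (hp' i a))

/-- The linear tree. -/
abbrev linear (n : ℕ) : LevelTree n where
  size _ := 1
  root := rfl
  par _ := OrderHom.id

section

variable {T S R : LevelTree n} (f : T ⟶ S) (g : S ⟶ R) (t : Fin (R.size (Fin.last n)))

/-- The map induced between the fibres, at one level. -/
def fibApp (j : Fin (n + 1)) : Fin ((fib (f ≫ g) t).size j) → Fin ((fib g t).size j) :=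
  fibMap (app (f ≫ g) j) (R.anc t j) (app g j) (R.anc t j) (app f j) (fun _ h => h)

lemma incl_fibApp (j : Fin (n + 1)) (a : Fin ((fib (f ≫ g) t).size j)) :
    incl g t j (fibApp f g t j a) = app f j (incl (f ≫ g) t j a) :=
  fibIncl_fibMap (app (f ≫ g) j) (R.anc t j) (app g j) (R.anc t j) (app f j) (fun _ h => h) a

/-- The map induced between the fibres over a vertex. -/
def fibMor : fib (f ≫ g) t ⟶ fib g t where
  app := fibApp f g t
  comm i a := (incl_strictMono _ _ _).injective (by
    rw [incl_fibApp, ← par_incl, ← par_incl, incl_fibApp, app_par])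
  mono i a b h hab := (incl_strictMono _ _ _).le_iff_le.1 (by
    rw [incl_fibApp, incl_fibApp]
    refine Hom.mono f i _ _ ?_ ((incl_strictMono _ _ _).monotone hab)
    rw [par_incl, par_incl, h])

lemma incl_fibMor (j : Fin (n + 1)) (a : Fin ((fib (f ≫ g) t).size j)) :
    incl g t j (app (fibMor f g t) j a) = app f j (incl (f ≫ g) t j a) :=
  incl_fibApp f g t j a

lemma incl_anc (s : Fin ((fib g t).size (Fin.last n))) (j : Fin (n + 1)) :
    incl g t j ((fib g t).anc s j) = S.anc (incl g t (Fin.last n) s) j :=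
  anc_unique S _ (fun j => incl g t j ((fib g t).anc s j)) (by rw [anc_last])
    (fun i => by rw [anc_castSucc, par_incl]) j

lemma fib_fibMor (s : Fin ((fib g t).size (Fin.last n))) :
    fib (fibMor f g t) s = fib f (incl g t (Fin.last n) s) := by
  refine eq_of_incl _ _ T
    (fun m a => incl (f ≫ g) t m (incl (fibMor f g t) s m a)) (fun m => incl f _ m)
    (fun m => (incl_strictMono _ _ _).comp (incl_strictMono _ _ _))
    (fun m => incl_strictMono _ _ _) (fun k a => by rw [par_incl, par_incl])
    (fun k a => par_incl _ _ _ _) (fun m a => ?_)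
  constructor
  · rintro ⟨b, rfl⟩
    refine exists_incl _ _ _ _ ?_
    rw [← incl_fibMor, app_incl, incl_anc]
  · rintro ⟨b, rfl⟩
    have h1 : app f m (incl f (incl g t (Fin.last n) s) m b) =
        incl g t m ((fib g t).anc s m) := by rw [incl_anc, app_incl]
    obtain ⟨c, hc⟩ := exists_incl (f ≫ g) t m (incl f (incl g t (Fin.last n) s) m b)
      ((congrArg (app g m) h1).trans (app_incl _ _ _ _))
    have h3 : app (fibMor f g t) m c = (fib g t).anc s m :=
      (incl_strictMono _ _ _).injective (by rw [incl_fibMor, hc, h1])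
    obtain ⟨d, hd⟩ := exists_incl (fibMor f g t) s m c h3
    exact ⟨d, by rw [hd, hc]⟩

lemma fib_id (t : Fin (T.size (Fin.last n))) : fib (𝟙 T) t = linear n :=
  eq_of_incl _ _ T (fun m => incl (𝟙 T) t m) (fun m _ => T.anc t m)
    (fun m => incl_strictMono _ _ _) (fun m a b h => absurd (Subsingleton.elim (α := Fin 1) a b) h.ne)
    (fun k a => par_incl _ _ _ _) (fun k a => (anc_castSucc _ _ _).symm) (fun m a => by
      constructor
      · rintro ⟨b, rfl⟩
        exact ⟨(0 : Fin 1), (app_incl (𝟙 T) t m b).symm⟩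
      · rintro ⟨b, rfl⟩
        exact exists_incl (𝟙 T) t m (T.anc t m) rfl)

/-- The map to the linear tree. -/
def toLinear (T : LevelTree n) : T ⟶ linear n where
  app _ _ := (0 : Fin 1)
  comm _ _ := rfl
  mono _ _ _ _ _ := le_rfl

lemma fib_toLinear (t : Fin ((linear n).size (Fin.last n))) : fib (toLinear T) t = T :=
  eq_of_incl _ _ T (fun m => incl _ t m) (fun m a => a)
    (fun m => incl_strictMono _ _ _) (fun m => strictMono_id)
    (fun k a => par_incl _ _ _ _) (fun k a => rfl) (fun m a =>
      ⟨fun _ => ⟨a, rfl⟩, fun _ => exists_incl _ _ _ _ (Subsingleton.elim (α := Fin 1) _ _)⟩)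

end

/-- The fibres of a map of trees are the fibres over the vertices of height `n`. -/
instance : FibredCategory (LevelTree n) where
  card T := T.size (Fin.last n)
  tips f := app f (Fin.last n)
  tips_id _ _ := rfl
  tips_comp _ _ _ := rfl
  fib := fib
  card_fib := size_fib
  fibMor := fibMor
  tips_fibMor f g i a := (incl_last g i _).trans ((incl_fibMor f g i _ a).trans
    (congrArg _ (incl_last (f ≫ g) i a).symm))
  fib_fibMor f g i j := (fib_fibMor f g i j).trans (congrArg (fib f) (incl_last g i j).symm)
  U := linear n
  card_U := rfl
  fib_id _ := fib_id
  toU := toLinear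
  fib_toU _ := fib_toLinear

/-- The number of tips. -/
abbrev tipCard (T : LevelTree n) : ℕ := FibredCategory.card T

end LevelTree

section Symmetrisation

variable (n : ℕ) (V : Type u) [Category.{v} V]

/-- The functor `W_n` from nonsymmetric collections to `n`-collections, `W_n(A)_T = A_{|T|}`. -/
def collW : (ℕ → V) ⥤ (LevelTree n → V) where
  obj A T := A T.tipCard
  map f T := f T.tipCard

/-- The functor `C_n` from `n`-collections to nonsymmetric collections: `C_n(B)_k` is the coproduct
of the objects `B_T` for all trees `T` with `k` tips. -/
noncomputable def collC [HasColimits V] : (LevelTree n → V) ⥤ (ℕ → V) where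
  obj B k := ∐ fun T : {T : LevelTree n // T.tipCard = k} => B T.1
  map f _ := Limits.Sigma.map fun T => f T.1
  map_id _ := funext fun _ => by ext; simp
  map_comp _ _ := funext fun _ => by ext; simp

variable {n V} in
/-- The inclusion of a summand. -/
noncomputable abbrev inc [HasColimits V] (B : LevelTree n → V) (T : LevelTree n) :
    B T ⟶ (collC n V).obj B T.tipCard :=
  Limits.Sigma.ι (fun S : {S : LevelTree n // S.tipCard = T.tipCard} => B S.1) ⟨T, rfl⟩

variable {n V} in
/-- The map out of the coproduct. -/
noncomputable abbrev descC [HasColimits V] {B : LevelTree n → V} {A : ℕ → V} (g : B ⟶ (collW n V).obj A) :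
    (collC n V).obj B ⟶ A :=
  fun _ => Limits.Sigma.desc fun T => g T.1 ≫ eqToHom (congrArg A T.2)

variable {n V} in
lemma inc_descC [HasColimits V] {B : LevelTree n → V} {A : ℕ → V} (g : B ⟶ (collW n V).obj A)
    (T : LevelTree n) : inc B T ≫ descC g T.tipCard = g T :=
  (Limits.Sigma.ι_desc _ _).trans (Category.comp_id _)

variable {n V} in
lemma hom_ext_C [HasColimits V] {B : LevelTree n → V} {A : ℕ → V} {f g : (collC n V).obj B ⟶ A}
    (h : ∀ T, inc B T ≫ f T.tipCard = inc B T ≫ g T.tipCard) : f = g :=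
  funext fun _ => Limits.Sigma.hom_ext _ _ (by rintro ⟨T, rfl⟩; exact h T)

variable {n V} in
lemma inc_map [HasColimits V] {B B' : LevelTree n → V} (f : B ⟶ B') (T : LevelTree n) :
    inc B T ≫ (collC n V).map f T.tipCard = f T ≫ inc B' T :=
  Limits.Sigma.ι_map (fun S : {S : LevelTree n // S.tipCard = T.tipCard} => f S.1) ⟨T, rfl⟩

/-- The adjunction between `C_n` and `W_n`. -/
noncomputable def adjCollCW [HasColimits V] : collC n V ⊣ collW n V :=
  Adjunction.mkOfHomEquiv
    { homEquiv := fun B A =>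
        { toFun := fun f T => inc B T ≫ f T.tipCard
          invFun := descC
          left_inv := fun f => hom_ext_C fun T => inc_descC _ T
          right_inv := fun g => funext fun T => inc_descC _ T }
      homEquiv_naturality_left_symm := fun f g => hom_ext_C fun T =>
        (inc_descC (f ≫ g) T).trans (by
          change f T ≫ g T = inc _ T ≫ (collC n V).map f T.tipCard ≫ descC g T.tipCard
          rw [reassoc_of% (inc_map f T), inc_descC]
          rfl)
      homEquiv_naturality_right := fun f g => funext fun T => (Category.assoc _ _ _).symm }

variable [MonoidalCategory V] [SymmetricCategory V]

/-- The category `O_n(V)` of `n`-operads. -/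
abbrev NOperad := Operad V (LevelTree n)

/-- The forgetful functor `R_n` from `n`-operads to `n`-collections. -/
abbrev forgetN : NOperad n V ⥤ (LevelTree n → V) := Operad.forget V (LevelTree n)

/-- The forgetful functor `R_∞` from left symmetric operads to nonsymmetric collections. -/
abbrev forgetInf : SymOperad V ⥤ (ℕ → V) := SymOperad.forget V

/-- The desymmetrisation functor `Des_n` from left symmetric operads to `n`-operads. -/
abbrev Des : SymOperad V ⥤ NOperad n V := SymOperad.des V (LevelTree n)

/-- The square of the desymmetrisation and the forgetful functors. -/
def squareIso : Des n V ⋙ forgetN n V ≅ forgetInf V ⋙ collW n V := Iso.refl _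

variable [HasColimits V]

variable {n V} in
/-- The operad map from the free `n`-operad on `X` to the desymmetrisation of the free symmetric
operad on `C_n(X)` that extends the unit of the adjunction. -/
noncomputable def freeToDes {Finf : (ℕ → V) ⥤ SymOperad V} (adjInf : Finf ⊣ forgetInf V)
    {F : (LevelTree n → V) ⥤ NOperad n V} (adj : F ⊣ forgetN n V) (X : LevelTree n → V) :
    F.obj X ⟶ (Des n V).obj (Finf.obj ((collC n V).obj X)) :=
  (adj.homEquiv _ _).symm (((adjCollCW n V).comp adjInf).unit.app X ≫
    (squareIso n V).inv.app _)

variable {n V} in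
/-- The canonical right action of the monad `R_n F_n` on the functor `F_∞ C_n`. -/
noncomputable def rightAction {Finf : (ℕ → V) ⥤ SymOperad V} (adjInf : Finf ⊣ forgetInf V)
    {F : (LevelTree n → V) ⥤ NOperad n V} (adj : F ⊣ forgetN n V) :
    (F ⋙ forgetN n V) ⋙ (collC n V ⋙ Finf) ⟶ collC n V ⋙ Finf where
  app X := (((adjCollCW n V).comp adjInf).homEquiv _ _).symm
    ((forgetN n V).map (freeToDes adjInf adj X) ≫ (squareIso n V).hom.app _)
  naturality X Y f := by
    have h : F.map f ≫ freeToDes adjInf adj Y =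
        freeToDes adjInf adj X ≫ (Des n V).map (Finf.map ((collC n V).map f)) := by
      rw [freeToDes, freeToDes, ← Adjunction.homEquiv_naturality_left_symm,
        ← Adjunction.homEquiv_naturality_right_symm]
      congr 1
      have h1 := ((adjCollCW n V).comp adjInf).unit.naturality f
      have h2 := (squareIso n V).inv.naturality (Finf.map ((collC n V).map f))
      simp only [Functor.comp_map, Functor.id_map] at h1 h2
      rw [Category.assoc, reassoc_of% h1]
      exact congrArg _ h2
    have h' := congrArg (forgetN n V).map h
    simp only [Functor.map_comp] at h'
    have h2 := (squareIso n V).hom.naturality (Finf.map ((collC n V).map f))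
    simp only [Functor.comp_map] at h2
    simp only [Functor.comp_map]
    rw [← Functor.comp_map, ← Adjunction.homEquiv_naturality_left_symm,
      ← Adjunction.homEquiv_naturality_right_symm]
    congr 1
    rw [reassoc_of% h', Category.assoc]
    exact congrArg _ h2

end Symmetrisation

/-- The unit and the associativity law for a right action of a monad on a functor. -/
structure IsRightAction {E D : Type*} [Category E] [Category D] (T : Monad E) (G : E ⥤ D)
    (α : T.toFunctor ⋙ G ⟶ G) : Prop where
  unit (X : E) : G.map (T.η.app X) ≫ α.app X = 𝟙 (G.obj X)
  assoc (X : E) : G.map (T.μ.app X) ≫ α.app X = α.app (T.obj X) ≫ α.app X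

/-- A monad is cartesian if its functor preserves pullbacks and its unit and multiplication are
cartesian, i.e. all their naturality squares are pullbacks. -/
structure IsCartesianMonad {E : Type*} [Category E] (T : Monad E) : Prop where
  preserves : PreservesLimitsOfShape WalkingCospan T.toFunctor
  unit : NatTrans.Equifibered T.η
  mul : NatTrans.Equifibered T.μ

/-- A monad is finitary if its functor preserves filtered colimits. -/
def IsFinitaryMonad {E : Type*} [Category E] (T : Monad E) : Prop :=
  PreservesFilteredColimits T.toFunctor

end HigherOperads

open HigherOperads

/-!
# Symmetric operads and higher operads: adjunctions, monadicity and the cartesian right action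

**Coherence.** Diagrams in a symmetric monoidal category are checked on generalised elements, that
is, on the values of lax symmetric monoidal functors to types (`EltFun`). Morphisms that agree on
all products of such elements are equal (`elt_ext`); the generic elements, which are morphisms from
tensor products of lists of labelled objects up to permutation of the factors, detect this. The laws
of operads thereby become equations between elements, as for operads of sets.

**One theory of operads.** The operads over trees of height `n` are operads over a category with
fibres. So, up to equivalence, are symmetric operads: in an operad over the category `FinAll` of
*all* maps of finite ordinals, composition with units along a bijection defines an action of the
bijections, and the two equivariance conditions say precisely that a symmetric operad extends
uniquely to such an operad (`SymOperad.toAll` is an equivalence). Both categories are `Levelled`,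
meaning that their maps and fibres are determined by finite ordinals; this gives the compatibility
of iterated fibres on which associativity depends.

**Free operads.** Over a `Levelled` category, each formal composite of generators is either the unit
or has an outermost generator, composed along some map with formal composites in its fibres. These
are the elements of `Tree`, and the free operad is the coproduct over them of tensor products of
generators (`Free.operad`, `Free.adjunction`). As the tensor product preserves colimits in each
variable, the multiplication is defined, and its laws are proved, by recursion on trees.

**Monadicity and adjoints.** The tensor product of coequalizers of reflexive pairs is again such a
coequalizer (`IsReflCoeq.tensor`), so reflexive coequalizers of operads exist and are computed
levelwise. Hence the forgetful functors are monadic (`Operad.monadicForget`,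
`SymOperad.monadicForgetInf`), and adjoint lifting along the equality of `des_forget` gives the left
adjoint of desymmetrisation (`isRightAdjoint_des`). The square of left adjoints commutes up to the
conjugate of that equality. The laws of the right action follow by passing to transposes
(`isRightAction_rightAction`).

**Sets.** An operad of sets is free if each of its elements is the value of a unique tree labelled
by generators (`OperadStr.IsFree`), and left adjoints of the forgetful functors produce such operads
(`isFree_of_adjunction`, `isFree_toAll`). Two facts about labelled trees carry the remaining
assertions. Relabelling is cartesian: decompositions of a relabelled tree lift uniquely
(`OperadStr.IsFree.isCart`). And a square from a map of free operads to a cartesian map of operads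
is a pullback as soon as it is one on generators (`OperadStr.IsFree.isPb`). On generators, the
naturality squares of the multiplication and of the right action reduce to identities, to naturality
squares of the unit, and to those of coprojections, which are pullbacks; this gives
`isCartesianMonad` and `equifibered_rightAction`. The monad is finitary because a labelled tree has
finitely many labels (`isFinitaryMonad`).
-/

namespace HigherOperads

/-! ### Generalised elements of a symmetric monoidal category -/

section EltFun

/-- A lax symmetric monoidal functor `V → Type v`. Its values are regarded as sets of generalised
elements of the objects of `V`: a morphism acts on elements by `map`, and elements of `A` and `B`
have a product `tmul` in `A ⊗ B`. -/
structure EltFun (V : Type u) [Category.{v} V] [MonoidalCategory V] [SymmetricCategory V] where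
  obj : V → Type v
  map {A B : V} (f : A ⟶ B) : obj A → obj B
  map_id {A : V} (a : obj A) : map (𝟙 A) a = a
  map_comp {A B C : V} (f : A ⟶ B) (g : B ⟶ C) (a : obj A) : map (f ≫ g) a = map g (map f a)
  one : obj (𝟙_ V)
  tmul {A B : V} (a : obj A) (b : obj B) : obj (A ⊗ B)
  map_tmul {A A' B B' : V} (f : A ⟶ A') (g : B ⟶ B') (a : obj A) (b : obj B) :
    map (f ⊗ₘ g) (tmul a b) = tmul (map f a) (map g b)
  map_assoc {A B C : V} (a : obj A) (b : obj B) (c : obj C) :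
    map (α_ A B C).hom (tmul (tmul a b) c) = tmul a (tmul b c)
  map_left {A : V} (a : obj A) : map (λ_ A).hom (tmul one a) = a
  map_right {A : V} (a : obj A) : map (ρ_ A).hom (tmul a one) = a
  map_braid {A B : V} (a : obj A) (b : obj B) : map (β_ A B).hom (tmul a b) = tmul b a

namespace EltFun

variable {V : Type u} [Category.{v} V] [MonoidalCategory V] [SymmetricCategory V] (Λ : EltFun V)

lemma map_inv {A B : V} (e : A ≅ B) {a : Λ.obj A} {b : Λ.obj B} (h : Λ.map e.hom a = b) :
    Λ.map e.inv b = a := by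
  rw [← h, ← Λ.map_comp, e.hom_inv_id, Λ.map_id]

lemma map_whiskerLeft (A : V) {B B' : V} (g : B ⟶ B') (a : Λ.obj A) (b : Λ.obj B) :
    Λ.map (A ◁ g) (Λ.tmul a b) = Λ.tmul a (Λ.map g b) := by
  rw [← id_tensorHom, Λ.map_tmul, Λ.map_id]

lemma map_whiskerRight {A A' : V} (f : A ⟶ A') (B : V) (a : Λ.obj A) (b : Λ.obj B) :
    Λ.map (f ▷ B) (Λ.tmul a b) = Λ.tmul (Λ.map f a) b := by
  rw [← tensorHom_id, Λ.map_tmul, Λ.map_id]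

/-- The product of a family of elements. -/
def tens : (k : ℕ) → {X : Fin k → V} → (∀ i, Λ.obj (X i)) → Λ.obj (HigherOperads.tens k X)
  | 0, _, _ => Λ.one
  | k + 1, _, a => Λ.tmul (a 0) (tens k (fun i => a i.succ))

lemma map_tensMap (k : ℕ) {X Y : Fin k → V} (f : ∀ i, X i ⟶ Y i) (a : ∀ i, Λ.obj (X i)) :
    Λ.map (tensMap k f) (Λ.tens k a) = Λ.tens k (fun i => Λ.map (f i) (a i)) := by
  induction k with
  | zero => exact Λ.map_id _
  | succ k ih => exact (Λ.map_tmul _ _ _ _).trans (congrArg _ (ih _ _))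

lemma map_swap {A B C : V} (a : Λ.obj A) (b : Λ.obj B) (c : Λ.obj C) :
    Λ.map (swap A B C) (Λ.tmul a (Λ.tmul b c)) = Λ.tmul b (Λ.tmul a c) := by
  rw [swap, Λ.map_comp, Λ.map_comp, Λ.map_inv _ (Λ.map_assoc a b c), map_whiskerRight, Λ.map_braid,
    Λ.map_assoc]

lemma map_tensUnit (k : ℕ) :
    Λ.map (tensUnit k) (Λ.tens k (fun _ => Λ.one)) = Λ.one := by
  induction k with
  | zero => exact Λ.map_id _
  | succ k ih =>
    change Λ.map ((λ_ _).hom ≫ tensUnit k) (Λ.tmul Λ.one _) = _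
    rw [Λ.map_comp, Λ.map_left, ih]

lemma map_tensOne {Y : V} (k : ℕ) (h : k = 1) (y : Λ.obj Y) :
    Λ.map (tensOne Y k h) y = Λ.tens k (fun _ => y) := by
  subst h
  exact Λ.map_inv _ (Λ.map_right y)

variable {J : Type} {Y : J → V} (a : ∀ j, Λ.obj (Y j))

/-- The product of the elements `a j` over a list of labels. -/
def listElt : (l : List J) → Λ.obj (listTens Y l)
  | [] => Λ.one
  | j :: l => Λ.tmul (a j) (listElt l)

/-- The product of the elements `a j` according to a formal expression. -/
def wordElt : (w : Word J) → Λ.obj (w.eval Y)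
  | .leaf j => a j
  | .tensor w w' => Λ.tmul (wordElt w) (wordElt w')
  | .prod k f => Λ.tens k (fun i => wordElt (f i))

lemma map_appIso (l l' : List J) :
    Λ.map (appIso Y l l').hom (Λ.tmul (Λ.listElt a l) (Λ.listElt a l')) =
      Λ.listElt a (l ++ l') := by
  induction l with
  | nil => exact Λ.map_left _
  | cons j l ih =>
    change Λ.map ((α_ _ _ _).hom ≫ Y j ◁ (appIso Y l l').hom)
      (Λ.tmul (Λ.tmul (a j) (Λ.listElt a l)) (Λ.listElt a l')) =
        Λ.tmul (a j) (Λ.listElt a (l ++ l'))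
    rw [Λ.map_comp, Λ.map_assoc, map_whiskerLeft, ih]

lemma map_concatIso (k : ℕ) (g : Fin k → List J) (Z : Fin k → V)
    (e : ∀ i, Z i ≅ listTens Y (g i)) (b : ∀ i, Λ.obj (Z i))
    (h : ∀ i, Λ.map (e i).hom (b i) = Λ.listElt a (g i)) :
    Λ.map (concatIso Y k g Z e).hom (Λ.tens k b) = Λ.listElt a (concat k g) := by
  induction k with
  | zero => exact Λ.map_id _
  | succ k ih =>
    change Λ.map (((e 0).hom ⊗ₘ (concatIso Y k _ _ (fun i => e i.succ)).hom) ≫ (appIso Y _ _).hom)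
      (Λ.tmul (b 0) (Λ.tens k (fun i => b i.succ))) = Λ.listElt a (g 0 ++ concat k _)
    rw [Λ.map_comp, Λ.map_tmul, h, ih _ _ _ _ (fun i => h i.succ), map_appIso]

lemma map_norm (w : Word J) : Λ.map (w.norm Y).hom (Λ.wordElt a w) = Λ.listElt a w.leaves := by
  induction w with
  | leaf j => exact Λ.map_inv _ (Λ.map_right _)
  | tensor w w' ih ih' =>
    change Λ.map (((w.norm Y).hom ⊗ₘ (w'.norm Y).hom) ≫ (appIso Y _ _).hom)
      (Λ.tmul (Λ.wordElt a w) (Λ.wordElt a w')) = Λ.listElt a (w.leaves ++ w'.leaves)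
    rw [Λ.map_comp, Λ.map_tmul, ih, ih', map_appIso]
  | prod k f ih => exact Λ.map_concatIso a k _ _ _ _ ih

lemma map_insHom {j : J} {l l' : List J} (i : Ins j l l') :
    Λ.map (insHom Y i) (Λ.tmul (a j) (Λ.listElt a l)) = Λ.listElt a l' := by
  induction i with
  | here l => exact Λ.map_id _
  | there b i ih =>
    rename_i l l'
    change Λ.map (swap _ _ _ ≫ Y b ◁ insHom Y i) (Λ.tmul (a j) (Λ.tmul (a b) (Λ.listElt a l))) =
      Λ.tmul (a b) (Λ.listElt a l')
    rw [Λ.map_comp, map_swap, map_whiskerLeft, ih]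

lemma map_permHom {l l' : List J} (p : LPerm l l') :
    Λ.map (permHom Y p) (Λ.listElt a l) = Λ.listElt a l' := by
  induction p with
  | nil => exact Λ.map_id _
  | cons j p i ih =>
    rename_i l _ _
    change Λ.map (Y j ◁ permHom Y p ≫ insHom Y i) (Λ.tmul (a j) (Λ.listElt a l)) = _
    rw [Λ.map_comp, map_whiskerLeft, ih, map_insHom]

/-- The canonical symmetries permute the factors of a product of elements. -/
lemma map_can {w w' : Word J} (h : w.SameLeaves w') :
    Λ.map (can Y w w' h) (Λ.wordElt a w) = Λ.wordElt a w' := by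
  obtain ⟨p, -⟩ := h.exists_perm
  rw [can_eq Y w w' h p, Λ.map_comp, Λ.map_comp, map_norm, map_permHom]
  exact Λ.map_inv _ (Λ.map_norm a w')

end EltFun

/-! ### Generic elements

For a family `X` of objects, labelled by a type `J`, the elements of `A` are the morphisms to `A`
from the tensor products of objects of the family, up to permutations of the factors. -/

variable {V : Type u} [Category.{v} V] [MonoidalCategory V] [SymmetricCategory V] {J : Type}
  (X : J → V)

/-- An insertion followed by a suitable permutation is a permutation that fixes the inserted factor.
This is what makes permutations invertible. -/
lemma insHom_cancel {a : J} {l l' m : List J} (i : Ins a l l') (q : LPerm l m) :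
    ∃ r : LPerm l' (a :: m), insHom X i ≫ permHom X r = X a ◁ permHom X q := by
  induction i generalizing m with
  | here l =>
    refine ⟨.cons a q (.here m), ?_⟩
    simp [insHom, permHom]
  | there b i ih =>
    cases q with
    | cons _ q j =>
      rename_i l l' m'
      obtain ⟨r, hr⟩ := ih q
      refine ⟨.cons b r (.there a j), ?_⟩
      have n1 := swap_nat (𝟙 (X a)) (𝟙 (X b)) (permHom X q)
      simp only [id_tensorHom] at n1
      have h1 := congrArg (fun t => X b ◁ t) hr
      simp only [MonoidalCategory.whiskerLeft_comp] at h1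
      simp only [insHom, permHom, MonoidalCategory.whiskerLeft_comp, Category.assoc]
      rw [reassoc_of% h1, ← reassoc_of% n1, ← Category.assoc (swap _ _ _), swap_swap]
      exact congrArg _ (Category.id_comp _)

/-- Every permutation has a right inverse, and hence an inverse, among the permutations. -/
lemma permHom_inverse {l l' : List J} (p : LPerm l l') :
    ∃ q : LPerm l' l, permHom X p ≫ permHom X q = 𝟙 _ := by
  induction p with
  | nil => exact ⟨.nil, Category.id_comp _⟩
  | cons a p i ih =>
    obtain ⟨q, hq⟩ := ih
    obtain ⟨r, hr⟩ := insHom_cancel X i q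
    refine ⟨r, ?_⟩
    simp only [permHom, Category.assoc]
    rw [hr, ← MonoidalCategory.whiskerLeft_comp, hq, whiskerLeft_id]

/-- The associativity isomorphisms agree with a permutation, whose underlying map of positions is
the identity: the two lists are equal, but not by definition. -/
lemma permHom_assoc (l l' l'' : List J) : ∃ p : LPerm ((l ++ l') ++ l'') (l ++ (l' ++ l'')),
    (appIso X l l').hom ▷ listTens X l'' ≫ (appIso X (l ++ l') l'').hom ≫ permHom X p =
      (α_ _ _ _).hom ≫ listTens X l ◁ (appIso X l' l'').hom ≫ (appIso X l (l' ++ l'')).hom := by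
  induction l with
  | nil =>
    obtain ⟨p, hp⟩ := permHom_id X (l' ++ l'')
    refine ⟨p, ?_⟩
    change (λ_ _).hom ▷ _ ≫ (appIso X l' l'').hom ≫ permHom X p =
      (α_ _ _ _).hom ≫ 𝟙_ V ◁ (appIso X l' l'').hom ≫ (λ_ _).hom
    rw [hp]
    simp
  | cons a l ih =>
    obtain ⟨p, hp⟩ := ih
    refine ⟨.cons a p (.here _), ?_⟩
    have h1 := congrArg (fun t => X a ◁ t) hp
    simp only [MonoidalCategory.whiskerLeft_comp] at h1
    change ((α_ _ _ _).hom ≫ X a ◁ (appIso X l l').hom) ▷ _ ≫ ((α_ _ _ _).hom ≫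
      X a ◁ (appIso X (l ++ l') l'').hom) ≫ X a ◁ permHom X p ≫ 𝟙 _ =
      (α_ _ _ _).hom ≫ (X a ⊗ listTens X l) ◁ (appIso X l' l'').hom ≫ (α_ _ _ _).hom ≫
        X a ◁ (appIso X l (l' ++ l'')).hom
    simp only [comp_whiskerRight, Category.assoc, Category.comp_id]
    rw [associator_naturality_middle_assoc, h1]
    simp

lemma permHom_right (l : List J) : ∃ p : LPerm (l ++ []) l,
    (appIso X l []).hom ≫ permHom X p = (ρ_ _).hom := by
  induction l with
  | nil => exact ⟨.nil, (Category.comp_id _).trans unitors_equal⟩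
  | cons a l ih =>
    obtain ⟨p, hp⟩ := ih
    refine ⟨.cons a p (.here _), ?_⟩
    change ((α_ _ _ _).hom ≫ X a ◁ (appIso X l []).hom) ≫ X a ◁ permHom X p ≫ 𝟙 _ = _
    rw [Category.comp_id, Category.assoc, ← MonoidalCategory.whiskerLeft_comp, hp]
    simp

/-- Moving a factor past a whole list is an insertion. -/
lemma insHom_block (a : J) (l' l : List J) : ∃ i : Ins a (l' ++ l) (l' ++ (a :: l)),
    X a ◁ (appIso X l' l).hom ≫ insHom X i = swap _ _ _ ≫ (appIso X l' (a :: l)).hom := by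
  induction l' with
  | nil =>
    refine ⟨.here _, ?_⟩
    change X a ◁ (λ_ _).hom ≫ 𝟙 _ = swap _ _ _ ≫ (λ_ _).hom
    simp [swap]
  | cons b l' ih =>
    obtain ⟨i, hi⟩ := ih
    refine ⟨.there b i, ?_⟩
    have hn := swap_nat (𝟙 (X a)) (𝟙 (X b)) (appIso X l' l).hom
    simp only [id_tensorHom] at hn
    have h1 := congrArg (fun t => X b ◁ t) hi
    simp only [MonoidalCategory.whiskerLeft_comp] at h1
    change X a ◁ ((α_ _ _ _).hom ≫ X b ◁ (appIso X l' l).hom) ≫ swap _ _ _ ≫ X b ◁ insHom X i =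
      swap _ _ _ ≫ (α_ _ _ _).hom ≫ X b ◁ (appIso X l' (a :: l)).hom
    simp only [MonoidalCategory.whiskerLeft_comp, Category.assoc]
    rw [reassoc_of% hn, h1]
    simp only [← Category.assoc]
    congr 1
    simp only [swap, BraidedCategory.braiding_tensor_right_hom]
    monoidal

/-- The braiding of two lists of factors is a permutation. -/
lemma permHom_braid (l l' : List J) : ∃ p : LPerm (l ++ l') (l' ++ l),
    (appIso X l l').hom ≫ permHom X p = (β_ _ _).hom ≫ (appIso X l' l).hom := by
  induction l with
  | nil =>
    obtain ⟨p, hp⟩ := permHom_right X l'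
    obtain ⟨q, hq⟩ := permHom_inverse X p
    refine ⟨q, ?_⟩
    change (λ_ _).hom ≫ permHom X q = _
    have h1 : (appIso X l' []).hom = (ρ_ _).hom ≫ permHom X q := by
      rw [← hp, Category.assoc, hq, Category.comp_id]
    rw [h1]
    simp
  | cons a l ih =>
    obtain ⟨p, hp⟩ := ih
    obtain ⟨i, hi⟩ := insHom_block X a l' l
    refine ⟨.cons a p i, ?_⟩
    have h1 := congrArg (fun t => X a ◁ t) hp
    simp only [MonoidalCategory.whiskerLeft_comp] at h1
    change ((α_ _ _ _).hom ≫ X a ◁ (appIso X l l').hom) ≫ X a ◁ permHom X p ≫ insHom X i = _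
    rw [Category.assoc, reassoc_of% h1, hi]
    simp only [swap, ← Category.assoc]
    congr 1
    simp only [BraidedCategory.braiding_tensor_left_hom]
    monoidal

/-- Two morphisms from tensor products of lists of labels define the same generic element if they
differ by a permutation of the factors. -/
def genericSetoid (A : V) : Setoid (Σ l : List J, (listTens X l ⟶ A)) where
  r f g := ∃ p : LPerm f.1 g.1, f.2 = permHom X p ≫ g.2
  iseqv :=
    { refl := fun f => by
        obtain ⟨p, hp⟩ := permHom_id X f.1
        exact ⟨p, by rw [hp, Category.id_comp]⟩
      symm := by
        rintro f g ⟨p, hp⟩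
        obtain ⟨q, hq⟩ := permHom_inverse X p
        obtain ⟨p', hp'⟩ := permHom_inverse X q
        -- a right inverse of a right inverse of `p` is `p` itself
        have h : permHom X p = permHom X p' := by
          rw [← Category.comp_id (permHom X p), ← hp', ← Category.assoc, hq, Category.id_comp]
        exact ⟨q, by rw [hp, h, ← Category.assoc, hp', Category.id_comp]⟩
      trans := by
        rintro f g h ⟨p, hp⟩ ⟨q, hq⟩
        obtain ⟨r, hr⟩ := permHom_comp X p q
        exact ⟨r, by rw [hp, hq, ← hr, Category.assoc]⟩ }

variable {X} in
/-- The generic element that is given by a morphism. -/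
def genericMk {A : V} (l : List J) (f : listTens X l ⟶ A) : Quotient (genericSetoid X A) :=
  Quotient.mk _ ⟨l, f⟩

variable {X} in
lemma genericMk_eq {A : V} {l l' : List J} {f : listTens X l ⟶ A} {f' : listTens X l' ⟶ A}
    (p : LPerm l l') (h : f = permHom X p ≫ f') : genericMk l f = genericMk l' f' :=
  Quotient.sound ⟨p, h⟩

/-- The generic elements as generalised elements: they multiply by concatenation of the lists of
labels. Passing to classes up to permutation makes the product strictly compatible with the
braiding. -/
def genericElt : EltFun V where
  obj A := Quotient (genericSetoid X A)
  map g := Quotient.map (fun f => ⟨f.1, f.2 ≫ g⟩)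
    (by rintro _ _ ⟨p, hp⟩; exact ⟨p, by rw [hp, Category.assoc]⟩)
  map_id := by
    rintro A ⟨l, f⟩
    exact congrArg (genericMk l) (Category.comp_id f)
  map_comp := by
    rintro A B C g h ⟨l, f⟩
    exact congrArg (genericMk l) (Category.assoc f g h).symm
  one := genericMk [] (𝟙 _)
  tmul := Quotient.map₂ (fun f g => ⟨f.1 ++ g.1, (appIso X _ _).inv ≫ (f.2 ⊗ₘ g.2)⟩) (by
    rintro f f' ⟨p, hp⟩ g g' ⟨q, hq⟩
    obtain ⟨r, hr⟩ := permHom_append X p q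
    refine ⟨r, ?_⟩
    rw [hp, hq, ← tensorHom_comp_tensorHom, Iso.inv_comp_eq, ← reassoc_of% hr,
      Iso.hom_inv_id_assoc])
  map_tmul := by
    rintro A A' B B' f g ⟨l, a⟩ ⟨l', b⟩
    exact congrArg (genericMk (l ++ l'))
      ((Category.assoc _ _ _).trans (congrArg _ (tensorHom_comp_tensorHom _ _ _ _)))
  map_assoc := by
    rintro A B C ⟨l, a⟩ ⟨l', b⟩ ⟨l'', c⟩
    obtain ⟨p, hp⟩ := permHom_assoc X l l' l''
    refine genericMk_eq p ?_
    change ((appIso X (l ++ l') l'').inv ≫ (((appIso X l l').inv ≫ (a ⊗ₘ b)) ⊗ₘ c)) ≫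
        (α_ A B C).hom =
      permHom X p ≫ (appIso X l (l' ++ l'')).inv ≫ (a ⊗ₘ ((appIso X l' l'').inv ≫ (b ⊗ₘ c)))
    have h2 : permHom X p = (appIso X (l ++ l') l'').inv ≫ (appIso X l l').inv ▷ _ ≫
        (α_ _ _ _).hom ≫ listTens X l ◁ (appIso X l' l'').hom ≫ (appIso X l (l' ++ l'')).hom := by
      rw [← hp]; simp
    rw [h2]
    simp only [Category.assoc, Iso.hom_inv_id_assoc]
    congr 1
    have h3 : ((appIso X l l').inv ≫ (a ⊗ₘ b)) ⊗ₘ c =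
        (appIso X l l').inv ▷ _ ≫ ((a ⊗ₘ b) ⊗ₘ c) := by
      rw [← tensorHom_id, tensorHom_comp_tensorHom, Category.id_comp]
    have h4 : listTens X l ◁ (appIso X l' l'').hom ≫ (a ⊗ₘ (appIso X l' l'').inv ≫ (b ⊗ₘ c)) =
        a ⊗ₘ (b ⊗ₘ c) := by
      rw [← id_tensorHom, tensorHom_comp_tensorHom, Category.id_comp, Iso.hom_inv_id_assoc]
    rw [h3, h4, Category.assoc, associator_naturality]
  map_left := by
    rintro A ⟨l, a⟩
    obtain ⟨p, hp⟩ := permHom_id X l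
    refine genericMk_eq p ?_
    change ((λ_ _).inv ≫ (𝟙 _ ⊗ₘ a)) ≫ (λ_ A).hom = permHom X p ≫ a
    rw [hp]
    simp
  map_right := by
    rintro A ⟨l, a⟩
    obtain ⟨p, hp⟩ := permHom_right X l
    refine genericMk_eq p ?_
    change ((appIso X l []).inv ≫ (a ⊗ₘ 𝟙 _)) ≫ (ρ_ A).hom = permHom X p ≫ a
    rw [Category.assoc, Iso.inv_comp_eq, ← Category.assoc, hp]
    simp
  map_braid := by
    rintro A B ⟨l, a⟩ ⟨l', b⟩
    obtain ⟨p, hp⟩ := permHom_braid X l l'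
    refine genericMk_eq p ?_
    change ((appIso X l l').inv ≫ (a ⊗ₘ b)) ≫ (β_ A B).hom =
      permHom X p ≫ (appIso X l' l).inv ≫ (b ⊗ₘ a)
    rw [Category.assoc, Iso.inv_comp_eq, reassoc_of% hp, Iso.hom_inv_id_assoc,
      BraidedCategory.braiding_naturality]

/-- The generic element of the object with a given label. -/
def genericLeaf (j : J) : (genericElt X).obj (X j) := genericMk [j] (ρ_ (X j)).hom

lemma genericElt_tens (k : ℕ) (g : Fin k → List J) (Z : Fin k → V)
    (e : ∀ i, Z i ≅ listTens X (g i)) (b : ∀ i, (genericElt X).obj (Z i))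
    (h : ∀ i, b i = genericMk (g i) (e i).inv) :
    (genericElt X).tens k b = genericMk (concat k g) (concatIso X k g Z e).inv := by
  induction k with
  | zero => rfl
  | succ k ih =>
    change (genericElt X).tmul (b 0) ((genericElt X).tens k (fun i => b i.succ)) = _
    rw [h 0, ih _ _ _ _ (fun i => h i.succ)]
    rfl

lemma genericElt_wordElt (w : Word J) :
    (genericElt X).wordElt (genericLeaf X) w = genericMk w.leaves (w.norm X).inv := by
  induction w with
  | leaf j => rfl
  | tensor w w' ih ih' =>
    change (genericElt X).tmul ((genericElt X).wordElt (genericLeaf X) w)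
      ((genericElt X).wordElt (genericLeaf X) w') = _
    rw [ih, ih']
    rfl
  | prod k f ih => exact genericElt_tens X k _ _ _ _ ih

variable {X}

/-- Morphisms from the value of a formal expression without repeated labels are equal if they agree
on all products of generalised elements. It suffices to test on the product of the generic elements:
as the labels are distinct, the only permutation between the two sides is the identity. -/
lemma elt_ext {A : V} (w : Word J) (hw : w.leaves.Nodup) {f g : w.eval X ⟶ A}
    (h : ∀ (Λ : EltFun V) (a : ∀ j, Λ.obj (X j)),
      Λ.map f (Λ.wordElt a w) = Λ.map g (Λ.wordElt a w)) : f = g := by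
  have h1 := h (genericElt X) (genericLeaf X)
  rw [genericElt_wordElt] at h1
  obtain ⟨p, hp⟩ : ∃ p : LPerm w.leaves w.leaves,
      (w.norm X).inv ≫ f = permHom X p ≫ (w.norm X).inv ≫ g := Quotient.exact h1
  obtain ⟨q, hq⟩ := permHom_id X w.leaves
  rw [LPerm.unique p q hw, hq, Category.id_comp] at hp
  exact (cancel_epi _).1 hp

end EltFun

open FibredCategory

/-! ### Operads in terms of generalised elements -/

/-! The lemmas `elt_ext_*` are the instances of `elt_ext` for the shapes of tensor products that
occur as sources of the diagrams in the theory of operads. -/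

section Ext

variable {V : Type u} [Category.{v} V] [MonoidalCategory V] [SymmetricCategory V]

lemma nodup_concat_singleton {J : Type} (k : ℕ) (g : Fin k → J) (hg : Function.Injective g) :
    (concat k fun i => [g i]).Nodup :=
  nodup_concat _ _ (by simp) (fun i i' a h h' => hg (by
    rw [List.mem_singleton] at h h'
    exact h.symm.trans h'))

lemma elt_ext_mul {k : ℕ} {A C : V} {B : Fin k → V} {f g : A ⊗ tens k B ⟶ C}
    (h : ∀ (Λ : EltFun V) (a : Λ.obj A) (b : ∀ i, Λ.obj (B i)),
      Λ.map f (Λ.tmul a (Λ.tens k b)) = Λ.map g (Λ.tmul a (Λ.tens k b))) : f = g :=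
  elt_ext (J := Unit ⊕ Fin k) (X := Sum.elim (fun _ => A) B)
    (.tensor (.leaf (.inl ())) (.prod k fun i => .leaf (.inr i)))
    (List.nodup_cons.2 ⟨by simp [mem_concat], nodup_concat_singleton k _ Sum.inr_injective⟩)
    (fun Λ a => h Λ (a (.inl ())) (fun i => a (.inr i)))

lemma elt_ext_units {k : ℕ} {A C : V} {f g : A ⊗ tens k (fun _ => 𝟙_ V) ⟶ C}
    (h : ∀ (Λ : EltFun V) (a : Λ.obj A),
      Λ.map f (Λ.tmul a (Λ.tens k (fun _ => Λ.one))) =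
        Λ.map g (Λ.tmul a (Λ.tens k (fun _ => Λ.one)))) : f = g :=
  elt_ext (J := Unit) (X := fun _ => A)
    (.tensor (.leaf ()) (.prod k fun _ => .prod 0 Fin.elim0))
    (List.nodup_cons.2 ⟨by simp [mem_concat], nodup_concat _ _ (by simp) (by simp)⟩)
    (fun Λ a => h Λ (a ()))

lemma elt_ext_unit {A C : V} {f g : 𝟙_ V ⊗ A ⟶ C}
    (h : ∀ (Λ : EltFun V) (a : Λ.obj A),
      Λ.map f (Λ.tmul Λ.one a) = Λ.map g (Λ.tmul Λ.one a)) : f = g :=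
  elt_ext (J := Unit) (X := fun _ => A) (.tensor (.prod 0 Fin.elim0) (.leaf ()))
    (List.nodup_singleton _) (fun Λ a => h Λ (a ()))

lemma elt_ext_one {C : V} {f g : 𝟙_ V ⟶ C}
    (h : ∀ (Λ : EltFun V), Λ.map f Λ.one = Λ.map g Λ.one) : f = g :=
  elt_ext (J := Empty) (X := Empty.elim) (.prod 0 Fin.elim0) List.nodup_nil (fun Λ _ => h Λ)

lemma elt_ext_leaf {A C : V} {f g : A ⟶ C}
    (h : ∀ (Λ : EltFun V) (a : Λ.obj A), Λ.map f a = Λ.map g a) : f = g :=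
  elt_ext (J := Unit) (X := fun _ => A) (.leaf ()) (List.nodup_singleton _) (fun Λ a => h Λ (a ()))

lemma elt_ext_unit_mul {k : ℕ} {C : V} {B : Fin k → V} {f g : 𝟙_ V ⊗ tens k B ⟶ C}
    (h : ∀ (Λ : EltFun V) (b : ∀ i, Λ.obj (B i)),
      Λ.map f (Λ.tmul Λ.one (Λ.tens k b)) = Λ.map g (Λ.tmul Λ.one (Λ.tens k b))) : f = g :=
  elt_ext (J := Fin k) (X := B) (.tensor (.prod 0 Fin.elim0) (.prod k fun i => .leaf i))
    (nodup_concat_singleton k _ Function.injective_id) (fun Λ a => h Λ a)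

section

variable {k l : ℕ} {m : Fin k → ℕ} {inc : ∀ i, Fin (m i) → Fin l}

lemma elt_ext_assoc (hinc : Function.Bijective (fun p : Σ i, Fin (m i) => inc p.1 p.2))
    {Y C : V} {X : Fin k → V} {Z : Fin l → V}
    {f g : Y ⊗ tens k (fun i => X i ⊗ tens (m i) (fun j => Z (inc i j))) ⟶ C}
    (h : ∀ (Λ : EltFun V) (y : Λ.obj Y) (x : ∀ i, Λ.obj (X i)) (z : ∀ s, Λ.obj (Z s)),
      Λ.map f (Λ.tmul y (Λ.tens k fun i => Λ.tmul (x i) (Λ.tens (m i) fun j => z (inc i j)))) =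
        Λ.map g (Λ.tmul y (Λ.tens k fun i => Λ.tmul (x i) (Λ.tens (m i) fun j => z (inc i j))))) :
    f = g :=
  elt_ext (X := Sum.elim (fun _ => Y) (Sum.elim X Z)) (shuffleSource m inc)
    (sameLeaves_shuffle hinc).nodup_left
    (fun Λ a => h Λ (a (.inl ())) (fun i => a (.inr (.inl i))) (fun s => a (.inr (.inr s))))

lemma elt_ext_unit_assoc (hinc : Function.Bijective (fun p : Σ i, Fin (m i) => inc p.1 p.2))
    {C : V} {X : Fin k → V} {Z : Fin l → V}
    {f g : 𝟙_ V ⊗ tens k (fun i => X i ⊗ tens (m i) (fun j => Z (inc i j))) ⟶ C}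
    (h : ∀ (Λ : EltFun V) (x : ∀ i, Λ.obj (X i)) (z : ∀ s, Λ.obj (Z s)),
      Λ.map f (Λ.tmul Λ.one
        (Λ.tens k fun i => Λ.tmul (x i) (Λ.tens (m i) fun j => z (inc i j)))) =
        Λ.map g (Λ.tmul Λ.one
          (Λ.tens k fun i => Λ.tmul (x i) (Λ.tens (m i) fun j => z (inc i j))))) :
    f = g :=
  elt_ext (J := Unit ⊕ (Fin k ⊕ Fin l)) (X := Sum.elim (fun _ => 𝟙_ V) (Sum.elim X Z))
    (.tensor (.prod 0 Fin.elim0) (.prod k fun i => .tensor (.leaf (.inr (.inl i)))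
      (.prod (m i) fun j => .leaf (.inr (.inr (inc i j))))))
    (List.nodup_cons.1 (sameLeaves_shuffle hinc).nodup_left).2
    (fun Λ a => h Λ (fun i => a (.inr (.inl i))) (fun s => a (.inr (.inr s))))

lemma elt_ext_node {A D : V} {B : Fin k → V} {C : Fin l → V}
    {f g : (A ⊗ tens k B) ⊗ tens l C ⟶ D}
    (h : ∀ (Λ : EltFun V) (a : Λ.obj A) (b : ∀ i, Λ.obj (B i)) (c : ∀ i, Λ.obj (C i)),
      Λ.map f (Λ.tmul (Λ.tmul a (Λ.tens k b)) (Λ.tens l c)) =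
        Λ.map g (Λ.tmul (Λ.tmul a (Λ.tens k b)) (Λ.tens l c))) : f = g :=
  elt_ext (X := Sum.elim (fun _ => A) (Sum.elim B C)) (shuffleTarget k l)
    (by
      refine List.nodup_cons.2 ⟨by simp [mem_concat], List.nodup_append.2
        ⟨nodup_concat_singleton k _ (Sum.inr_injective.comp Sum.inl_injective),
          nodup_concat_singleton l _ (Sum.inr_injective.comp Sum.inr_injective), ?_⟩⟩
      intro x hx y hy
      obtain ⟨i, hi⟩ := (mem_concat _ _ _).1 hx
      obtain ⟨j, hj⟩ := (mem_concat _ _ _).1 hy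
      rw [List.mem_singleton.1 hi, List.mem_singleton.1 hj]
      simp)
    (fun Λ a => h Λ (a (.inl ())) (fun i => a (.inr (.inl i))) (fun s => a (.inr (.inr s))))

lemma elt_ext_node_assoc (hinc : Function.Bijective (fun p : Σ i, Fin (m i) => inc p.1 p.2))
    {k' : ℕ} {A D : V} {B : Fin k' → V} {X : Fin k → V} {Z : Fin l → V}
    {f g : (A ⊗ tens k' B) ⊗ tens k (fun i => X i ⊗ tens (m i) (fun j => Z (inc i j))) ⟶ D}
    (h : ∀ (Λ : EltFun V) (a : Λ.obj A) (b : ∀ i, Λ.obj (B i)) (x : ∀ i, Λ.obj (X i))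
      (z : ∀ s, Λ.obj (Z s)),
      Λ.map f (Λ.tmul (Λ.tmul a (Λ.tens k' b))
        (Λ.tens k fun i => Λ.tmul (x i) (Λ.tens (m i) fun j => z (inc i j)))) =
        Λ.map g (Λ.tmul (Λ.tmul a (Λ.tens k' b))
          (Λ.tens k fun i => Λ.tmul (x i) (Λ.tens (m i) fun j => z (inc i j))))) : f = g :=
  elt_ext (J := Option (Fin k' ⊕ (Unit ⊕ (Fin k ⊕ Fin l))))
    (X := fun t => t.elim A (Sum.elim B (Sum.elim (fun _ => A) (Sum.elim X Z))))
    (.tensor (.tensor (.leaf none) (.prod k' fun i => .leaf (some (.inl i))))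
      ((Word.prod k fun i => .tensor (.leaf (.inr (.inl i)))
        (.prod (m i) fun j => .leaf (.inr (.inr (inc i j))))).map (fun t => some (.inr t))))
    (by
      refine List.nodup_cons.2 ⟨?_, List.nodup_append.2
        ⟨nodup_concat_singleton k' _ ((Option.some_injective _).comp Sum.inl_injective), ?_, ?_⟩⟩
      · simp [mem_concat]
      · have h := (List.nodup_cons.1 (sameLeaves_shuffle hinc).nodup_left).2.map
          (f := fun t : Unit ⊕ (Fin k ⊕ Fin l) =>
            (some (.inr t) : Option (Fin k' ⊕ (Unit ⊕ (Fin k ⊕ Fin l)))))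
          ((Option.some_injective _).comp Sum.inr_injective)
        exact (congrArg List.Nodup (Word.leaves_map _ _)).mpr h
      · intro x hx y hy
        obtain ⟨i, hi⟩ := (mem_concat _ _ _).1 hx
        obtain ⟨j, hj⟩ := (mem_concat _ _ _).1 hy
        simp only [Word.leaves, List.singleton_append, List.mem_cons, mem_concat, List.not_mem_nil,
          or_false] at hi hj
        obtain rfl | ⟨j', rfl⟩ := hj <;> simp [hi])
    (fun Λ a => h Λ (a none) (fun i => a (some (.inl i))) (fun i => a (some (.inr (.inr (.inl i)))))
      (fun s => a (some (.inr (.inr (.inr s))))))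

end

end Ext

namespace EltFun

variable {V : Type u} [Category.{v} V] [MonoidalCategory V] [SymmetricCategory V] (Λ : EltFun V)

/-- The action on elements of a multiplication `A ⊗ (B 0 ⊗ B 1 ⊗ ⋯) ⟶ C`. -/
def mul {k : ℕ} {A C : V} {B : Fin k → V} (m : A ⊗ HigherOperads.tens k B ⟶ C) (a : Λ.obj A)
    (b : ∀ i, Λ.obj (B i)) : Λ.obj C :=
  Λ.map m (Λ.tmul a (Λ.tens k b))

/-- Transport of elements along an equality of indices. -/
def tr {O : Type} (A : O → V) {T T' : O} (h : T = T') (a : Λ.obj (A T)) : Λ.obj (A T') :=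
  Λ.map (eqToHom (congrArg A h)) a

section

variable {O : Type} {A B : O → V} {T T' T'' : O}

@[simp] lemma tr_rfl (h : T = T) (a : Λ.obj (A T)) : Λ.tr A h a = a := Λ.map_id a

@[simp] lemma tr_tr (h : T = T') (h' : T' = T'') (a : Λ.obj (A T)) :
    Λ.tr A h' (Λ.tr A h a) = Λ.tr A (h.trans h') a := by
  subst h h'
  simp

lemma map_tr (f : ∀ T, A T ⟶ B T) (h : T = T') (a : Λ.obj (A T)) :
    Λ.map (f T') (Λ.tr A h a) = Λ.tr B h (Λ.map (f T) a) := by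
  subst h
  simp

lemma tr_index {I : Type} {g : I → O} (z : ∀ i, Λ.obj (A (g i))) {i i' : I} (hi : i = i')
    (h : g i = T) (h' : g i' = T) : Λ.tr A h (z i) = Λ.tr A h' (z i') := by
  subst hi
  rfl

end

lemma map_mul {k : ℕ} {A C A' C' : V} {B B' : Fin k → V} {m : A ⊗ HigherOperads.tens k B ⟶ C}
    {m' : A' ⊗ HigherOperads.tens k B' ⟶ C'} {f : A ⟶ A'} {g : ∀ i, B i ⟶ B' i} {h : C ⟶ C'}
    (H : m ≫ h = (f ⊗ₘ tensMap k g) ≫ m') (a : Λ.obj A) (b : ∀ i, Λ.obj (B i)) :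
    Λ.map h (Λ.mul m a b) = Λ.mul m' (Λ.map f a) (fun i => Λ.map (g i) (b i)) := by
  rw [mul, ← Λ.map_comp, H, Λ.map_comp, Λ.map_tmul, map_tensMap, mul]

/-- An element of a symmetry `tens k X ⟶ tens k' X'`. -/
lemma map_tensPerm {k k' : ℕ} (ρ : Fin k ≃ Fin k') {X : Fin k → V} {X' : Fin k' → V}
    (f : ∀ i, X i ⟶ X' (ρ i)) (b : ∀ i, Λ.obj (X i)) (b' : ∀ i, Λ.obj (X' i))
    (h : ∀ i, Λ.map (f i) (b i) = b' (ρ i)) :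
    Λ.map (tensPerm ρ f) (Λ.tens k b) = Λ.tens k' b' := by
  rw [tensPerm, Λ.map_comp, map_tensMap]
  simp only [h]
  exact Λ.map_can b' (sameLeaves_perm ρ)

section

variable {k l : ℕ} {m : Fin k → ℕ} {inc : ∀ i, Fin (m i) → Fin l}
  (hinc : Function.Bijective (fun p : Σ i, Fin (m i) => inc p.1 p.2))

lemma map_shuffle {Y : V} {X : Fin k → V} {Z : Fin l → V} (y : Λ.obj Y) (x : ∀ i, Λ.obj (X i))
    (z : ∀ s, Λ.obj (Z s)) :
    Λ.map (shuffle hinc Y X Z)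
      (Λ.tmul y (Λ.tens k fun i => Λ.tmul (x i) (Λ.tens (m i) fun j => z (inc i j)))) =
      Λ.tmul (Λ.tmul y (Λ.tens k x)) (Λ.tens l z) :=
  let a : ∀ t : Unit ⊕ (Fin k ⊕ Fin l), Λ.obj (Sum.elim (fun _ => Y) (Sum.elim X Z) t) := fun t =>
    match t with
    | .inl _ => y
    | .inr (.inl i) => x i
    | .inr (.inr s) => z s
  Λ.map_can a (sameLeaves_shuffle hinc)

/-- The effect on elements of the left hand side of the associativity axiom of an operad. -/
lemma map_assoc_left {Y A B : V} {X : Fin k → V} {Z : Fin l → V}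
    (f : Y ⊗ HigherOperads.tens k X ⟶ A) (g : A ⊗ HigherOperads.tens l Z ⟶ B) (y : Λ.obj Y)
    (x : ∀ i, Λ.obj (X i)) (z : ∀ s, Λ.obj (Z s)) :
    Λ.map (shuffle hinc Y X Z ≫ (f ▷ _) ≫ g)
      (Λ.tmul y (Λ.tens k fun i => Λ.tmul (x i) (Λ.tens (m i) fun j => z (inc i j)))) =
      Λ.mul g (Λ.mul f y x) z := by
  rw [Λ.map_comp, map_shuffle, Λ.map_comp, map_whiskerRight, mul, mul]

end

/-- The effect on elements of the right hand side of the associativity axiom of an operad. -/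
lemma map_assoc_right {k : ℕ} {m : Fin k → ℕ} {Y B : V} {X X' : Fin k → V}
    {Z Z' : ∀ i, Fin (m i) → V} (e : ∀ i j, Z i j ⟶ Z' i j)
    (f : ∀ i, X i ⊗ HigherOperads.tens (m i) (Z' i) ⟶ X' i)
    (g : Y ⊗ HigherOperads.tens k X' ⟶ B)
    (y : Λ.obj Y) (x : ∀ i, Λ.obj (X i)) (z : ∀ i j, Λ.obj (Z i j)) :
    Λ.map ((Y ◁ tensMap k (fun i => (X i ◁ tensMap (m i) (e i)) ≫ f i)) ≫ g)
      (Λ.tmul y (Λ.tens k fun i => Λ.tmul (x i) (Λ.tens (m i) (z i)))) =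
      Λ.mul g y (fun i => Λ.mul (f i) (x i) (fun j => Λ.map (e i j) (z i j))) := by
  rw [Λ.map_comp, map_whiskerLeft, map_tensMap, mul]
  simp only [Λ.map_comp, map_whiskerLeft, map_tensMap, mul]

end EltFun

section Operads

variable {V : Type u} [Category.{v} V] [MonoidalCategory V] [SymmetricCategory V]
  {O : Type} [FibredCategory O]

/-- The multiplications for equal maps agree. -/
lemma EltFun.mul_congr (Λ : EltFun V) {A B C : O → V}
    (m : ∀ {T S : O} (f : T ⟶ S), A S ⊗ HigherOperads.tens (card S) (fun i => B (fib f i)) ⟶ C T)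
    {T T' S S' : O} (hT : T = T') (hS : S = S') (f : T ⟶ S) (f' : T' ⟶ S')
    (hf : f = eqToHom hT ≫ f' ≫ eqToHom hS.symm) (x : Λ.obj (A S)) (x' : Λ.obj (A S'))
    (hx : Λ.tr A hS x = x') (y : ∀ i, Λ.obj (B (fib f i))) (y' : ∀ i, Λ.obj (B (fib f' i)))
    (hy : ∀ (i : Fin (card S)) (i' : Fin (card S')) (_ : (i : ℕ) = i') (e : fib f i = fib f' i'),
      Λ.tr B e (y i) = y' i') :
    Λ.tr C hT (Λ.mul (m f) x y) = Λ.mul (m f') x' y' := by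
  subst hT hS
  obtain rfl : f = f' := by simpa using hf
  have : y = y' := funext fun i => by simpa using hy i i rfl rfl
  subst this
  simp only [EltFun.tr_rfl] at hx ⊢
  rw [hx]

namespace OperadStr

variable {A : O → V} (a : OperadStr O A) (Λ : EltFun V)

/-- The unit of an operad as an element. -/
def one : Λ.obj (A U) := Λ.map a.unit Λ.one

/-- The multiplication of an operad on elements. -/
def comp {T S : O} (f : T ⟶ S) (x : Λ.obj (A S)) (y : ∀ i, Λ.obj (A (fib f i))) : Λ.obj (A T) :=
  Λ.mul (a.mul f) x y

lemma comp_assoc {T S R : O} (f : T ⟶ S) (g : S ⟶ R) (x : Λ.obj (A R))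
    (y : ∀ i, Λ.obj (A (fib g i))) (z : ∀ s, Λ.obj (A (fib f s))) :
    a.comp Λ f (a.comp Λ g x y) z = a.comp Λ (f ≫ g) x (fun i => a.comp Λ (fibMor f g i) (y i)
      (fun j => Λ.tr A (fib_fibMor f g i j).symm (z (fibTip g i j)))) := by
  have h := congrArg (fun t => Λ.map t (Λ.tmul x (Λ.tens _ fun i => Λ.tmul (y i)
    (Λ.tens _ fun j => z (fibTip g i j))))) (a.assoc f g)
  simp only [Λ.map_assoc_left (Z := fun s => A (fib f s)) (fibTip_bijective g)] at h
  exact h.trans (Λ.map_assoc_right _ _ _ _ _ (fun i j => z (fibTip g i j)))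

lemma comp_id (T : O) (x : Λ.obj (A T)) :
    a.comp Λ (𝟙 T) x (fun i => Λ.tr A (fib_id T i).symm (a.one Λ)) = x := by
  have h := congrArg (fun t => Λ.map t (Λ.tmul x (Λ.tens _ fun _ => Λ.one))) (a.mul_id T)
  simp only [Λ.map_comp, Λ.map_whiskerLeft, Λ.map_tensMap, Λ.map_tensUnit, Λ.map_right] at h
  exact h

lemma comp_toU (T : O) (x : Λ.obj (A T)) :
    a.comp Λ (toU T) (a.one Λ) (fun i => Λ.tr A (fib_toU T i).symm x) = x := by
  have h := congrArg (fun t => Λ.map t (Λ.tmul Λ.one x)) (a.mul_toU T)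
  simp only [Λ.map_comp, Λ.map_tmul, Λ.map_left, Λ.map_tensOne, Λ.map_tensMap] at h
  exact h

variable {a} in
lemma IsHom.map_one {B : O → V} {b : OperadStr O B} {f : ∀ T, A T ⟶ B T} (h : a.IsHom b f) :
    Λ.map (f U) (a.one Λ) = b.one Λ := by
  rw [one, one, ← Λ.map_comp, h.unit]

variable {a} in
lemma IsHom.map_comp {B : O → V} {b : OperadStr O B} {f : ∀ T, A T ⟶ B T} (h : a.IsHom b f)
    {T S : O} (g : T ⟶ S) (x : Λ.obj (A S)) (y : ∀ i, Λ.obj (A (fib g i))) :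
    Λ.map (f T) (a.comp Λ g x y) =
      b.comp Λ g (Λ.map (f S) x) (fun i => Λ.map (f _) (y i)) :=
  Λ.map_mul (h.mul g) x y

variable {a} in
/-- A family of morphisms is an operad map if it is compatible with the units and the
multiplications of generalised elements. -/
lemma isHom_of_elements {B : O → V} {b : OperadStr O B} {f : ∀ T, A T ⟶ B T}
    (h1 : ∀ Λ : EltFun V, Λ.map (f U) (a.one Λ) = b.one Λ)
    (h2 : ∀ (Λ : EltFun V) {T S : O} (g : T ⟶ S) (x : Λ.obj (A S))
      (y : ∀ i, Λ.obj (A (fib g i))), Λ.map (f T) (a.comp Λ g x y) =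
        b.comp Λ g (Λ.map (f S) x) (fun i => Λ.map (f _) (y i))) : a.IsHom b f where
  unit := elt_ext_one (fun Λ => by
    rw [Λ.map_comp]
    exact h1 Λ)
  mul g := elt_ext_mul (fun Λ x y => by
    rw [Λ.map_comp, Λ.map_comp, Λ.map_tmul, Λ.map_tensMap]
    exact h2 Λ g x y)

end OperadStr

end Operads

/-! ### Coherence of fibres -/

/-- A category with fibres whose maps are determined by their action on finite ordinals, one for
each level, in such a way that the fibre of a map over a tip consists of all elements that are
sent to the ancestors of that tip. -/
class Levelled (O : Type) [FibredCategory O] where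
  Lev : Type
  size : O → Lev → ℕ
  app {T S : O} (f : T ⟶ S) (m : Lev) : Fin (size T m) → Fin (size S m)
  app_id (T : O) (m : Lev) (a : Fin (size T m)) : app (𝟙 T) m a = a
  app_comp {T S R : O} (f : T ⟶ S) (g : S ⟶ R) (m : Lev) (a : Fin (size T m)) :
    app (f ≫ g) m a = app g m (app f m a)
  app_ext {T S : O} (f g : T ⟶ S) : (∀ m a, app f m a = app g m a) → f = g
  incl {T S : O} (f : T ⟶ S) (i : Fin (card S)) (m : Lev) :
    Fin (size (fib f i) m) → Fin (size T m)
  incl_strictMono {T S : O} (f : T ⟶ S) (i : Fin (card S)) (m : Lev) : StrictMono (incl f i m)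
  anc (T : O) (i : Fin (card T)) (m : Lev) : Fin (size T m)
  exists_incl {T S : O} (f : T ⟶ S) (i : Fin (card S)) (m : Lev) (a : Fin (size T m)) :
    (∃ b, incl f i m b = a) ↔ app f m a = anc S i m
  incl_fibMor {T S R : O} (f : T ⟶ S) (g : S ⟶ R) (i : Fin (card R)) (m : Lev)
    (a : Fin (size (fib (f ≫ g) i) m)) :
    incl g i m (app (fibMor f g i) m a) = app f m (incl (f ≫ g) i m a)
  incl_anc {T S : O} (f : T ⟶ S) (i : Fin (card S)) (s : Fin (card (fib f i))) (m : Lev) :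
    incl f i m (anc (fib f i) s m) = anc T (fibTip f i s) m
  size_U (m : Lev) : size (U : O) m = 1

section Tips

variable {O : Type} [FibredCategory O]

lemma fibTip_strictMono {T S : O} (f : T ⟶ S) (i : Fin (card S)) : StrictMono (fibTip f i) :=
  fun _ _ h => fibIncl_strictMono _ _ h

lemma exists_fibTip {T S : O} (f : T ⟶ S) (i : Fin (card S)) (a : Fin (card T)) :
    (∃ b, fibTip f i b = a) ↔ tips f a = i := by
  constructor
  · rintro ⟨b, rfl⟩
    exact apply_fibIncl _ _ _
  · rintro h
    exact ⟨Fin.cast (card_fib f i).symm (fibIdx _ _ a h), fibIncl_fibIdx _ _ _ h⟩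

/-- Two increasing enumerations of the same subset agree, also if their lengths are only
propositionally equal. -/
lemma strictMono_eq {n n' N : ℕ} (h : n = n') (ι : Fin n → Fin N) (ι' : Fin n' → Fin N)
    (hι : StrictMono ι) (hι' : StrictMono ι') (hr : ∀ a, (∃ b, ι b = a) ↔ ∃ b, ι' b = a)
    (a : Fin n) (a' : Fin n') (ha : (a : ℕ) = a') : ι a = ι' a' := by
  subst h
  obtain rfl := Fin.ext ha
  exact congrFun ((hι.range_inj hι').1 (Set.ext hr)) a

lemma fibTip_fibMor {T S R : O} (f : T ⟶ S) (g : S ⟶ R) (i : Fin (card R))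
    (a : Fin (card (fib (f ≫ g) i))) :
    fibTip g i (tips (fibMor f g i) a) = tips f (fibTip (f ≫ g) i a) :=
  tips_fibMor f g i a

lemma fibTip_fibTip {T S R : O} (f : T ⟶ S) (g : S ⟶ R) (i : Fin (card R))
    (j : Fin (card (fib g i))) (l : Fin (card (fib (fibMor f g i) j)))
    (l' : Fin (card (fib f (fibTip g i j)))) (hl : (l : ℕ) = l') :
    fibTip (f ≫ g) i (fibTip (fibMor f g i) j l) = fibTip f (fibTip g i j) l' := by
  refine strictMono_eq (congrArg card (fib_fibMor f g i j))
    (fun l => fibTip (f ≫ g) i (fibTip (fibMor f g i) j l)) (fibTip f (fibTip g i j))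
    ((fibTip_strictMono _ _).comp (fibTip_strictMono _ _)) (fibTip_strictMono _ _) (fun a => ?_)
    l l' hl
  constructor
  · rintro ⟨b, rfl⟩
    refine (exists_fibTip _ _ _).2 ?_
    rw [← fibTip_fibMor, (exists_fibTip (fibMor f g i) j _).1 ⟨b, rfl⟩]
    rfl
  · intro h
    have h1 := (exists_fibTip _ _ _).1 h
    obtain ⟨c, rfl⟩ := (exists_fibTip (f ≫ g) i a).2 (by
      rw [tips_comp, h1]
      exact (exists_fibTip g i _).1 ⟨j, rfl⟩)
    rw [← fibTip_fibMor] at h1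
    obtain ⟨b, rfl⟩ := (exists_fibTip (fibMor f g i) j c).2 ((fibTip_strictMono _ _).injective h1)
    exact ⟨b, rfl⟩

end Tips

namespace Levelled

variable {O : Type} [FibredCategory O] [Levelled O]

/-- The object `U` is terminal. -/
lemma eq_toU {T : O} (f g : T ⟶ U) : f = g :=
  app_ext _ _ fun m a => by
    have := size_U (O := O) m
    apply Fin.ext
    have h1 := (app f m a).2
    have h2 := (app g m a).2
    omega

lemma app_eqToHom {T T' : O} (h : T = T') (m : Lev O) (a : Fin (size T m)) :
    (app (eqToHom h) m a : ℕ) = a := by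
  subst h
  rw [eqToHom_refl, app_id]

/-- Two increasing embeddings with the same image correspond to each other under the identification
of their sources. -/
lemma embed_unique {X X' : O} (h : X = X') {N : ℕ} (m : Lev O) (ι : Fin (size X m) → Fin N)
    (ι' : Fin (size X' m) → Fin N) (hι : StrictMono ι) (hι' : StrictMono ι')
    (hr : ∀ a, (∃ b, ι b = a) ↔ ∃ b, ι' b = a) (a : Fin (size X m)) :
    ι' (app (eqToHom h) m a) = ι a :=
  (strictMono_eq (congrArg (fun X => size X m) h) ι ι' hι hι' hr _ _ (app_eqToHom h m a).symm).symm

lemma incl_eqToHom {T S : O} {f f' : T ⟶ S} (h : f = f') (i : Fin (card S))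
    (e : fib f i = fib f' i) (m : Lev O) (a : Fin (size (fib f i) m)) :
    incl f' i m (app (eqToHom e) m a) = incl f i m a := by
  subst h
  rw [eqToHom_refl, app_id]

lemma fibMor_comp_left {T S R Q : O} (f : T ⟶ S) (g : S ⟶ R) (h : R ⟶ Q) (i : Fin (card Q)) :
    fibMor (f ≫ g) h i = eqToHom (congrArg (fun t => fib t i) (Category.assoc f g h)) ≫
      fibMor f (g ≫ h) i ≫ fibMor g h i := by
  refine app_ext _ _ fun m a => (incl_strictMono _ _ _).injective ?_
  rw [app_comp, app_comp, incl_fibMor, incl_fibMor, incl_fibMor,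
    incl_eqToHom (Category.assoc f g h), app_comp]

lemma fibMor_id_left {S R : O} (g : S ⟶ R) (i : Fin (card R)) :
    fibMor (𝟙 S) g i = eqToHom (congrArg (fun t => fib t i) (Category.id_comp g)) := by
  refine app_ext _ _ fun m a => (incl_strictMono _ _ _).injective ?_
  rw [incl_fibMor, incl_eqToHom (Category.id_comp g), app_id]

/-- A fibre of a fibre is a fibre. -/
lemma exists_incl_incl {X T R Q : O} (k : T ⟶ R) (h : R ⟶ Q) (i : Fin (card Q)) (p : X ⟶ fib h i)
    (m : Lev O) (ι : Fin (size X m) → Fin (size T m))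
    (hι : ∀ a, incl h i m (app p m a) = app k m (ι a))
    (hr : ∀ b, (∃ a, ι a = b) ↔ app (k ≫ h) m b = anc Q i m) (j : Fin (card (fib h i)))
    (b : Fin (size T m)) :
    (∃ a, ι (incl p j m a) = b) ↔ app k m b = anc R (fibTip h i j) m := by
  constructor
  · rintro ⟨a, rfl⟩
    rw [← hι, (exists_incl p j m _).1 ⟨a, rfl⟩, incl_anc]
  · intro hb
    obtain ⟨c, rfl⟩ := (hr b).2 (by
      rw [app_comp, hb, ← incl_anc]
      exact (exists_incl h i m _).1 ⟨_, rfl⟩)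
    rw [← hι, ← incl_anc] at hb
    obtain ⟨a, rfl⟩ := (exists_incl p j m c).2 ((incl_strictMono _ _ _).injective hb)
    exact ⟨a, rfl⟩

/-- The map of fibres induced by a map of fibres is a map of fibres of the original maps. Together
with `fibMor_comp_left` and `fibMor_toU`, this is the coherence needed for the associativity of free
operads. -/
lemma fibMor_fibMor {T S R Q : O} (f : T ⟶ S) (g : S ⟶ R) (h : R ⟶ Q) (i : Fin (card Q))
    (j : Fin (card (fib h i)))
    (e1 : fib (fibMor f (g ≫ h) i ≫ fibMor g h i) j = fib (f ≫ g) (fibTip h i j))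
    (e2 : fib g (fibTip h i j) = fib (fibMor g h i) j) :
    fibMor (fibMor f (g ≫ h) i) (fibMor g h i) j =
      eqToHom e1 ≫ fibMor f g (fibTip h i j) ≫ eqToHom e2 := by
  have r1 : ∀ m a, (∃ b, incl (g ≫ h) i m (incl (fibMor g h i) j m b) = a) ↔
      ∃ b, incl g (fibTip h i j) m b = a := fun m a => by
    rw [exists_incl_incl g h i (fibMor g h i) m (incl (g ≫ h) i m)
      (incl_fibMor g h i m) (exists_incl (g ≫ h) i m), exists_incl]
  have r2 : ∀ m a, (∃ b, incl (f ≫ g ≫ h) i m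
      (incl (fibMor f (g ≫ h) i ≫ fibMor g h i) j m b) = a) ↔
      ∃ b, incl (f ≫ g) (fibTip h i j) m b = a := fun m a => by
    rw [exists_incl_incl (f ≫ g) h i (fibMor f (g ≫ h) i ≫ fibMor g h i) m (incl (f ≫ g ≫ h) i m)
      (fun a => by rw [app_comp, incl_fibMor, incl_fibMor, app_comp])
      (fun b => by rw [exists_incl, Category.assoc]), exists_incl]
  refine app_ext _ _ fun m a =>
    ((incl_strictMono (g ≫ h) i m).comp (incl_strictMono (fibMor g h i) j m)).injective ?_
  simp only [Function.comp_apply]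
  rw [incl_fibMor, incl_fibMor, app_comp, app_comp]
  rw [embed_unique e2 m (incl g (fibTip h i j) m)
    (fun b => incl (g ≫ h) i m (incl (fibMor g h i) j m b)) (incl_strictMono _ _ _)
    ((incl_strictMono _ _ _).comp (incl_strictMono _ _ _)) (fun a => (r1 m a).symm), incl_fibMor]
  rw [embed_unique e1 m _ (incl (f ≫ g) (fibTip h i j) m)
    ((incl_strictMono (f ≫ g ≫ h) i m).comp (incl_strictMono _ j m)) (incl_strictMono _ _ _) (r2 m)]
  rfl

lemma anc_U (i : Fin (card (U : O))) (m : Lev O) (a : Fin (size (U : O) m)) : a = anc U i m := by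
  have h := size_U (O := O) m
  apply Fin.ext
  have h1 := a.2
  have h2 := (anc (U : O) i m).2
  omega

lemma fib_eq_of_toU {T : O} (f : T ⟶ U) (i : Fin (card (U : O))) : fib f i = T := by
  rw [eq_toU f (toU T), fib_toU]

lemma fibMor_toU {T S : O} (f : T ⟶ S) (g : S ⟶ U) (i : Fin (card (U : O))) :
    fibMor f g i = eqToHom (fib_eq_of_toU (f ≫ g) i) ≫ f ≫ eqToHom (fib_eq_of_toU g i).symm := by
  refine app_ext _ _ fun m a => (incl_strictMono _ _ _).injective ?_
  have hr : ∀ {X : O} (h : X ⟶ U) (a), (∃ b, incl h i m b = a) := fun h a =>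
    (exists_incl h i m a).2 (anc_U _ _ _)
  rw [incl_fibMor, app_comp, app_comp]
  rw [embed_unique (fib_eq_of_toU g i).symm m (fun a => a) (incl g i m) strictMono_id
    (incl_strictMono _ _ _) (fun a => ⟨fun _ => hr g a, fun _ => ⟨a, rfl⟩⟩)]
  exact congrArg _ (embed_unique (fib_eq_of_toU (f ≫ g) i) m (incl (f ≫ g) i m) (fun a => a)
    (incl_strictMono _ _ _) strictMono_id (fun a => ⟨fun _ => ⟨a, rfl⟩, fun _ => hr (f ≫ g) a⟩)
    a).symm

end Levelled

/-- Trees of height `n`, with the `n + 1` ordinals that make up a tree as levels. -/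
instance (n : ℕ) : Levelled (LevelTree n) where
  Lev := Fin (n + 1)
  size T j := T.size j
  app f j := LevelTree.app f j
  app_id _ _ _ := rfl
  app_comp _ _ _ _ := rfl
  app_ext f g h := LevelTree.Hom.ext (funext fun j => funext fun a => h j a)
  incl f i j := LevelTree.incl f i j
  incl_strictMono f i j := LevelTree.incl_strictMono f i j
  anc T i j := T.anc i j
  exists_incl f i j a := ⟨by
    rintro ⟨b, rfl⟩
    exact LevelTree.app_incl f i j b, LevelTree.exists_incl f i j a⟩
  incl_fibMor f g i j a := LevelTree.incl_fibMor f g i j a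
  incl_anc f i s j := (LevelTree.incl_anc f i s j).trans
    (congrArg (fun t => LevelTree.anc _ t j) (LevelTree.incl_last f i s).symm)
  size_U _ := rfl

/-- The ordinals `[n]`, with all maps as morphisms. -/
abbrev FinAll : Type := ℕ

/-- The fibres of a map are its preimages, with the induced order. -/
instance : FibredCategory FinAll where
  Hom a b := Fin a → Fin b
  id _ := fun a => a
  comp f g := fun a => g (f a)
  card a := a
  tips f := f
  tips_id _ _ := rfl
  tips_comp _ _ _ := rfl
  fib f i := fibCard f i
  card_fib _ _ := rfl
  fibMor f g i := fibMap (fun a => g (f a)) i g i f (fun _ h => h)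
  tips_fibMor f g i a := fibIncl_fibMap (fun a => g (f a)) i g i f (fun _ h => h) a
  fib_fibMor f g i j := fibCard_fibMap f g i j
  U := (1 : ℕ)
  card_U := rfl
  fib_id _ i := fibCard_id i
  toU _ := fun _ => (0 : Fin 1)
  fib_toU _ i := fibCard_of_subsingleton _ rfl i

instance : Levelled FinAll where
  Lev := Unit
  size T _ := T
  app f _ := f
  app_id _ _ _ := rfl
  app_comp _ _ _ _ := rfl
  app_ext f g h := funext fun a => h () a
  incl f i _ := fibIncl f i
  incl_strictMono f i _ := fibIncl_strictMono f i
  anc _ i _ := i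
  exists_incl f i _ a := ⟨by
    rintro ⟨b, rfl⟩
    exact apply_fibIncl f i b, fun h => ⟨fibIdx f i a h, fibIncl_fibIdx f i a h⟩⟩
  incl_fibMor f g i _ a := fibIncl_fibMap (fun a => g (f a)) i g i f (fun _ h => h) a
  incl_anc _ _ _ _ := rfl
  size_U _ := rfl

/-! ### Coproducts and tensor products -/

section Coproducts

variable {V : Type u} [Category.{v} V]

/-- The morphisms `ι i` form a coproduct diagram. -/
def IsCoprod {I : Type} {Y : I → V} {Z : V} (ι : ∀ i, Y i ⟶ Z) : Prop :=
  ∀ (W : V) (f : ∀ i, Y i ⟶ W), ∃! g : Z ⟶ W, ∀ i, ι i ≫ g = f i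

namespace IsCoprod

variable {I I' : Type} {Y : I → V} {Y' : I' → V} {Z Z' W : V} {ι : ∀ i, Y i ⟶ Z}
  {κ : ∀ i, Y' i ⟶ Z'}

lemma hom_ext (h : IsCoprod ι) {f g : Z ⟶ W} (H : ∀ i, ι i ≫ f = ι i ≫ g) : f = g :=
  (h W (fun i => ι i ≫ g)).unique H (fun _ => rfl)

/-- The morphism from a coproduct that is given by a family of morphisms. -/
noncomputable def desc (h : IsCoprod ι) (f : ∀ i, Y i ⟶ W) : Z ⟶ W := (h W f).choose

lemma ι_desc (h : IsCoprod ι) (f : ∀ i, Y i ⟶ W) (i : I) : ι i ≫ h.desc f = f i :=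
  (h W f).choose_spec.1 i

lemma of_isColimit (h : IsColimit (Cofan.mk Z ι)) : IsCoprod ι := fun W f =>
  ⟨Cofan.IsColimit.desc h f, fun i => Cofan.IsColimit.fac h f i,
    fun g hg => Cofan.IsColimit.hom_ext h _ _ fun i =>
      (hg i).trans (Cofan.IsColimit.fac h f i).symm⟩

/-- The colimit cocone of a coproduct diagram. -/
noncomputable def isColimit (h : IsCoprod ι) : IsColimit (Cofan.mk Z ι) :=
  Cofan.IsColimit.mk _ (fun s => h.desc s.inj) (fun s i => h.ι_desc s.inj i)
    (fun s m hm => h.hom_ext fun i => (hm i).trans (h.ι_desc s.inj i).symm)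

lemma sigma [HasCoproduct Y] : IsCoprod (Sigma.ι Y) := of_isColimit (coproductIsCoproduct Y)

lemma reindex (h : IsCoprod ι) (e : I' ≃ I) : IsCoprod (fun i => ι (e i)) := fun W f => by
  refine ⟨h.desc (fun i => eqToHom (congrArg Y (e.apply_symm_apply i).symm) ≫ f (e.symm i)),
    fun i => ?_, fun g hg => h.hom_ext fun i => ?_⟩
  · rw [h.ι_desc]
    have : ∀ i' (hi : i' = i) (h' : Y (e i) = Y (e i')), eqToHom h' ≫ f i' = f i := by
      rintro _ rfl _
      simp
    exact this _ (e.symm_apply_apply i) _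
  · rw [h.ι_desc]
    obtain ⟨i, rfl⟩ := e.surjective i
    rw [hg]
    have : ∀ i' (hi : i' = i) (h' : Y (e i) = Y (e i')), f i = eqToHom h' ≫ f i' := by
      rintro _ rfl _
      simp
    exact this _ (e.symm_apply_apply i) _

lemma of_unique [Unique I] (h : Y default = Z) (hι : ι default = eqToHom h) : IsCoprod ι := by
  subst h
  intro W f
  refine ⟨f default, fun i => ?_, fun g hg => ?_⟩
  · obtain rfl := Unique.eq_default i
    rw [hι]
    simp
  · rw [← hg, hι]
    simp

variable [MonoidalCategory V]

lemma whiskerLeft (h : IsCoprod ι) (X : V) [PreservesColimits (tensorLeft X)] :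
    IsCoprod (fun i => X ◁ ι i) := by
  have := preservesSmallestColimits_of_preservesColimits (tensorLeft X)
  exact of_isColimit (isColimitCofanMkObjOfIsColimit (tensorLeft X) Y ι h.isColimit)

variable [SymmetricCategory V]

lemma whiskerRight (h : IsCoprod ι) (X : V) [PreservesColimits (tensorLeft X)] :
    IsCoprod (fun i => ι i ▷ X) := fun W f => by
  have h' := h.whiskerLeft X
  refine ⟨(β_ _ _).hom ≫ h'.desc (fun i => (β_ _ _).hom ≫ f i), fun i => ?_,
    fun g hg => ?_⟩
  · change ι i ▷ X ≫ _ = _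
    rw [BraidedCategory.braiding_naturality_left_assoc, h'.ι_desc, SymmetricCategory.symmetry_assoc]
  · rw [← cancel_epi (β_ X Z).hom, SymmetricCategory.symmetry_assoc]
    refine h'.hom_ext fun i => ?_
    rw [h'.ι_desc, BraidedCategory.braiding_naturality_right_assoc]
    exact congrArg _ (hg i)

variable [∀ X : V, PreservesColimits (tensorLeft X)]

lemma tensor (h : IsCoprod ι) (h' : IsCoprod κ) :
    IsCoprod (fun p : I × I' => ι p.1 ⊗ₘ κ p.2) := fun W f => by
  have h1 := h'.whiskerLeft Z
  have h2 := fun i' => h.whiskerRight (Y' i')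
  refine ⟨h1.desc (fun i' => (h2 i').desc (fun i => f (i, i'))), ?_, fun g hg => ?_⟩
  · rintro ⟨i, i'⟩
    change (ι i ⊗ₘ κ i') ≫ _ = _
    rw [MonoidalCategory.tensorHom_def, Category.assoc, h1.ι_desc, (h2 i').ι_desc]
  · refine h1.hom_ext fun i' => (h2 i').hom_ext fun i => ?_
    rw [h1.ι_desc, (h2 i').ι_desc, ← hg (i, i')]
    change _ = (ι i ⊗ₘ κ i') ≫ g
    rw [MonoidalCategory.tensorHom_def, Category.assoc]

/-- The iterated tensor product distributes over coproducts. -/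
lemma tens (k : ℕ) {I : Fin k → Type} {Y : ∀ i, I i → V} {Z : Fin k → V}
    {ι : ∀ i j, Y i j ⟶ Z i} (h : ∀ i, IsCoprod (ι i)) :
    IsCoprod (fun t : ∀ i, I i => tensMap k (fun i => ι i (t i))) := by
  induction k with
  | zero => exact of_unique rfl rfl
  | succ k ih =>
    have h1 := (h 0).tensor (ih (fun i => h i.succ))
    exact h1.reindex (Fin.consEquiv I).symm

end IsCoprod

end Coproducts

/-! ### Free operads -/

section Unshuffle

variable {V : Type u} [Category.{v} V] [MonoidalCategory V] [SymmetricCategory V]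
  {k l : ℕ} {m : Fin k → ℕ} {inc : ∀ i, Fin (m i) → Fin l}

/-- The inverse of `shuffle`. -/
noncomputable def unshuffle (hinc : Function.Bijective (fun p : Σ i, Fin (m i) => inc p.1 p.2))
    (Y : V) (X : Fin k → V) (Z : Fin l → V) :
    (Y ⊗ tens k X) ⊗ tens l Z ⟶
      Y ⊗ tens k (fun i => X i ⊗ tens (m i) (fun j => Z (inc i j))) :=
  can (Sum.elim (fun _ => Y) (Sum.elim X Z)) (shuffleTarget k l) (shuffleSource m inc)
    ⟨(sameLeaves_shuffle hinc).2, (sameLeaves_shuffle hinc).1,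
      fun j => ((sameLeaves_shuffle hinc).3 j).symm⟩

lemma EltFun.map_unshuffle (Λ : EltFun V)
    (hinc : Function.Bijective (fun p : Σ i, Fin (m i) => inc p.1 p.2))
    {Y : V} {X : Fin k → V} {Z : Fin l → V} (y : Λ.obj Y) (x : ∀ i, Λ.obj (X i))
    (z : ∀ s, Λ.obj (Z s)) :
    Λ.map (unshuffle hinc Y X Z) (Λ.tmul (Λ.tmul y (Λ.tens k x)) (Λ.tens l z)) =
      Λ.tmul y (Λ.tens k fun i => Λ.tmul (x i) (Λ.tens (m i) fun j => z (inc i j))) :=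
  let a : ∀ t : Unit ⊕ (Fin k ⊕ Fin l), Λ.obj (Sum.elim (fun _ => Y) (Sum.elim X Z) t) := fun t =>
    match t with
    | .inl _ => y
    | .inr (.inl i) => x i
    | .inr (.inr s) => z s
  Λ.map_can a _

/-- The canonical isomorphism from a one-fold iterated tensor product to its factor. -/
def tensFst : (k : ℕ) → (h : k = 1) → (Y : Fin k → V) → (tens k Y ⟶ Y (Fin.cast h.symm 0))
  | _, rfl, Y => (ρ_ (Y 0)).hom

lemma EltFun.map_tensFst (Λ : EltFun V) (k : ℕ) (h : k = 1) (Y : Fin k → V)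
    (y : ∀ i, Λ.obj (Y i)) : Λ.map (tensFst k h Y) (Λ.tens k y) = y (Fin.cast h.symm 0) := by
  subst h
  exact Λ.map_right _

/-- The canonical isomorphism `𝟙 ⟶ 𝟙 ⊗ (⋯ ⊗ 𝟙)`. -/
def tensUnitInv : (k : ℕ) → (𝟙_ V ⟶ tens k (fun _ => 𝟙_ V))
  | 0 => 𝟙 _
  | k + 1 => (λ_ _).inv ≫ 𝟙_ V ◁ tensUnitInv k

lemma EltFun.map_tensUnitInv (Λ : EltFun V) (k : ℕ) :
    Λ.map (tensUnitInv k) Λ.one = Λ.tens k (fun _ => Λ.one) := by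
  induction k with
  | zero => exact Λ.map_id _
  | succ k ih =>
    change Λ.map ((λ_ _).inv ≫ 𝟙_ V ◁ tensUnitInv k) Λ.one = Λ.tmul Λ.one _
    rw [Λ.map_comp, Λ.map_inv _ (Λ.map_left _), Λ.map_whiskerLeft, ih]

end Unshuffle

/-- The operations of the free operad over `O`: the unit, and for each map `σ : T ⟶ S` the
composite of a generator of arity `S` with operations whose arities are the fibres of `σ`. Every
formal composite of generators can be written in this way, with the outermost generator first. -/
inductive Tree (O : Type) [FibredCategory O] : O → Type
  | unit {T : O} (h : T = U) : Tree O T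
  | node {T S : O} (σ : T ⟶ S) (b : ∀ i, Tree O (fib σ i)) : Tree O T

namespace Free

variable {O : Type} [FibredCategory O] {V : Type u} [Category.{v} V] [MonoidalCategory V]

/-- The tensor product of the generators that occur in an operation. -/
abbrev ev (X : O → V) : {T : O} → Tree O T → V
  | _, .unit _ => 𝟙_ V
  | _, .node (S := S) _ b => X S ⊗ tens (card S) (fun i => ev X (b i))

variable [HasColimits V]

/-- The objects of the free operad. -/
noncomputable def F (X : O → V) (T : O) : V := ∐ fun t : Tree O T => ev X t

/-- The inclusion of a summand. -/
noncomputable def ι (X : O → V) {T : O} (t : Tree O T) : ev X t ⟶ F X T :=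
  Limits.Sigma.ι (fun t : Tree O T => ev X t) t

lemma isCoprod_ι (X : O → V) (T : O) : IsCoprod (fun t : Tree O T => ι X t) := IsCoprod.sigma

/-- The unit of the free operad. -/
noncomputable def unit (X : O → V) : 𝟙_ V ⟶ F X U := ι X (.unit rfl)

variable [SymmetricCategory V] [∀ X : V, PreservesColimits (tensorLeft X)] (X : O → V)

/-- The composites of a generator with elements of the free operad split into summands, one for each
choice of the operations to which those elements belong. -/
lemma isCoprod_node {T S : O} (σ : T ⟶ S) : IsCoprod (fun b : ∀ i, Tree O (fib σ i) =>
    X S ◁ tensMap (card S) (fun i => ι X (b i))) :=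
  (IsCoprod.tens (card S) (fun i => isCoprod_ι X (fib σ i))).whiskerLeft _

/-- The composition of a generator with elements of the free operad. -/
noncomputable def inn {T S : O} (σ : T ⟶ S) :
    X S ⊗ tens (card S) (fun i => F X (fib σ i)) ⟶ F X T :=
  (isCoprod_node X σ).desc (fun b => ι X (.node σ b))

lemma ι_inn {T S : O} (σ : T ⟶ S) (b : ∀ i, Tree O (fib σ i)) :
    (X S ◁ tensMap (card S) (fun i => ι X (b i))) ≫ inn X σ = ι X (.node σ b) :=
  (isCoprod_node X σ).ι_desc _ b

lemma map_ι_node (Λ : EltFun V) {T S : O} (σ : T ⟶ S) (b : ∀ i, Tree O (fib σ i))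
    (x : Λ.obj (X S)) (β : ∀ i, Λ.obj (ev X (b i))) :
    Λ.map (ι X (.node σ b)) (Λ.tmul x (Λ.tens _ β)) =
      Λ.mul (inn X σ) x (fun i => Λ.map (ι X (b i)) (β i)) := by
  rw [← ι_inn, Λ.map_comp, Λ.map_whiskerLeft, Λ.map_tensMap, EltFun.mul]

/-- The composite of a generator, composed along `ω` with elements of `B`, with elements of the free
operad along `σ`, if composites `m` of the elements of `B` are given. -/
noncomputable def graft {T S R : O} (σ : T ⟶ S) (ω : S ⟶ R) {B : Fin (card R) → V}
    (m : ∀ i, B i ⊗ tens (card (fib ω i)) (fun j => F X (fib (fibMor σ ω i) j)) ⟶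
      F X (fib (σ ≫ ω) i)) :
    (X R ⊗ tens (card R) B) ⊗ tens (card S) (fun s => F X (fib σ s)) ⟶ F X T :=
  unshuffle (fibTip_bijective ω) (X R) B (fun s => F X (fib σ s)) ≫
    (X R ◁ tensMap (card R) (fun i => (B i ◁ tensMap _ (fun j =>
      eqToHom (congrArg (F X) (fib_fibMor σ ω i j).symm))) ≫ m i)) ≫ inn X (σ ≫ ω)

lemma map_graft (Λ : EltFun V) {T S R : O} (σ : T ⟶ S) (ω : S ⟶ R) {B : Fin (card R) → V}
    (m : ∀ i, B i ⊗ tens (card (fib ω i)) (fun j => F X (fib (fibMor σ ω i) j)) ⟶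
      F X (fib (σ ≫ ω) i)) (x : Λ.obj (X R)) (β : ∀ i, Λ.obj (B i))
    (c : ∀ s, Λ.obj (F X (fib σ s))) :
    Λ.map (graft X σ ω m) (Λ.tmul (Λ.tmul x (Λ.tens _ β)) (Λ.tens _ c)) =
      Λ.mul (inn X (σ ≫ ω)) x (fun i => Λ.mul (m i) (β i)
        (fun j => Λ.tr (F X) (fib_fibMor σ ω i j).symm (c (fibTip ω i j)))) := by
  rw [graft, Λ.map_comp]
  refine (congrArg _ (Λ.map_unshuffle (Z := fun s => F X (fib σ s)) (fibTip_bijective ω)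
    x β c)).trans ?_
  exact Λ.map_assoc_right _ _ _ _ _ (fun i j => c (fibTip ω i j))

lemma isCoprod_mul {T S : O} (σ : T ⟶ S) : IsCoprod (fun t : Tree O S =>
    ι X t ▷ tens (card S) (fun s => F X (fib σ s))) :=
  (isCoprod_ι X S).whiskerRight _

variable [Levelled O]

open Levelled

lemma fib_eq_of_U {T S : O} (h : S = U) (σ : T ⟶ S) (i : Fin (card S)) : fib σ i = T := by
  subst h
  exact fib_eq_of_toU σ i

/-- The multiplication of the free operad on a summand. -/
noncomputable def mulTree : {S : O} → (t : Tree O S) → {T : O} → (σ : T ⟶ S) →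
    (ev X t ⊗ tens (card S) (fun s => F X (fib σ s)) ⟶ F X T)
  | _, .unit h, _, σ => (λ_ _).hom ≫ tensFst _ ((congrArg card h).trans card_U) _ ≫
      eqToHom (congrArg (F X) (fib_eq_of_U h σ _))
  | _, .node ω b, _, σ => graft X σ ω (fun i => mulTree (b i) (fibMor σ ω i))

/-- The multiplication of the free operad. -/
noncomputable def mul {T S : O} (σ : T ⟶ S) :
    F X S ⊗ tens (card S) (fun s => F X (fib σ s)) ⟶ F X T :=
  (isCoprod_mul X σ).desc (fun t => mulTree X t σ)

lemma ι_mul {T S : O} (σ : T ⟶ S) (t : Tree O S) :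
    ι X t ▷ tens (card S) (fun s => F X (fib σ s)) ≫ mul X σ = mulTree X t σ :=
  (isCoprod_mul X σ).ι_desc _ t

lemma mul_ι (Λ : EltFun V) {T S : O} (σ : T ⟶ S) (t : Tree O S) (e : Λ.obj (ev X t))
    (c : ∀ s, Λ.obj (F X (fib σ s))) :
    Λ.mul (mul X σ) (Λ.map (ι X t) e) c = Λ.mul (mulTree X t σ) e c := by
  rw [← ι_mul, EltFun.mul, EltFun.mul, Λ.map_comp, Λ.map_whiskerRight]

/-- Multiplication with the unit. -/
lemma mul_unit (Λ : EltFun V) {T S : O} (h : S = U) (σ : T ⟶ S)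
    (c : ∀ s, Λ.obj (F X (fib σ s))) (s : Fin (card S)) :
    Λ.mul (mul X σ) (Λ.tr (F X) h.symm (Λ.map (unit X) Λ.one)) c =
      Λ.tr (F X) (fib_eq_of_U h σ s) (c s) := by
  subst h
  obtain rfl : s = Fin.cast card_U.symm 0 := by
    have h := s.2.trans_eq card_U
    exact Fin.ext (Nat.lt_one_iff.1 h)
  rw [EltFun.tr_rfl, unit, mul_ι, EltFun.mul]
  change Λ.map ((λ_ _).hom ≫ tensFst _ _ _ ≫ eqToHom _) _ = _
  rw [Λ.map_comp, Λ.map_comp, Λ.map_left, Λ.map_tensFst]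
  rfl

/-- The recursion that defines the multiplication on summands holds for the multiplication of the
free operad itself. -/
lemma inn_mul {T S R : O} (σ : T ⟶ S) (ω : S ⟶ R) :
    inn X ω ▷ _ ≫ mul X σ = graft X σ ω (fun i => mul X (fibMor σ ω i)) := by
  refine ((isCoprod_node X ω).whiskerRight _).hom_ext fun b => ?_
  rw [← comp_whiskerRight_assoc, ι_inn, ι_mul]
  refine elt_ext_node (C := fun s => F X (fib σ s)) fun Λ x β c => ?_
  change Λ.map (graft X σ ω _) _ = _
  refine (map_graft X Λ σ ω _ x β c).trans ?_
  rw [Λ.map_comp, Λ.map_whiskerRight, Λ.map_whiskerLeft, Λ.map_tensMap]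
  refine Eq.trans ?_ (map_graft X Λ σ ω _ x _ c).symm
  simp only [mul_ι]

/-- Multiplication with a composite of a generator. -/
lemma mul_inn (Λ : EltFun V) {T S R : O} (σ : T ⟶ S) (ω : S ⟶ R) (x : Λ.obj (X R))
    (β : ∀ i, Λ.obj (F X (fib ω i))) (c : ∀ s, Λ.obj (F X (fib σ s))) :
    Λ.mul (mul X σ) (Λ.mul (inn X ω) x β) c =
      Λ.mul (inn X (σ ≫ ω)) x (fun i => Λ.mul (mul X (fibMor σ ω i)) (β i)
        (fun j => Λ.tr (F X) (fib_fibMor σ ω i j).symm (c (fibTip ω i j)))) := by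
  have h := congrArg (fun t => Λ.map t (Λ.tmul (Λ.tmul x (Λ.tens _ β)) (Λ.tens _ c)))
    (inn_mul X σ ω)
  simp only [Λ.map_comp, Λ.map_whiskerRight] at h
  exact h.trans (map_graft X Λ σ ω _ x β c)

end Free

/-! ### Free operads: operad laws and universal property -/

lemma fibTip_id {O : Type} [FibredCategory O] (S : O) (i : Fin (card S))
    (j : Fin (card (fib (𝟙 S) i))) : fibTip (𝟙 S) i j = i := by
  have h := (exists_fibTip (𝟙 S) i _).1 ⟨j, rfl⟩
  rwa [tips_id] at h

section

variable {V : Type u} [Category.{v} V] [MonoidalCategory V] [SymmetricCategory V]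

lemma EltFun.map_whiskerRight_comp (Λ : EltFun V) {A A' B D : V} (f : A ⟶ A') (g : A' ⊗ B ⟶ D)
    (a : Λ.obj A) (b : Λ.obj B) :
    Λ.map (f ▷ B ≫ g) (Λ.tmul a b) = Λ.map g (Λ.tmul (Λ.map f a) b) := by
  rw [Λ.map_comp, Λ.map_whiskerRight]

lemma elt_ext_node_units {k l : ℕ} {A D : V} {B : Fin k → V}
    {f g : (A ⊗ tens k B) ⊗ tens l (fun _ => 𝟙_ V) ⟶ D}
    (h : ∀ (Λ : EltFun V) (a : Λ.obj A) (b : ∀ i, Λ.obj (B i)),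
      Λ.map f (Λ.tmul (Λ.tmul a (Λ.tens k b)) (Λ.tens l (fun _ => Λ.one))) =
        Λ.map g (Λ.tmul (Λ.tmul a (Λ.tens k b)) (Λ.tens l (fun _ => Λ.one)))) : f = g :=
  elt_ext (J := Unit ⊕ Fin k) (X := Sum.elim (fun _ => A) B)
    (.tensor (.tensor (.leaf (.inl ())) (.prod k fun i => .leaf (.inr i)))
      (.prod l fun _ => .prod 0 Fin.elim0))
    (List.nodup_append.2 ⟨List.nodup_cons.2 ⟨by simp [mem_concat],
      nodup_concat_singleton k _ Sum.inr_injective⟩, nodup_concat _ _ (by simp) (by simp),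
      by simp [mem_concat]⟩)
    (fun Λ a => h Λ (a (.inl ())) (fun i => a (.inr i)))

end

namespace Free

open Levelled

variable {O : Type} [FibredCategory O] {V : Type u} [Category.{v} V] [MonoidalCategory V]
  [HasColimits V] [SymmetricCategory V] [∀ X : V, PreservesColimits (tensorLeft X)] (X : O → V)
  [Levelled O]

/-- The left hand side of the associativity axiom. -/
noncomputable abbrev assocLeft {T S R : O} (f : T ⟶ S) (g : S ⟶ R) :
    F X R ⊗ tens (card R) (fun i => F X (fib g i) ⊗
      tens (card (fib g i)) (fun j => F X (fib f (fibTip g i j)))) ⟶ F X T :=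
  shuffle (fibTip_bijective g) (F X R) (fun i => F X (fib g i)) (fun s => F X (fib f s)) ≫
    (mul X g ▷ _) ≫ mul X f

/-- The right hand side of the associativity axiom. -/
noncomputable abbrev assocRight {T S R : O} (f : T ⟶ S) (g : S ⟶ R) :
    F X R ⊗ tens (card R) (fun i => F X (fib g i) ⊗
      tens (card (fib g i)) (fun j => F X (fib f (fibTip g i j)))) ⟶ F X T :=
  (F X R ◁ tensMap (card R) (fun i =>
    (F X (fib g i) ◁ tensMap _ (fun j => eqToHom (congrArg (F X) (fib_fibMor f g i j).symm))) ≫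
      mul X (fibMor f g i))) ≫ mul X (f ≫ g)

lemma map_assocLeft (Λ : EltFun V) {T S R : O} (f : T ⟶ S) (g : S ⟶ R) (x : Λ.obj (F X R))
    (y : ∀ i, Λ.obj (F X (fib g i))) (z : ∀ s, Λ.obj (F X (fib f s))) :
    Λ.map (assocLeft X f g)
      (Λ.tmul x (Λ.tens _ fun i => Λ.tmul (y i) (Λ.tens _ fun j => z (fibTip g i j)))) =
      Λ.mul (mul X f) (Λ.mul (mul X g) x y) z :=
  Λ.map_assoc_left (Z := fun s => F X (fib f s)) (fibTip_bijective g) _ _ _ _ _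

lemma map_assocRight (Λ : EltFun V) {T S R : O} (f : T ⟶ S) (g : S ⟶ R) (x : Λ.obj (F X R))
    (y : ∀ i, Λ.obj (F X (fib g i))) (z : ∀ s, Λ.obj (F X (fib f s))) :
    Λ.map (assocRight X f g)
      (Λ.tmul x (Λ.tens _ fun i => Λ.tmul (y i) (Λ.tens _ fun j => z (fibTip g i j)))) =
      Λ.mul (mul X (f ≫ g)) x (fun i => Λ.mul (mul X (fibMor f g i)) (y i)
        (fun j => Λ.tr (F X) (fib_fibMor f g i j).symm (z (fibTip g i j)))) :=
  Λ.map_assoc_right _ _ _ _ _ (fun i j => z (fibTip g i j))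

/-- Associativity on each summand, by induction on the operation. If the outermost generator is
composed along `ω`, both sides are composites of that generator along `f ≫ g ≫ ω`, and the induction
hypothesis applies to the operations in its fibres. -/
lemma assoc_ι {R : O} (t : Tree O R) {T S : O} (f : T ⟶ S) (g : S ⟶ R) :
    ι X t ▷ _ ≫ assocLeft X f g = ι X t ▷ _ ≫ assocRight X f g := by
  induction t generalizing T S with
  | unit h =>
    subst h
    refine elt_ext_unit_assoc (X := fun i => F X (fib g i)) (Z := fun s => F X (fib f s))
      (fibTip_bijective g) fun Λ y z => ?_
    rw [Λ.map_whiskerRight_comp, Λ.map_whiskerRight_comp]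
    refine (map_assocLeft X Λ f g _ y z).trans (Eq.trans ?_ (map_assocRight X Λ f g _ y z).symm)
    let i : Fin (card (U : O)) := Fin.cast card_U.symm 0
    have h0 := fun {T' : O} (σ : T' ⟶ U) (c : ∀ s, Λ.obj (F X (fib σ s))) =>
      mul_unit X Λ rfl σ c i
    simp only [EltFun.tr_rfl] at h0
    change Λ.mul _ (Λ.mul _ (Λ.map (unit X) _) _) _ = Λ.mul _ (Λ.map (unit X) _) _
    rw [h0, h0]
    refine (Λ.mul_congr (mul X) (fib_eq_of_toU (f ≫ g) i) (fib_eq_of_toU g i) (fibMor f g i) f ?_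
      _ _ rfl _ _ ?_).symm
    · rw [fibMor_toU f g i]
    · intro j j' hj e
      refine (Λ.tr_tr _ _ _).trans ?_
      have hj' : fibTip g i j = j' := strictMono_eq (congrArg card (fib_eq_of_toU g i)) (fibTip g i)
        (fun a => a) (fibTip_strictMono _ _) strictMono_id (fun a =>
          ⟨fun _ => ⟨a, rfl⟩, fun _ => (exists_fibTip g i a).2 (Fin.ext (by
            have h1 := (tips g a).2.trans_eq card_U
            have h2 := i.2.trans_eq card_U
            omega))⟩) j j' hj
      exact (Λ.tr_index z hj' _ rfl).trans (Λ.tr_rfl _ _)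
  | @node R Q ω b ih =>
    -- the induction hypothesis for generalised elements
    have ih' := fun (i : Fin (card Q)) {T S : O} (f : T ⟶ S) (g : S ⟶ fib ω i) (Λ : EltFun V)
      (x : Λ.obj (ev X (b i))) (y : ∀ j, Λ.obj (F X (fib g j)))
      (z : ∀ s, Λ.obj (F X (fib f s))) => by
      have h := congrArg (fun t => Λ.map t (Λ.tmul x (Λ.tens _ fun i => Λ.tmul (y i)
        (Λ.tens _ fun j => z (fibTip g i j))))) (ih i f g)
      simp only [Λ.map_comp _ (assocLeft X f g), Λ.map_comp _ (assocRight X f g),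
        Λ.map_whiskerRight] at h
      rw [map_assocLeft X Λ f g _ y z, map_assocRight X Λ f g _ y z] at h
      exact h
    refine elt_ext_node_assoc (X := fun i => F X (fib g i)) (Z := fun s => F X (fib f s))
      (fibTip_bijective g) fun Λ x β y z => ?_
    rw [Λ.map_whiskerRight_comp, Λ.map_whiskerRight_comp]
    refine (map_assocLeft X Λ f g _ y z).trans (Eq.trans ?_ (map_assocRight X Λ f g _ y z).symm)
    rw [map_ι_node, mul_inn, mul_inn, mul_inn]
    simp only [ih']
    refine (Λ.tr_rfl rfl _).symm.trans (Λ.mul_congr (inn X) rfl rfl (f ≫ g ≫ ω) ((f ≫ g) ≫ ω)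
      (by simp) _ _ (Λ.tr_rfl rfl _) _ _ ?_)
    rintro i i' hi e
    obtain rfl := Fin.ext hi
    refine Λ.mul_congr (mul X) e rfl _ (fibMor (f ≫ g) ω i) ?_ _ _ (Λ.tr_rfl rfl _) _ _ ?_
    · rw [fibMor_comp_left]
      simp
    rintro j j' hj e'
    obtain rfl := Fin.ext hj
    have e1 : fib (fibMor f (g ≫ ω) i ≫ fibMor g ω i) j = fib (f ≫ g) (fibTip ω i j) :=
      e'.trans (fib_fibMor (f ≫ g) ω i j)
    have e2 : fib (fibMor g ω i) j = fib g (fibTip ω i j) := fib_fibMor g ω i j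
    rw [← Λ.mul_congr (mul X) e1 e2 (fibMor (fibMor f (g ≫ ω) i) (fibMor g ω i) j)
      (fibMor f g (fibTip ω i j)) (fibMor_fibMor f g ω i j e1 e2.symm)
      (Λ.tr (F X) e2.symm (y (fibTip ω i j))) _ (by rw [EltFun.tr_tr, EltFun.tr_rfl])
      (fun l => Λ.tr (F X) (fib_fibMor (fibMor f (g ≫ ω) i) (fibMor g ω i) j l).symm
        (Λ.tr (F X) (fib_fibMor f (g ≫ ω) i _).symm
          (z (fibTip (g ≫ ω) i (fibTip (fibMor g ω i) j l)))))]
    · exact (Λ.tr_tr _ _ _).symm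
    intro l l' hl e
    refine (congrArg _ (Λ.tr_tr _ _ _)).trans ((Λ.tr_tr _ _ _).trans ?_)
    exact Λ.tr_index z (fibTip_fibTip g ω i j l l' hl) _ _

/-- The right unit law on each summand, by induction on the operation. -/
lemma mul_id_ι {T : O} (t : Tree O T) :
    ι X t ▷ _ ≫ (F X T ◁ tensMap (card T) (fun i => unit X ≫
      eqToHom (congrArg (F X) (fib_id T i).symm))) ≫ mul X (𝟙 T) =
    ι X t ▷ _ ≫ (F X T ◁ tensUnit (card T)) ≫ (ρ_ (F X T)).hom := by
  have hmap : ∀ (Λ : EltFun V) (T : O) (x : Λ.obj (F X T)), Λ.map ((F X T ◁ tensMap (card T)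
      (fun i => unit X ≫ eqToHom (congrArg (F X) (fib_id T i).symm))) ≫ mul X (𝟙 T))
      (Λ.tmul x (Λ.tens _ (fun _ => Λ.one))) =
      Λ.mul (mul X (𝟙 T)) x (fun i => Λ.tr (F X) (fib_id T i).symm (Λ.map (unit X) Λ.one)) := by
    intro Λ T x
    simp only [Λ.map_comp, Λ.map_whiskerLeft, Λ.map_tensMap]
    rfl
  induction t with
  | unit h =>
    subst h
    refine elt_ext_units (A := 𝟙_ V) fun Λ x => ?_
    revert x
    -- morphisms out of the unit object need only be compared on the element `Λ.one`
    have key : (ρ_ (𝟙_ V)).inv ≫ 𝟙_ V ◁ tensUnitInv (card (U : O)) ≫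
        ι X (.unit rfl : Tree O U) ▷ _ ≫ (F X U ◁ tensMap (card U) (fun i => unit X ≫
          eqToHom (congrArg (F X) (fib_id U i).symm))) ≫ mul X (𝟙 U) =
        (ρ_ (𝟙_ V)).inv ≫ 𝟙_ V ◁ tensUnitInv (card (U : O)) ≫ ι X (.unit rfl : Tree O U) ▷ _ ≫
          (F X U ◁ tensUnit (card U)) ≫ (ρ_ (F X U)).hom := by
      refine elt_ext_one fun Λ => ?_
      have gen : ∀ f : F X U ⊗ tens (card (U : O)) (fun _ => 𝟙_ V) ⟶ F X U,
          Λ.map ((ρ_ (𝟙_ V)).inv ≫ 𝟙_ V ◁ tensUnitInv (card (U : O)) ≫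
            ι X (.unit rfl : Tree O U) ▷ _ ≫ f) Λ.one =
          Λ.map f (Λ.tmul (Λ.map (unit X) Λ.one) (Λ.tens _ (fun _ => Λ.one))) := fun f => by
        rw [Λ.map_comp, Λ.map_comp, Λ.map_inv _ (Λ.map_right _), Λ.map_whiskerLeft,
          Λ.map_tensUnitInv, Λ.map_whiskerRight_comp]
        rfl
      rw [gen, gen, hmap, Λ.map_comp, Λ.map_whiskerLeft, Λ.map_tensUnit, Λ.map_right]
      have h := mul_unit X Λ rfl (𝟙 U) (fun i => Λ.tr (F X) (fib_id U i).symm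
        (Λ.map (unit X) Λ.one)) (Fin.cast card_U.symm 0)
      rw [EltFun.tr_rfl, EltFun.tr_tr, EltFun.tr_rfl] at h
      exact h
    intro x
    have h := congrArg (fun t => Λ.map t x) key
    simp only [Λ.map_comp (ρ_ (𝟙_ V)).inv, Λ.map_inv _ (Λ.map_right _),
      Λ.map_comp (𝟙_ V ◁ tensUnitInv _), Λ.map_whiskerLeft, Λ.map_tensUnitInv] at h
    exact h
  | @node T S ω b ih =>
    have ih' := fun (i : Fin (card S)) (Λ : EltFun V) (x : Λ.obj (ev X (b i))) => by
      have h := congrArg (fun t => Λ.map t (Λ.tmul x (Λ.tens _ (fun _ => Λ.one)))) (ih i)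
      simp only [Λ.map_comp (ι X (b i) ▷ _), Λ.map_whiskerRight, hmap] at h
      simp only [Λ.map_comp, Λ.map_whiskerLeft, Λ.map_tensUnit, Λ.map_right] at h
      exact h
    refine elt_ext_node_units fun Λ x β => ?_
    rw [Λ.map_comp, Λ.map_whiskerRight, hmap, Λ.map_comp, Λ.map_comp, Λ.map_whiskerRight,
      Λ.map_whiskerLeft, Λ.map_tensUnit, Λ.map_right, map_ι_node, mul_inn]
    refine (Λ.tr_rfl rfl _).symm.trans (Λ.mul_congr (inn X) rfl rfl (𝟙 T ≫ ω) ω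
      (by simp) _ _ (Λ.tr_rfl rfl _) _ _ ?_)
    rintro i i' hi e
    obtain rfl := Fin.ext hi
    refine (Λ.mul_congr (mul X) e rfl (fibMor (𝟙 T) ω i) (𝟙 _) ?_ _ _ (Λ.tr_rfl rfl _) _
      (fun j => Λ.tr (F X) (fib_id (fib ω i) j).symm (Λ.map (unit X) Λ.one)) ?_).trans
      (ih' i Λ (β i))
    · rw [fibMor_id_left]
      simp
    · rintro j j' hj e'
      exact (congrArg _ (Λ.tr_tr _ _ _)).trans (Λ.tr_tr _ _ _)

/-- The operad structure of the free operad. -/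
noncomputable def str : OperadStr O (F X) where
  unit := unit X
  mul f := mul X f
  assoc f g := ((isCoprod_ι X _).whiskerRight _).hom_ext fun t => assoc_ι X t f g
  mul_id T := ((isCoprod_ι X T).whiskerRight _).hom_ext fun t => mul_id_ι X t
  mul_toU T := elt_ext_unit fun Λ x => by
    simp only [Λ.map_comp, Λ.map_tmul, Λ.map_left, Λ.map_tensOne, Λ.map_tensMap]
    have h := mul_unit X Λ rfl (toU T) (fun i => Λ.tr (F X) (fib_toU T i).symm x)
      (Fin.cast card_U.symm 0)
    rw [EltFun.tr_rfl, EltFun.tr_tr, EltFun.tr_rfl] at h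
    exact h

/-- The free operad on a collection. -/
noncomputable def operad : Operad V O := ⟨F X, str X⟩

/-- The inclusion of the generators. -/
noncomputable def η (S : O) : X S ⟶ F X S :=
  (ρ_ _).inv ≫ (X S ◁ tensUnitInv _) ≫ (X S ◁ tensMap (card S) (fun i =>
    unit X ≫ eqToHom (congrArg (F X) (fib_id S i).symm))) ≫ inn X (𝟙 S)

lemma map_η (Λ : EltFun V) (S : O) (x : Λ.obj (X S)) :
    Λ.map (η X S) x = Λ.mul (inn X (𝟙 S)) x
      (fun i => Λ.tr (F X) (fib_id S i).symm (Λ.map (unit X) Λ.one)) := by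
  rw [η, Λ.map_comp, Λ.map_inv _ (Λ.map_right x), Λ.map_comp, Λ.map_whiskerLeft, Λ.map_tensUnitInv,
    Λ.map_comp, Λ.map_whiskerLeft, Λ.map_tensMap]
  simp only [Λ.map_comp]
  rfl

/-- Multiplication with a generator. -/
lemma mul_η (Λ : EltFun V) {T S : O} (σ : T ⟶ S) (x : Λ.obj (X S))
    (c : ∀ i, Λ.obj (F X (fib σ i))) :
    Λ.mul (mul X σ) (Λ.map (η X S) x) c = Λ.mul (inn X σ) x c := by
  rw [map_η, mul_inn]
  refine (Λ.tr_rfl rfl _).symm.trans (Λ.mul_congr (inn X) rfl rfl (σ ≫ 𝟙 S) σ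
    (by simp) _ _ (Λ.tr_rfl rfl _) _ _ ?_)
  rintro i i' hi e
  obtain rfl := Fin.ext hi
  rw [mul_unit X Λ (fib_id S i) (fibMor σ (𝟙 S) i) _ (Fin.cast (by rw [fib_id, card_U]) 0)]
  refine (congrArg _ (Λ.tr_tr _ _ _)).trans ((Λ.tr_tr _ _ _).trans ?_)
  exact (Λ.tr_index c (fibTip_id S i _) _ rfl).trans (Λ.tr_rfl _ _)

lemma inn_eq {T S : O} (σ : T ⟶ S) : inn X σ = (η X S ▷ _) ≫ mul X σ :=
  elt_ext_mul fun Λ x c => by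
    rw [Λ.map_comp, Λ.map_whiskerRight]
    exact (mul_η X Λ σ x c).symm

end Free

/-- Multiplication with the unit of an operad. -/
lemma OperadStr.comp_one {O : Type} [FibredCategory O] [Levelled O] {V : Type u} [Category.{v} V]
    [MonoidalCategory V] [SymmetricCategory V] {A : O → V} (a : OperadStr O A) (Λ : EltFun V)
    {T S : O} (h : S = U) (σ : T ⟶ S) (c : ∀ s, Λ.obj (A (fib σ s))) (s : Fin (card S)) :
    a.comp Λ σ (Λ.tr A h.symm (a.one Λ)) c = Λ.tr A (Free.fib_eq_of_U h σ s) (c s) := by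
  subst h
  obtain rfl := Levelled.eq_toU σ (toU T)
  rw [EltFun.tr_rfl]
  refine Eq.trans ?_ (a.comp_toU Λ T _)
  congr 1
  funext i
  obtain rfl : i = s := Fin.ext (by
    have h1 := i.2.trans_eq card_U
    have h2 := s.2.trans_eq card_U
    omega)
  rw [EltFun.tr_tr, EltFun.tr_rfl]

namespace Free

open Levelled

variable {O : Type} [FibredCategory O] {V : Type u} [Category.{v} V] [MonoidalCategory V]
  [HasColimits V] [SymmetricCategory V] [∀ X : V, PreservesColimits (tensorLeft X)] {X : O → V}
  [Levelled O] {B : O → V} (b : OperadStr O B) (g : ∀ T, X T ⟶ B T)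

/-- The value of an operation of the free operad in an operad. -/
noncomputable def evMap : {T : O} → (t : Tree O T) → (ev X t ⟶ B T)
  | _, .unit h => b.unit ≫ eqToHom (congrArg B h.symm)
  | _, .node (S := S) σ c => (g S ⊗ₘ tensMap (card S) (fun i => evMap (c i))) ≫ b.mul σ

/-- The extension of a map of collections to the free operad. -/
noncomputable def lift (T : O) : F X T ⟶ B T := (isCoprod_ι X T).desc (fun t => evMap b g t)

lemma ι_lift {T : O} (t : Tree O T) : ι X t ≫ lift b g T = evMap b g t :=
  (isCoprod_ι X T).ι_desc _ t

lemma inn_lift {T S : O} (σ : T ⟶ S) :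
    inn X σ ≫ lift b g T = (g S ⊗ₘ tensMap (card S) (fun i => lift b g (fib σ i))) ≫ b.mul σ := by
  refine (isCoprod_node X σ).hom_ext fun c => ?_
  rw [← Category.assoc, ι_inn, ι_lift, ← id_tensorHom, tensorHom_comp_tensorHom_assoc, tensMap_comp,
    Category.id_comp]
  simp only [ι_lift]
  rfl

lemma map_inn_lift (Λ : EltFun V) {T S : O} (σ : T ⟶ S) (x : Λ.obj (X S))
    (c : ∀ i, Λ.obj (F X (fib σ i))) :
    Λ.map (lift b g T) (Λ.mul (inn X σ) x c) =
      b.comp Λ σ (Λ.map (g S) x) (fun i => Λ.map (lift b g _) (c i)) :=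
  Λ.map_mul (inn_lift b g σ) x c

lemma unit_lift : unit X ≫ lift b g U = b.unit := by
  rw [unit, ι_lift]
  exact Category.comp_id _

/-- The extension is multiplicative on each summand, by induction on the operation. -/
lemma lift_ι {S : O} (t : Tree O S) {T : O} (σ : T ⟶ S) :
    ι X t ▷ _ ≫ mul X σ ≫ lift b g T =
      ι X t ▷ _ ≫ (lift b g S ⊗ₘ tensMap (card S) (fun i => lift b g (fib σ i))) ≫ b.mul σ := by
  have hl : ∀ (Λ : EltFun V) {T S : O} (σ : T ⟶ S) (x : Λ.obj (F X S))
      (c : ∀ i, Λ.obj (F X (fib σ i))), Λ.map ((lift b g S ⊗ₘ tensMap (card S)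
        (fun i => lift b g (fib σ i))) ≫ b.mul σ) (Λ.tmul x (Λ.tens _ c)) =
      b.comp Λ σ (Λ.map (lift b g S) x) (fun i => Λ.map (lift b g _) (c i)) := by
    intro Λ T S σ x c
    rw [Λ.map_comp, Λ.map_tmul, Λ.map_tensMap]
    rfl
  have hm : ∀ (Λ : EltFun V) {T S : O} (σ : T ⟶ S) (x : Λ.obj (F X S))
      (c : ∀ i, Λ.obj (F X (fib σ i))), Λ.map (mul X σ ≫ lift b g T) (Λ.tmul x (Λ.tens _ c)) =
      Λ.map (lift b g T) (Λ.mul (mul X σ) x c) := fun Λ {T S} σ x c => Λ.map_comp _ _ _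
  induction t generalizing T with
  | unit h =>
    subst h
    refine elt_ext_unit_mul (B := fun i => F X (fib σ i)) fun Λ c => ?_
    rw [Λ.map_whiskerRight_comp, Λ.map_whiskerRight_comp]
    refine (hm Λ σ _ c).trans (Eq.trans ?_ (hl Λ σ _ c).symm)
    have h1 := mul_unit X Λ rfl σ c (Fin.cast card_U.symm 0)
    have h2 := b.comp_one Λ rfl σ (fun i => Λ.map (lift b g _) (c i)) (Fin.cast card_U.symm 0)
    rw [EltFun.tr_rfl] at h1 h2
    have h3 : Λ.map (lift b g U) (Λ.map (ι X (.unit rfl)) Λ.one) = b.one Λ := by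
      rw [← Λ.map_comp]
      exact congrArg (fun t => Λ.map t Λ.one) (unit_lift b g)
    rw [h3, h2]
    exact (congrArg _ h1).trans (Λ.map_tr (lift b g) _ _)
  | @node S R ω t ih =>
    have ih' := fun (i : Fin (card R)) {T : O} (σ : T ⟶ fib ω i) (Λ : EltFun V)
      (x : Λ.obj (ev X (t i))) (c : ∀ j, Λ.obj (F X (fib σ j))) => by
      have h := congrArg (fun t => Λ.map t (Λ.tmul x (Λ.tens _ c))) (ih i σ)
      simp only [Λ.map_comp (ι X (t i) ▷ _), Λ.map_whiskerRight, hm, hl] at h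
      exact h
    refine elt_ext_node (C := fun i => F X (fib σ i)) fun Λ x β c => ?_
    rw [Λ.map_whiskerRight_comp, Λ.map_whiskerRight_comp]
    refine (hm Λ σ _ c).trans (Eq.trans ?_ (hl Λ σ _ c).symm)
    rw [map_ι_node, mul_inn, map_inn_lift, map_inn_lift, b.comp_assoc]
    simp only [ih']
    exact congrArg _ (funext fun i => congrArg _ (funext fun j => Λ.map_tr (lift b g) _ _))

lemma isHom_lift : (str X).IsHom b (lift b g) where
  unit := unit_lift b g
  mul σ := ((isCoprod_ι X _).whiskerRight _).hom_ext fun t => lift_ι b g t σ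

lemma η_lift (S : O) : η X S ≫ lift b g S = g S := elt_ext_leaf fun Λ x => by
  rw [Λ.map_comp, map_η, map_inn_lift]
  refine Eq.trans ?_ (b.comp_id Λ S _)
  congr 1
  funext i
  rw [Λ.map_tr (lift b g)]
  congr 1
  exact (isHom_lift b g).map_one Λ

/-- An operad map from the free operad is determined by its values on the generators, because every
operation is a composite of generators. -/
lemma lift_unique {φ : ∀ T, F X T ⟶ B T} (hφ : (str X).IsHom b φ) (h : ∀ T, η X T ≫ φ T = g T)
    (T : O) : φ T = lift b g T := by
  refine (isCoprod_ι X T).hom_ext fun t => ?_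
  rw [ι_lift]
  induction t with
  | unit h =>
    subst h
    exact hφ.unit.trans (Category.comp_id _).symm
  | @node T S σ c ih =>
    have h1 : inn X σ ≫ φ T =
        (g S ⊗ₘ tensMap (card S) (fun i => φ (fib σ i))) ≫ b.mul σ := by
      have h2 := hφ.mul σ
      change mul X σ ≫ φ T = _ at h2
      rw [inn_eq, Category.assoc, h2, ← tensorHom_id, tensorHom_comp_tensorHom_assoc, h,
        Category.id_comp]
    rw [← ι_inn, Category.assoc, h1, ← id_tensorHom, tensorHom_comp_tensorHom_assoc, tensMap_comp,
      Category.id_comp]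
    simp only [ih]
    rfl

/-- The operad map from the free operad that extends a map of collections. -/
noncomputable def liftHom {B : Operad V O} (g : X ⟶ (Operad.forget V O).obj B) : operad X ⟶ B :=
  (⟨lift B.str g, isHom_lift B.str g⟩ : Operad.Hom (operad X) B)

/-- Operad maps from a free operad correspond to maps of collections. -/
noncomputable def homEquiv (X : O → V) (B : Operad V O) :
    (operad X ⟶ B) ≃ (X ⟶ (Operad.forget V O).obj B) where
  toFun φ T := η X T ≫ (show Operad.Hom _ _ from φ).app T
  invFun := liftHom
  left_inv φ := Operad.Hom.ext (funext fun T =>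
    (lift_unique B.str _ (show Operad.Hom _ _ from φ).isHom (fun _ => rfl) T).symm)
  right_inv g := funext fun T => η_lift B.str g T

variable (O V) in
/-- The free operad functor is left adjoint to the forgetful functor. -/
noncomputable def adjunction : Adjunction.leftAdjointOfEquiv (G := Operad.forget V O)
    homEquiv (fun _ _ _ _ _ => funext fun _ => (Category.assoc _ _ _).symm) ⊣
      Operad.forget V O :=
  Adjunction.adjunctionOfEquivLeft _ _

variable (O V) in
/-- The forgetful functor from operads has a left adjoint. -/
lemma isRightAdjoint_forget : (Operad.forget V O).IsRightAdjoint :=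
  (adjunction O V).isRightAdjoint

end Free

/-! ### Reflexive coequalizers of operads -/

/-- The morphism `q` is the coequalizer of the reflexive pair `f`, `g`. -/
structure IsReflCoeq {V : Type u} [Category.{v} V] {A B C : V} (f g : A ⟶ B) (q : B ⟶ C) :
    Prop where
  condition : f ≫ q = g ≫ q
  exists_section : ∃ s, s ≫ f = 𝟙 B ∧ s ≫ g = 𝟙 B
  exists_unique (W : V) (h : B ⟶ W) : f ≫ h = g ≫ h → ∃! k, q ≫ k = h

namespace IsReflCoeq

variable {V : Type u} [Category.{v} V] {A B C A' B' C' W : V} {f g : A ⟶ B} {q : B ⟶ C}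
  {f' g' : A' ⟶ B'} {q' : B' ⟶ C'}

lemma epi (h : IsReflCoeq f g q) : Epi q where
  left_cancellation a b hab := (h.exists_unique _ (q ≫ b)
    (by rw [← Category.assoc, ← Category.assoc, h.condition])).unique hab rfl

/-- The morphism induced on the coequalizer. -/
noncomputable def desc (h : IsReflCoeq f g q) (k : B ⟶ W) (hk : f ≫ k = g ≫ k) : C ⟶ W :=
  (h.exists_unique W k hk).choose

lemma comp_desc (h : IsReflCoeq f g q) (k : B ⟶ W) (hk : f ≫ k = g ≫ k) :
    q ≫ h.desc k hk = k :=
  (h.exists_unique W k hk).choose_spec.1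

lemma id (A : V) : IsReflCoeq (𝟙 A) (𝟙 A) (𝟙 A) :=
  ⟨rfl, ⟨𝟙 A, Category.id_comp _, Category.id_comp _⟩, fun W k _ =>
    ⟨k, Category.id_comp _, fun _ h => (Category.id_comp _).symm.trans h⟩⟩

lemma of_isColimit (hs : ∃ s, s ≫ f = 𝟙 B ∧ s ≫ g = 𝟙 B) {w : f ≫ q = g ≫ q}
    (h : IsColimit (Cofork.ofπ q w)) : IsReflCoeq f g q :=
  ⟨w, hs, fun W k hk => ⟨h.desc (Cofork.ofπ k hk), h.fac _ WalkingParallelPair.one,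
    fun m hm => Cofork.IsColimit.hom_ext h
      (hm.trans (h.fac (Cofork.ofπ k hk) WalkingParallelPair.one).symm)⟩⟩

/-- The colimit cocone of a coequalizer diagram. -/
noncomputable def isColimit (h : IsReflCoeq f g q) : IsColimit (Cofork.ofπ q h.condition) :=
  Cofork.IsColimit.mk _ (fun s => h.desc s.π s.condition) (fun s => h.comp_desc s.π s.condition)
    (fun s m hm => by
      have := h.epi
      rw [← cancel_epi q, h.comp_desc]
      exact hm)

variable [MonoidalCategory V] [∀ X : V, PreservesColimits (tensorLeft X)]

lemma whiskerLeft (h : IsReflCoeq f g q) (X : V) : IsReflCoeq (X ◁ f) (X ◁ g) (X ◁ q) := by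
  have := preservesSmallestColimits_of_preservesColimits (tensorLeft X)
  obtain ⟨s, hs, hs'⟩ := h.exists_section
  exact of_isColimit ⟨X ◁ s, by rw [← whiskerLeft_comp, hs, whiskerLeft_id],
    by rw [← whiskerLeft_comp, hs', whiskerLeft_id]⟩
    (isColimitCoforkMapOfIsColimit (tensorLeft X) h.condition h.isColimit)

variable [SymmetricCategory V]

lemma whiskerRight (h : IsReflCoeq f g q) (X : V) : IsReflCoeq (f ▷ X) (g ▷ X) (q ▷ X) := by
  have h' := h.whiskerLeft X
  obtain ⟨s, hs, hs'⟩ := h.exists_section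
  refine ⟨by rw [← comp_whiskerRight, h.condition, comp_whiskerRight],
    ⟨s ▷ X, by rw [← comp_whiskerRight, hs, id_whiskerRight],
      by rw [← comp_whiskerRight, hs', id_whiskerRight]⟩, fun W k hk => ?_⟩
  have hk' : X ◁ f ≫ (β_ X B).hom ≫ k = X ◁ g ≫ (β_ X B).hom ≫ k := by
    rw [BraidedCategory.braiding_naturality_right_assoc, hk,
      BraidedCategory.braiding_naturality_right_assoc]
  refine ⟨(β_ C X).hom ≫ h'.desc _ hk', ?_, fun m hm => ?_⟩
  · change q ▷ X ≫ _ = _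
    rw [BraidedCategory.braiding_naturality_left_assoc, h'.comp_desc,
      SymmetricCategory.symmetry_assoc]
  · have := h'.epi
    rw [← cancel_epi (β_ X C).hom, SymmetricCategory.symmetry_assoc, ← cancel_epi (X ◁ q),
      h'.comp_desc, BraidedCategory.braiding_naturality_right_assoc]
    exact congrArg _ hm

/-- The tensor product of coequalizers of reflexive pairs is the coequalizer of the tensor product
of the pairs. -/
lemma tensor (h : IsReflCoeq f g q) (h' : IsReflCoeq f' g' q') :
    IsReflCoeq (f ⊗ₘ f') (g ⊗ₘ g') (q ⊗ₘ q') := by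
  -- by means of the sections, the two variables can be treated separately
  obtain ⟨s, hs, hs₂⟩ := h.exists_section
  obtain ⟨s', hs', hs₂'⟩ := h'.exists_section
  have h1 := h.whiskerRight B'
  have h2 := h'.whiskerLeft C
  have e1 := h1.epi
  have e2 := h2.epi
  refine ⟨by rw [tensorHom_comp_tensorHom, tensorHom_comp_tensorHom, h.condition, h'.condition],
    ⟨s ⊗ₘ s', by rw [tensorHom_comp_tensorHom, hs, hs', id_tensorHom_id],
      by rw [tensorHom_comp_tensorHom, hs₂, hs₂', id_tensorHom_id]⟩, fun W k hk => ?_⟩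
  have k1 : f ▷ B' ≫ k = g ▷ B' ≫ k := by
    have := congrArg (fun t => (𝟙 A ⊗ₘ s') ≫ t) hk
    simp only [tensorHom_comp_tensorHom_assoc, hs', hs₂', Category.id_comp, tensorHom_id] at this
    exact this
  have k2 : B ◁ f' ≫ k = B ◁ g' ≫ k := by
    have := congrArg (fun t => (s ⊗ₘ 𝟙 A') ≫ t) hk
    simp only [tensorHom_comp_tensorHom_assoc, hs, hs₂, Category.id_comp, id_tensorHom] at this
    exact this
  have k3 : C ◁ f' ≫ h1.desc k k1 = C ◁ g' ≫ h1.desc k k1 := by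
    have := (h.whiskerRight A').epi
    rw [← cancel_epi (q ▷ A'), ← whisker_exchange_assoc, ← whisker_exchange_assoc, h1.comp_desc, k2]
  refine ⟨h2.desc _ k3, ?_, fun m hm => ?_⟩
  · change (q ⊗ₘ q') ≫ _ = _
    rw [MonoidalCategory.tensorHom_def, Category.assoc, h2.comp_desc, h1.comp_desc]
  · rw [← cancel_epi (C ◁ q'), ← cancel_epi (q ▷ B'), h2.comp_desc, h1.comp_desc, ← Category.assoc,
      ← MonoidalCategory.tensorHom_def]
    exact hm

lemma tens (k : ℕ) {A B C : Fin k → V} {f g : ∀ i, A i ⟶ B i} {q : ∀ i, B i ⟶ C i}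
    (h : ∀ i, IsReflCoeq (f i) (g i) (q i)) :
    IsReflCoeq (tensMap k f) (tensMap k g) (tensMap k q) := by
  induction k with
  | zero => exact id _
  | succ k ih => exact (h 0).tensor (ih fun i => h i.succ)

end IsReflCoeq

section Descend

variable {V : Type u} [Category.{v} V] [MonoidalCategory V] [SymmetricCategory V]
  [∀ X : V, PreservesColimits (tensorLeft X)] {O : Type} [FibredCategory O] {A B C : O → V}
  {f g : ∀ T, A T ⟶ B T} {q : ∀ T, B T ⟶ C T}

/-- The levelwise coequalizer of operads has a compatible multiplication. -/
lemma exists_mul_coeq {a : OperadStr O A} {b : OperadStr O B} (hf : a.IsHom b f)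
    (hg : a.IsHom b g) (hq : ∀ T, IsReflCoeq (f T) (g T) (q T)) {T S : O} (σ : T ⟶ S) :
    ∃ m : C S ⊗ tens (card S) (fun i => C (fib σ i)) ⟶ C T,
      (q S ⊗ₘ tensMap (card S) (fun i => q (fib σ i))) ≫ m = b.mul σ ≫ q T :=
  (((hq S).tensor (IsReflCoeq.tens (card S) (fun i => hq (fib σ i)))).exists_unique _
    (b.mul σ ≫ q T) (by
      rw [← Category.assoc, ← Category.assoc, ← hf.mul, ← hg.mul, Category.assoc, Category.assoc,
        (hq T).condition])).exists

/-- An operad structure descends along levelwise coequalizers of reflexive pairs. -/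
def OperadStr.descend (b : OperadStr O B) (hq : ∀ T, IsReflCoeq (f T) (g T) (q T))
    (m : ∀ {T S : O} (σ : T ⟶ S), C S ⊗ tens (card S) (fun i => C (fib σ i)) ⟶ C T)
    (hm : ∀ {T S : O} (σ : T ⟶ S),
      (q S ⊗ₘ tensMap (card S) (fun i => q (fib σ i))) ≫ m σ = b.mul σ ≫ q T) :
    OperadStr O C :=
  have hmΛ : ∀ (Λ : EltFun V) {T S : O} (σ : T ⟶ S) (x : Λ.obj (B S))
      (y : ∀ i, Λ.obj (B (fib σ i))), Λ.mul (m σ) (Λ.map (q S) x) (fun i => Λ.map (q _) (y i)) =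
        Λ.map (q T) (b.comp Λ σ x y) := fun Λ {T S} σ x y => (Λ.map_mul (hm σ).symm x y).symm
  { unit := b.unit ≫ q U
    mul := m
    assoc := fun {T S R} σ ω => by
      have := ((hq R).tensor (IsReflCoeq.tens (card R) (fun i => (hq (fib ω i)).tensor
        (IsReflCoeq.tens (card (fib ω i)) (fun j => hq (fib σ (fibTip ω i j))))))).epi
      refine (cancel_epi (q R ⊗ₘ tensMap (card R) (fun i => q (fib ω i) ⊗ₘ
        tensMap (card (fib ω i)) (fun j => q (fib σ (fibTip ω i j)))))).1 ?_
      refine elt_ext_assoc (X := fun i => B (fib ω i)) (Z := fun s => B (fib σ s))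
        (fibTip_bijective ω) fun Λ x y z => ?_
      have h1 : Λ.map (q R ⊗ₘ tensMap (card R) (fun i => q (fib ω i) ⊗ₘ
          tensMap (card (fib ω i)) (fun j => q (fib σ (fibTip ω i j)))))
          (Λ.tmul x (Λ.tens _ fun i => Λ.tmul (y i) (Λ.tens _ fun j => z (fibTip ω i j)))) =
          Λ.tmul (Λ.map (q R) x) (Λ.tens _ fun i => Λ.tmul (Λ.map (q _) (y i))
            (Λ.tens _ fun j => Λ.map (q _) (z (fibTip ω i j)))) := by
        rw [Λ.map_tmul, Λ.map_tensMap]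
        simp only [Λ.map_tmul, Λ.map_tensMap]
      refine ((Λ.map_comp _ _ _).trans (congrArg _ h1)).trans (Eq.trans ?_
        ((Λ.map_comp _ _ _).trans (congrArg _ h1)).symm)
      refine (Λ.map_assoc_left (Z := fun s => C (fib σ s)) (fibTip_bijective ω) _ _ _ _
        (fun s => Λ.map (q _) (z s))).trans (Eq.trans ?_ (Λ.map_assoc_right _ _ _ _ _
          (fun i j => Λ.map (q _) (z (fibTip ω i j)))).symm)
      have h2 : ∀ i j, Λ.map (eqToHom (congrArg C (fib_fibMor σ ω i j).symm))
          (Λ.map (q _) (z (fibTip ω i j))) =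
          Λ.map (q _) (Λ.tr B (fib_fibMor σ ω i j).symm (z (fibTip ω i j))) := fun i j =>
        (Λ.map_tr q _ _).symm
      have h3 := fun i => (congrArg (Λ.mul (m (fibMor σ ω i)) (Λ.map (q _) (y i)))
        (funext fun j => h2 i j)).trans (hmΛ Λ (fibMor σ ω i) (y i) _)
      refine (congrArg (fun t => Λ.mul (m σ) t (fun s => Λ.map (q _) (z s))) (hmΛ Λ ω x y)).trans
        ((hmΛ Λ σ _ z).trans (Eq.trans ?_
          (congrArg (Λ.mul (m (σ ≫ ω)) (Λ.map (q R) x)) (funext h3)).symm))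
      exact (congrArg _ (b.comp_assoc Λ σ ω x y z)).trans (hmΛ Λ (σ ≫ ω) x _).symm
    mul_id := fun T => by
      have := ((hq T).whiskerRight (tens (card T) (fun _ => 𝟙_ V))).epi
      refine (cancel_epi (q T ▷ tens (card T) (fun _ => 𝟙_ V))).1 ?_
      refine elt_ext_units fun Λ x => ?_
      rw [Λ.map_whiskerRight_comp, Λ.map_whiskerRight_comp]
      simp only [Λ.map_comp, Λ.map_whiskerLeft, Λ.map_tensMap, Λ.map_tensUnit, Λ.map_right]
      have h2 : ∀ i, Λ.map (eqToHom (congrArg C (fib_id T i).symm))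
          (Λ.map (q U) (Λ.map b.unit Λ.one)) =
          Λ.map (q _) (Λ.tr B (fib_id T i).symm (b.one Λ)) := fun i => (Λ.map_tr q _ _).symm
      simp only [h2]
      exact (hmΛ Λ (𝟙 T) x _).trans (congrArg _ (b.comp_id Λ T x))
    mul_toU := fun T => by
      have := ((hq T).whiskerLeft (𝟙_ V)).epi
      refine (cancel_epi (𝟙_ V ◁ q T)).1 ?_
      refine elt_ext_unit fun Λ x => ?_
      rw [Λ.map_comp (𝟙_ V ◁ q T), Λ.map_comp (𝟙_ V ◁ q T), Λ.map_whiskerLeft]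
      simp only [Λ.map_comp, Λ.map_tmul, Λ.map_left, Λ.map_tensOne, Λ.map_tensMap]
      have h2 : ∀ i, Λ.map (eqToHom (congrArg C (fib_toU T i).symm)) (Λ.map (q T) x) =
          Λ.map (q _) (Λ.tr B (fib_toU T i).symm x) := fun i => (Λ.map_tr q _ _).symm
      simp only [h2]
      exact (hmΛ Λ (toU T) (b.one Λ) _).trans (congrArg _ (b.comp_toU Λ T x)) }

end Descend

namespace Operad

variable {V : Type u} [Category.{v} V] [MonoidalCategory V] [SymmetricCategory V]
  {O : Type} [FibredCategory O]

/-- The components of an operad map. -/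
abbrev app {A B : Operad V O} (f : A ⟶ B) (T : O) : A.obj T ⟶ B.obj T := Operad.Hom.app f T

lemma isHom {A B : Operad V O} (f : A ⟶ B) : A.str.IsHom B.str (app f) := Operad.Hom.isHom f

variable [HasColimits V] [∀ X : V, PreservesColimits (tensorLeft X)]

/-- A reflexive pair of operad maps has a coequalizer, which is computed levelwise. -/
lemma exists_coeq {A B : Operad V O} (f g : Operad.Hom A B)
    (s : Operad.Hom B A) (hs : ∀ T, s.app T ≫ f.app T = 𝟙 _) (hs' : ∀ T, s.app T ≫ g.app T = 𝟙 _) :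
    ∃ (C : Operad V O) (q : Operad.Hom B C), ∀ T, IsReflCoeq (f.app T) (g.app T) (q.app T) := by
  have hq : ∀ T, IsReflCoeq (f.app T) (g.app T) (coequalizer.π (f.app T) (g.app T)) := fun T =>
    IsReflCoeq.of_isColimit ⟨s.app T, hs T, hs' T⟩ (coequalizerIsCoequalizer _ _)
  choose m hm using fun (T S : O) (σ : T ⟶ S) => exists_mul_coeq f.isHom g.isHom hq σ
  exact ⟨⟨_, B.str.descend hq (fun {T S} σ => m T S σ) (fun {T S} σ => hm T S σ)⟩,
    ⟨fun T => coequalizer.π (f.app T) (g.app T), ⟨rfl, fun {T S} σ => (hm T S σ).symm⟩⟩, hq⟩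

/-- The levelwise coequalizer of operad maps is a coequalizer of operads. -/
noncomputable def isColimitCoeq {A B C : Operad V O} {f g : A ⟶ B} {q : B ⟶ C}
    (hq : ∀ T, IsReflCoeq (app f T)
      (app g T) (app q T)) :
    IsColimit (Cofork.ofπ q (Operad.Hom.ext (funext fun T => (hq T).condition) : f ≫ q = g ≫ q)) :=
  Cofork.IsColimit.mk' _ fun s =>
    let k : Operad.Hom B s.pt := s.π
    have hk : ∀ T, app f T ≫ k.app T =
        app g T ≫ k.app T := fun T =>
      congrFun (congrArg Operad.Hom.app s.condition) T
    ⟨(⟨fun T => (hq T).desc (k.app T) (hk T), {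
        unit := by
          rw [← (isHom q).unit, Category.assoc, (hq _).comp_desc,
            k.isHom.unit]
        mul := fun {T S} σ => by
          have := ((hq S).tensor (IsReflCoeq.tens (card S) (fun i => hq (fib σ i)))).epi
          refine (cancel_epi (app q S ⊗ₘ tensMap (card S)
            (fun i => app q (fib σ i)))).1 ?_
          rw [← Category.assoc, ← (isHom q).mul, Category.assoc,
            (hq _).comp_desc, k.isHom.mul, tensorHom_comp_tensorHom_assoc, (hq _).comp_desc,
            tensMap_comp]
          simp only [(hq _).comp_desc] }⟩ : Operad.Hom C s.pt),
      Operad.Hom.ext (funext fun T => (hq T).comp_desc (k.app T) (hk T)), fun {m} hm =>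
      Operad.Hom.ext (funext fun T => by
        have := (hq T).epi
        rw [← cancel_epi (app q T)]
        exact (congrFun (congrArg Operad.Hom.app hm) T).trans
          ((hq T).comp_desc (k.app T) (hk T)).symm)⟩

/-- A coequalizer in each coordinate is a coequalizer of collections. -/
noncomputable def isColimitPi {I : Type} {A B C : I → V} {f g : A ⟶ B} {q : B ⟶ C}
    (hq : ∀ i, IsReflCoeq (f i) (g i) (q i)) :
    IsColimit (Cofork.ofπ q (funext fun i => (hq i).condition : f ≫ q = g ≫ q)) :=
  Cofork.IsColimit.mk' _ fun s =>
    ⟨fun i => (hq i).desc (s.π i) (congrFun s.condition i),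
      funext fun i => (hq i).comp_desc _ _, fun {m} hm => funext fun i => by
        have := (hq i).epi
        rw [← cancel_epi (q i)]
        exact (congrFun hm i).trans ((hq i).comp_desc _ _).symm⟩

instance : HasReflexiveCoequalizers (Operad V O) where
  has_coeq A B f g _ := by
    obtain ⟨s, hs, hs'⟩ := IsReflexivePair.common_section f g
    obtain ⟨C, q, hq⟩ := exists_coeq f g s (fun T => congrFun (congrArg Operad.Hom.app hs) T)
      (fun T => congrFun (congrArg Operad.Hom.app hs') T)
    exact ⟨⟨_, isColimitCoeq hq⟩⟩

instance : Monad.PreservesColimitOfIsReflexivePair (Operad.forget V O) where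
  out A B f g _ := by
    obtain ⟨s, hs, hs'⟩ := IsReflexivePair.common_section f g
    obtain ⟨C, q, hq⟩ := exists_coeq f g s (fun T => congrFun (congrArg Operad.Hom.app hs) T)
      (fun T => congrFun (congrArg Operad.Hom.app hs') T)
    exact preservesColimit_of_preserves_colimit_cocone (isColimitCoeq hq)
      ((isColimitMapCoconeCoforkEquiv (Operad.forget V O) _).symm (isColimitPi hq))

instance : (Operad.forget V O).ReflectsIsomorphisms where
  reflects {A B} f hf := by
    obtain ⟨k, h1, h2⟩ : ∃ k : ∀ T, B.obj T ⟶ A.obj T, (∀ T, app f T ≫ k T = 𝟙 _) ∧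
        ∀ T, k T ≫ app f T = 𝟙 _ :=
      ⟨inv ((Operad.forget V O).map f),
        fun T => congrFun (IsIso.hom_inv_id ((Operad.forget V O).map f)) T,
        fun T => congrFun (IsIso.inv_hom_id ((Operad.forget V O).map f)) T⟩
    have h3 : ∀ T (Λ : EltFun V) (b : Λ.obj (B.obj T)), Λ.map (app f T)
        (Λ.map (k T) b) = b := fun T Λ b => by
      rw [← Λ.map_comp]
      exact (congrArg (fun t => Λ.map t b) (h2 T)).trans (Λ.map_id b)
    have h4 : ∀ T (Λ : EltFun V) (a : Λ.obj (A.obj T)), Λ.map (k T)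
        (Λ.map (app f T) a) = a := fun T Λ a => by
      rw [← Λ.map_comp]
      exact (congrArg (fun t => Λ.map t a) (h1 T)).trans (Λ.map_id a)
    refine ⟨(⟨k,
      OperadStr.isHom_of_elements (fun Λ => ?_) (fun Λ T S σ x y => ?_)⟩ : Operad.Hom B A),
      Operad.Hom.ext (funext h1), Operad.Hom.ext (funext h2)⟩
    · exact (congrArg _ ((isHom f).map_one Λ).symm).trans (h4 _ Λ _)
    · refine Eq.trans (congrArg _ ?_) (h4 _ Λ _)
      rw [(isHom f).map_comp]
      simp only [h3]

variable [Levelled O]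

variable (V O) in
/-- Operads are monadic over collections. -/
noncomputable abbrev monadicForget : MonadicRightAdjoint (Operad.forget V O) :=
  Monad.monadicOfHasPreservesReflexiveCoequalizersOfReflectsIsomorphisms (Free.adjunction O V)

end Operad

/-! ### Symmetric operads as operads over all maps of finite ordinals -/

/-! An operad over all maps of finite ordinals has an action of the bijections, given by composition
with units. Its restriction to the order preserving maps is a symmetric operad, and each symmetric
operad arises in this way, so that the two notions are equivalent. -/

section FinAll

lemma fibCard_equiv {n m : ℕ} (e : Fin n ≃ Fin m) (i : Fin m) : fibCard e i = 1 :=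
  (fibCard_congr e i (fun a => a) i e (fun _ => Iff.rfl)).trans (fibCard_id i)

variable {V : Type u} [Category.{v} V] [MonoidalCategory V] [SymmetricCategory V]
  {A : FinAll → V} (b : OperadStr FinAll A) (Λ : EltFun V)

namespace OperadStr

/-- The multiplication for a map between finite ordinals. -/
def mapMul {n k : ℕ} (f : Fin n → Fin k) : A k ⊗ tens k (fun i => A (fibCard f i)) ⟶ A n :=
  b.mul (T := (n : FinAll)) (S := (k : FinAll)) f

/-- The multiplication for a map between finite ordinals, on elements. -/
def mapComp {n k : ℕ} (f : Fin n → Fin k) (x : Λ.obj (A k)) (y : ∀ i, Λ.obj (A (fibCard f i))) :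
    Λ.obj (A n) :=
  Λ.mul (b.mapMul f) x y

lemma mapComp_congr {n k : ℕ} {f f' : Fin n → Fin k} (h : ∀ a, f a = f' a) (x : Λ.obj (A k))
    {y : ∀ i, Λ.obj (A (fibCard f i))} {y' : ∀ i, Λ.obj (A (fibCard f' i))}
    (hy : ∀ i (e : fibCard f i = fibCard f' i), Λ.tr A e (y i) = y' i) :
    b.mapComp Λ f x y = b.mapComp Λ f' x y' := by
  obtain rfl := funext h
  obtain rfl : y = y' := funext fun i => (Λ.tr_rfl rfl _).symm.trans (hy i rfl)
  rfl

lemma mapComp_assoc {n l k : ℕ} (f : Fin n → Fin l) (g : Fin l → Fin k) (x : Λ.obj (A k))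
    (y : ∀ i, Λ.obj (A (fibCard g i))) (z : ∀ s, Λ.obj (A (fibCard f s))) :
    b.mapComp Λ f (b.mapComp Λ g x y) z = b.mapComp Λ (fun a => g (f a)) x (fun i =>
      b.mapComp Λ (SymOperad.fibRes f g i) (y i)
        (fun j => Λ.tr A (fibCard_fibMap f g i j).symm (z (fibIncl g i j)))) :=
  b.comp_assoc Λ (T := (n : FinAll)) (S := (l : FinAll)) (R := (k : FinAll)) f g x y z

lemma mapComp_one {n k : ℕ} (h : k = 1) (f : Fin n → Fin k) (c : ∀ s, Λ.obj (A (fibCard f s)))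
    (s : Fin k) : b.mapComp Λ f (Λ.tr A (T := (1 : ℕ)) (T' := k) h.symm (b.one Λ)) c =
      Λ.tr A (fibCard_of_subsingleton f h s) (c s) :=
  b.comp_one Λ (T := (n : FinAll)) (S := (k : FinAll)) h f c s

/-- The action of a bijection, on elements: the composition with units along the inverse. -/
def actElt {n m : ℕ} (e : Fin n ≃ Fin m) (x : Λ.obj (A n)) : Λ.obj (A m) :=
  b.mapComp Λ e.symm x
    (fun i => Λ.tr A (T := (1 : ℕ)) (fibCard_equiv e.symm i).symm (b.one Λ))

lemma actElt_cast {n m : ℕ} (h : n = m) (e : Fin n ≃ Fin m) (he : ∀ a, (e a : ℕ) = a)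
    (x : Λ.obj (A n)) : b.actElt Λ e x = Λ.tr A (T := n) (T' := m) h x := by
  subst h
  obtain rfl : e = Equiv.refl _ := Equiv.ext fun a => Fin.ext (he a)
  exact (b.comp_id Λ (n : FinAll) x).trans (Λ.tr_rfl rfl x).symm

/-- The action of a bijection on the source of a map. -/
lemma actElt_mapComp {n n' k : ℕ} (e : Fin n ≃ Fin n') (f : Fin n → Fin k) (x : Λ.obj (A k))
    (y : ∀ i, Λ.obj (A (fibCard f i))) :
    b.actElt Λ e (b.mapComp Λ f x y) = b.mapComp Λ (fun a => f (e.symm a)) x (fun i =>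
      b.actElt Λ (fibEquiv f i (fun a => f (e.symm a)) i e (fun a => by simp)) (y i)) := by
  refine (b.mapComp_assoc Λ e.symm f x y _).trans ?_
  refine congrArg _ (funext fun i => ?_)
  refine b.mapComp_congr Λ (fun a => rfl) _ fun j e' => ?_
  rw [EltFun.tr_tr, EltFun.tr_tr]
  rfl

lemma actElt_actElt {n m l : ℕ} (e : Fin n ≃ Fin m) (e' : Fin m ≃ Fin l) (x : Λ.obj (A n)) :
    b.actElt Λ e' (b.actElt Λ e x) = b.actElt Λ (e.trans e') x := by
  refine (b.mapComp_assoc Λ e'.symm e.symm x _ _).trans ?_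
  refine b.mapComp_congr Λ (fun a => rfl) _ fun i h => ?_
  rw [b.mapComp_one Λ (fibCard_equiv e.symm i) _ _ (Fin.cast (fibCard_equiv e.symm i).symm 0),
    EltFun.tr_tr, EltFun.tr_tr, EltFun.tr_tr]
  rfl

/-- The action of a bijection on the target of a map permutes the factors that are composed into it.
-/
lemma mapComp_actElt {n k k' : ℕ} (f : Fin n → Fin k') (ρ : Fin k ≃ Fin k') (x : Λ.obj (A k))
    (y : ∀ i, Λ.obj (A (fibCard f i))) :
    b.mapComp Λ f (b.actElt Λ ρ x) y = b.mapComp Λ (fun a => ρ.symm (f a)) x (fun i =>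
      Λ.tr A (T := fibCard f (ρ i)) (fibCard_congr _ _ _ _ (Equiv.refl _)
        (fun a => by simp [Equiv.symm_apply_eq])) (y (ρ i))) := by
  refine (b.mapComp_assoc Λ f ρ.symm x _ y).trans ?_
  refine congrArg _ (funext fun i => ?_)
  rw [b.mapComp_one Λ (fibCard_equiv ρ.symm i) _ _ (Fin.cast (fibCard_equiv ρ.symm i).symm 0),
    EltFun.tr_tr]
  refine Λ.tr_index (g := fun s => (fibCard f s : FinAll)) y ?_ _ _
  have := apply_fibIncl ρ.symm i (Fin.cast (fibCard_equiv ρ.symm i).symm 0)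
  rwa [Equiv.symm_apply_eq] at this

/-- The action of a bijection. -/
def actHom {n m : ℕ} (e : Fin n ≃ Fin m) : A n ⟶ A m :=
  (ρ_ _).inv ≫ (A n ◁ tensUnitInv n) ≫ (A n ◁ tensMap n (fun i =>
    b.unit ≫ eqToHom (congrArg A (fibCard_equiv e.symm i).symm))) ≫
      b.mapMul e.symm

lemma map_actHom {n m : ℕ} (e : Fin n ≃ Fin m) (x : Λ.obj (A n)) :
    Λ.map (b.actHom e) x = b.actElt Λ e x := by
  rw [actHom, Λ.map_comp, Λ.map_inv _ (Λ.map_right x), Λ.map_comp, Λ.map_whiskerLeft,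
    Λ.map_tensUnitInv, Λ.map_comp, Λ.map_whiskerLeft, Λ.map_tensMap]
  simp only [Λ.map_comp]
  rfl

/-- The collection with the action of bijections. -/
def symColl : FinBij ⥤ V where
  obj a := A a.len
  map e := b.actHom e
  map_id a := elt_ext_leaf fun Λ x => by
    rw [map_actHom, Λ.map_id]
    exact (b.actElt_cast Λ rfl _ (fun _ => rfl) x).trans (Λ.tr_rfl rfl x)
  map_comp e e' := elt_ext_leaf fun Λ x => by
    rw [map_actHom, Λ.map_comp, map_actHom, map_actHom, actElt_actElt]
    rfl

/-- The restriction of the multiplication to order preserving maps. -/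
def restrict : OperadStr FinMono (fun a => b.symColl.obj ⟨a.len⟩) where
  unit := b.unit
  mul {T S} f := b.mul (T := (T.len : FinAll)) (S := (S.len : FinAll)) (tips f)
  assoc {T S R} f g :=
    b.assoc (T := (T.len : FinAll)) (S := (S.len : FinAll)) (R := (R.len : FinAll)) (tips f)
      (tips g)
  mul_id T := b.mul_id (T.len : FinAll)
  mul_toU T := b.mul_toU (T.len : FinAll)

/-- Equivariance with respect to a permutation of the fibres. -/
lemma mapMul_actHom {n n' k k' : ℕ} (σ : Fin n → Fin k) (σ' : Fin n' → Fin k')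
    (π : Fin n ≃ Fin n') (ρ : Fin k ≃ Fin k') (h : ∀ a, σ' (π a) = ρ (σ a))
    (hπ : ∀ a b, σ a = σ b → a ≤ b → π a ≤ π b) :
    b.mapMul σ ≫ b.actHom π = (b.actHom ρ ⊗ₘ tensPerm ρ (X' := fun i => A (fibCard σ' i))
      (fun i => eqToHom (congrArg A (fibCard_congr σ i σ' (ρ i) π (fun a => by simp [h]))))) ≫
        b.mapMul σ' := by
  refine elt_ext_mul fun Λ x y => ?_
  let y' : ∀ i, Λ.obj (A (fibCard σ' i)) := fun i =>
    Λ.tr A (T := fibCard σ (ρ.symm i)) (fibCard_congr σ _ σ' i π (fun a => by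
      rw [h, ← Equiv.eq_symm_apply])) (y (ρ.symm i))
  have hy := Λ.map_tensPerm ρ (X' := fun i => A (fibCard σ' i)) (fun i => eqToHom (congrArg A
    (fibCard_congr σ i σ' (ρ i) π (fun a => by simp [h])))) y y'
    (fun i => Λ.tr_index (A := A) y (ρ.symm_apply_apply i).symm
      (fibCard_congr σ i σ' (ρ i) π (fun a => by simp [h])) _)
  rw [Λ.map_comp, Λ.map_comp, Λ.map_tmul, hy, map_actHom, map_actHom]
  refine (b.actElt_mapComp Λ π σ x y).trans (Eq.trans ?_ (b.mapComp_actElt Λ σ' ρ x y').symm)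
  refine b.mapComp_congr Λ (fun a => ?_) x (fun i e => ?_)
  · rw [Equiv.eq_symm_apply, ← h, Equiv.apply_symm_apply]
  · have hc : fibCard σ i = fibCard (fun a => σ (π.symm a)) i :=
      fibCard_congr _ _ _ _ π (fun a => by simp)
    rw [b.actElt_cast Λ hc _ (fun a => by
      rw [fibEquiv_eq_finCongr _ _ _ _ _ _
        (fun a b ha hb hab => hπ a b (ha.trans hb.symm) hab) hc]
      rfl), EltFun.tr_tr, EltFun.tr_tr]
    exact Λ.tr_index (A := A) y (ρ.symm_apply_apply i).symm _ _

/-- The multiplication for a map can be computed from any factorisation of the map that starts with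
a bijection. -/
lemma whiskerLeft_mapMul_actHom {m n k : ℕ} (τ : Fin n → Fin k) (η : Fin m → Fin k)
    (σ : Fin n ≃ Fin m) (h : ∀ a, τ a = η (σ a)) :
    (A k ◁ tensMap k (fun i => b.actHom (fibEquiv τ i η i σ (fun a => by rw [h])))) ≫
      b.mapMul η ≫ b.actHom σ.symm = b.mapMul τ := by
  refine elt_ext_mul fun Λ x y => ?_
  rw [Λ.map_comp, Λ.map_whiskerLeft, Λ.map_tensMap, Λ.map_comp, map_actHom]
  refine (b.actElt_mapComp Λ σ.symm η x _).trans ?_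
  refine b.mapComp_congr Λ (fun a => (h a).symm) x (fun i e => ?_)
  rw [map_actHom, actElt_actElt, b.actElt_cast Λ e.symm _ (fun a => ?_), EltFun.tr_tr,
    EltFun.tr_rfl]
  have h1 := (fibEquiv_trans τ i η i (fun a => η (σ.symm.symm a)) i σ (fun a => by rw [h]) σ.symm
    (fun a => by simp) (Equiv.refl _) (fun a => by simp [h]) (fun a => by simp)).trans
    (fibEquiv_eq_finCongr _ _ _ _ _ _ (fun _ _ _ _ h => h) e.symm)
  exact congrArg (fun t => ((t a : Fin _) : ℕ)) h1

/-- The symmetric operad of an operad over all maps. -/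
def toSym : SymOperad V where
  coll := b.symColl
  str := b.restrict
  equivariance_base σ σ' π ρ h hπ := b.mapMul_actHom σ σ' π ρ h hπ
  equivariance_fib η η' σ σ' h :=
    (b.whiskerLeft_mapMul_actHom (fun a => η (σ a)) η σ (fun _ => rfl)).trans
      (b.whiskerLeft_mapMul_actHom (fun a => η (σ a)) η' σ' h).symm

/-- The multiplication of the symmetric operad for a map that need not preserve the order. -/
lemma toSym_mapMul {n k : ℕ} (τ : Fin n → Fin k) : b.toSym.mapMul τ = b.mapMul τ :=
  (b.toSym.mapMul_eq τ (SymOperad.nuPart τ) (SymOperad.nuPart_mono τ) (SymOperad.piPart τ)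
    (fun a => (SymOperad.nuPart_piPart τ a).symm)).trans
    (b.whiskerLeft_mapMul_actHom τ (SymOperad.nuPart τ) (SymOperad.piPart τ)
      (fun a => (SymOperad.nuPart_piPart τ a).symm))

end OperadStr

namespace SymOperad

lemma desStr_mapMul (A : SymOperad V) {n k : ℕ} (f : Fin n → Fin k) :
    (A.desStr FinAll).mapMul f = A.mapMul f := by
  change (A.ob k ◁ tensMap k (fun i => 𝟙 _)) ≫ A.mapMul f = A.mapMul f
  rw [tensMap_id, whiskerLeft_id, Category.id_comp]

end SymOperad

/-- An operad over all maps is recovered from its symmetric operad. -/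
lemma OperadStr.desStr_toSym : b.toSym.desStr FinAll = b := by
  have h1 : (b.toSym.desStr FinAll).unit = b.unit := Category.comp_id _
  have h2 : ∀ {T S : FinAll} (f : T ⟶ S), (b.toSym.desStr FinAll).mul f = b.mul f := fun f =>
    (b.toSym.desStr_mapMul f).trans (b.toSym_mapMul f)
  have ext : ∀ b' : OperadStr FinAll A, b'.unit = b.unit →
      (∀ {T S : FinAll} (f : T ⟶ S), b'.mul f = b.mul f) → b' = b := by
    rintro ⟨u, m, _, _, _⟩ rfl h
    obtain ⟨u, m', _, _, _⟩ := b
    obtain rfl : @m = @m' := funext fun T => funext fun S => funext fun f => h f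
    rfl
  exact ext _ h1 h2

variable {Λ} in
lemma OperadStr.IsHom.map_actElt {A B : FinAll → V} {a : OperadStr FinAll A}
    {b : OperadStr FinAll B} {h : ∀ T, A T ⟶ B T} (hh : a.IsHom b h) {n m : ℕ} (e : Fin n ≃ Fin m)
    (x : Λ.obj (A n)) : Λ.map (h m) (a.actElt Λ e x) = b.actElt Λ e (Λ.map (h n) x) := by
  refine (hh.map_comp Λ (T := (m : FinAll)) (S := (n : FinAll)) e.symm x _).trans ?_
  refine congrArg (b.mapComp Λ e.symm (Λ.map (h n) x)) (funext fun i => ?_)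
  exact (Λ.map_tr h _ _).trans (congrArg _ (hh.map_one Λ))

namespace SymOperad

/-- The action of the bijections is determined by the multiplication for maps that need not
preserve the order. -/
lemma actHom_desStr (A : SymOperad V) {n m : ℕ} (e : Fin n ≃ Fin m) :
    (A.desStr FinAll).actHom e = A.act e := by
  refine elt_ext_leaf (A := A.ob n) (C := A.ob m) fun Λ x => ?_
  refine ((A.desStr FinAll).map_actHom Λ e x).trans ?_
  change Λ.mul ((A.desStr FinAll).mapMul e.symm) x _ = _
  rw [desStr_mapMul, A.mapMul_eq e.symm (fun a => a) monotone_id e.symm (fun _ => rfl), EltFun.mul,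
    Λ.map_comp, Λ.map_comp, Λ.map_whiskerLeft, Λ.map_tensMap]
  refine (congrArg (Λ.map (A.act e)) ?_ : Λ.map (A.act e) _ = Λ.map (A.act e) x)
  refine Eq.trans ?_ (A.str.comp_id Λ ⟨n⟩ x)
  refine congrArg (fun t => Λ.map (A.monoMul (fun a : Fin n => a) monotone_id)
    (Λ.tmul x (Λ.tens n t))) (funext fun i => ?_)
  have hc : fibCard e.symm i = fibCard (fun a => a) i :=
    (fibCard_equiv _ _).trans (fibCard_id i).symm
  have h1 : fibEquiv e.symm i (fun a => a) i e.symm (fun a => Iff.rfl) = finCongr hc :=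
    Equiv.ext fun a => Fin.ext (by
      have h2 := (fibEquiv e.symm i (fun a => a) i e.symm (fun a => Iff.rfl) a).2.trans_eq
        (fibCard_id i)
      have h3 := (finCongr hc a).2.trans_eq (fibCard_id i)
      omega)
  rw [h1, act_finCongr]
  refine (Λ.tr_tr (A := A.ob) _ hc _).trans ?_
  have h4 : (A.desStr FinAll).one Λ = A.str.one Λ :=
    congrArg (fun t => Λ.map t Λ.one) (Category.comp_id A.str.unit)
  rw [h4]
  rfl

variable (V)

/-- The functor from symmetric operads to operads over all maps of finite ordinals. -/
abbrev toAll : SymOperad V ⥤ Operad V FinAll := des V FinAll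

instance : (toAll V).Faithful where
  map_injective {A B} f g h := Hom.ext (NatTrans.ext (funext fun a =>
    congrFun (congrArg Operad.Hom.app h) a.len))

instance : (toAll V).Full where
  map_surjective {A B} h := by
    have hh : (A.desStr FinAll).IsHom (B.desStr FinAll) (Operad.Hom.app h) := Operad.Hom.isHom h
    refine ⟨(⟨{ app := fun a => Operad.Hom.app h a.len
                naturality := fun {a a'} e => ?_ }, ⟨?_, fun {T S} f => ?_⟩⟩ : Hom A B), rfl⟩
    · refine elt_ext_leaf (A := A.ob a.len) (C := B.ob a'.len) fun Λ x => ?_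
      refine (Λ.map_comp (A.act e) (Operad.Hom.app h a'.len) x).trans (Eq.trans ?_
        (Λ.map_comp (Operad.Hom.app h a.len) (B.act e) x).symm)
      rw [← actHom_desStr, ← actHom_desStr]
      refine (congrArg _ ((A.desStr FinAll).map_actHom Λ e x)).trans ?_
      exact (hh.map_actElt e x).trans ((B.desStr FinAll).map_actHom Λ e _).symm
    · have h1 := hh.unit
      exact (congrArg (fun t => t ≫ Operad.Hom.app h (1 : ℕ))
        (Category.comp_id A.str.unit).symm).trans (h1.trans (Category.comp_id _))
    · have h1 := hh.mul (T := (T.len : FinAll)) (S := (S.len : FinAll)) (tips f)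
      have hf : Monotone (tips f) := OrderHom.monotone (show Fin T.len →o Fin S.len from f)
      have h2 : ∀ A : SymOperad V, (A.desStr FinAll).mul (T := (T.len : FinAll))
          (S := (S.len : FinAll)) (tips f) = A.str.mul f := fun A =>
        (A.desStr_mapMul (tips f)).trans (A.mapMul_mono (tips f) hf)
      rw [h2, h2] at h1
      exact h1

instance : (toAll V).EssSurj where
  mem_essImage B := ⟨B.str.toSym, ⟨eqToIso
    (congrArg (fun b => (⟨B.obj, b⟩ : Operad V FinAll)) B.str.desStr_toSym)⟩⟩

instance : (toAll V).IsEquivalence where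

lemma isReflexivePair_toAll {A B : SymOperad V} (f g : A ⟶ B) [IsReflexivePair f g] :
    IsReflexivePair ((toAll V).map f) ((toAll V).map g) := by
  obtain ⟨s, hs, hs'⟩ := IsReflexivePair.common_section f g
  exact .mk' ((toAll V).map s) (by rw [← Functor.map_comp, hs, CategoryTheory.Functor.map_id])
    (by rw [← Functor.map_comp, hs', CategoryTheory.Functor.map_id])

variable [HasColimits V] [∀ X : V, PreservesColimits (tensorLeft X)]

instance : HasReflexiveCoequalizers (SymOperad V) where
  has_coeq A B f g _ := by
    have := isReflexivePair_toAll V f g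
    have h : HasCoequalizer ((toAll V).map f) ((toAll V).map g) := inferInstance
    have : HasColimit (parallelPair f g ⋙ toAll V) :=
      @hasColimit_of_iso _ _ _ _ _ _ h (diagramIsoParallelPair (parallelPair f g ⋙ toAll V))
    exact hasColimit_of_created (parallelPair f g) (toAll V)

instance : (forgetInf V).ReflectsIsomorphisms :=
  inferInstanceAs (toAll V ⋙ Operad.forget V FinAll).ReflectsIsomorphisms

instance : Monad.PreservesColimitOfIsReflexivePair (forgetInf V) where
  out A B f g _ := by
    have := isReflexivePair_toAll V f g
    have h : PreservesColimit (parallelPair ((toAll V).map f) ((toAll V).map g))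
      (Operad.forget V FinAll) := inferInstance
    have : PreservesColimit (parallelPair f g ⋙ toAll V) (Operad.forget V FinAll) :=
      @preservesColimit_of_iso_diagram _ _ _ _ _ _ _ _ (Operad.forget V FinAll)
        (diagramIsoParallelPair (parallelPair f g ⋙ toAll V)).symm h
    exact inferInstanceAs (PreservesColimit (parallelPair f g) (toAll V ⋙ Operad.forget V FinAll))

/-- The forgetful functor from symmetric operads factors through the equivalence with operads over
all maps, for which free operads have been constructed. -/
lemma isRightAdjoint_forgetInf : (forgetInf V).IsRightAdjoint :=
  have := Free.isRightAdjoint_forget FinAll V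
  inferInstanceAs (toAll V ⋙ Operad.forget V FinAll).IsRightAdjoint

/-- Symmetric operads are monadic over nonsymmetric collections. -/
noncomputable abbrev monadicForgetInf : MonadicRightAdjoint (forgetInf V) :=
  have := isRightAdjoint_forgetInf V
  Monad.monadicOfHasPreservesReflexiveCoequalizersOfReflectsIsomorphisms
    (Adjunction.ofIsRightAdjoint (forgetInf V))

end SymOperad

end FinAll

/-! ### Symmetrisation and the right action -/

section Symmetrisation

variable (n : ℕ) (V : Type u) [Category.{v} V] [MonoidalCategory V] [SymmetricCategory V]

lemma des_forget : Des n V ⋙ forgetN n V = forgetInf V ⋙ collW n V := rfl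

variable [HasColimits V]

section

variable [∀ X : V, PreservesColimits (tensorLeft X)]

/-- Adjoint lifting along the monadic functor `forgetN`: the composite of `Des` with it is
`forgetInf ⋙ collW`, which has a left adjoint, and symmetric operads have reflexive coequalizers. -/
lemma isRightAdjoint_des : (Des n V).IsRightAdjoint := by
  have := Operad.monadicForget V (LevelTree n)
  have := SymOperad.isRightAdjoint_forgetInf V
  have : (collW n V).IsRightAdjoint := (adjCollCW n V).isRightAdjoint
  have : (Des n V ⋙ forgetN n V).IsRightAdjoint :=
    inferInstanceAs (forgetInf V ⋙ collW n V).IsRightAdjoint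
  exact isRightAdjoint_triangle_lift_monadic (forgetN n V)

end

variable {n V} {Finf : (ℕ → V) ⥤ SymOperad V} (adjInf : Finf ⊣ forgetInf V)
  {F : (LevelTree n → V) ⥤ NOperad n V} (adj : F ⊣ forgetN n V)

/-- The map from the free operad is the transpose of the unit of `collC ⋙ Finf`. -/
lemma homEquiv_freeToDes (X : LevelTree n → V) :
    adj.homEquiv _ _ (freeToDes adjInf adj X) = ((adjCollCW n V).comp adjInf).unit.app X :=
  (Equiv.apply_symm_apply _ _).trans (Category.comp_id _)

/-- The right action is the transpose of the map of collections underlying `freeToDes`. -/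
lemma homEquiv_rightAction (X : LevelTree n → V) :
    ((adjCollCW n V).comp adjInf).homEquiv _ _ ((rightAction adjInf adj).app X) =
      (forgetN n V).map (freeToDes adjInf adj X) :=
  (Equiv.apply_symm_apply _ _).trans (Category.comp_id _)

/-- The map from the free operad to the desymmetrisation is compatible with the counit and the
right action. -/
lemma counit_freeToDes (X : LevelTree n → V) :
    adj.counit.app (F.obj X) ≫ freeToDes adjInf adj X =
      freeToDes adjInf adj ((forgetN n V).obj (F.obj X)) ≫
        (Des n V).map ((rightAction adjInf adj).app X) := by
  apply (adj.homEquiv _ _).injective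
  rw [Adjunction.homEquiv_naturality_right, Adjunction.homEquiv_naturality_right,
    homEquiv_freeToDes, adj.homEquiv_unit, adj.right_triangle_components, Category.id_comp]
  refine (homEquiv_rightAction adjInf adj X).symm.trans ?_
  rw [Adjunction.homEquiv_unit]
  rfl

/-- The unit law of the right action: both sides have the unit of `collC ⋙ Finf` as transpose. -/
lemma unit_rightAction (X : LevelTree n → V) :
    (collC n V ⋙ Finf).map (adj.unit.app X) ≫ (rightAction adjInf adj).app X = 𝟙 _ := by
  apply (((adjCollCW n V).comp adjInf).homEquiv _ _).injective
  rw [Adjunction.homEquiv_naturality_left, homEquiv_rightAction]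
  refine Eq.trans ?_ ((homEquiv_freeToDes adjInf adj X).trans ?_)
  · rw [Adjunction.homEquiv_unit]
    rfl
  · exact (((adjCollCW n V).comp adjInf).homEquiv_id X).symm

/-- The associativity law of the right action, which is the transpose of `counit_freeToDes`. -/
lemma counit_rightAction (X : LevelTree n → V) :
    (collC n V ⋙ Finf).map ((forgetN n V).map (adj.counit.app (F.obj X))) ≫
        (rightAction adjInf adj).app X =
      (rightAction adjInf adj).app ((forgetN n V).obj (F.obj X)) ≫
        (rightAction adjInf adj).app X := by
  apply (((adjCollCW n V).comp adjInf).homEquiv _ _).injective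
  refine (Adjunction.homEquiv_naturality_left _ _ _).trans ((congrArg (fun t =>
    (forgetN n V).map (adj.counit.app (F.obj X)) ≫ t) (homEquiv_rightAction adjInf adj X)).trans ?_)
  refine Eq.trans ?_ (Adjunction.homEquiv_naturality_right _ _ _).symm
  refine Eq.trans ?_ (congrArg (fun t => t ≫ (forgetInf V ⋙ collW n V).map
    ((rightAction adjInf adj).app X)) (homEquiv_rightAction adjInf adj _).symm)
  have h := congrArg (forgetN n V).map (counit_freeToDes adjInf adj X)
  rw [Functor.map_comp, Functor.map_comp] at h
  exact h

lemma isRightAction_rightAction :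
    IsRightAction adj.toMonad (collC n V ⋙ Finf) (rightAction adjInf adj) where
  unit X := unit_rightAction adjInf adj X
  assoc X := counit_rightAction adjInf adj X

end Symmetrisation

/-! ### Operads of sets -/

section Sets

/-- In the category of sets, generalised elements are elements. -/
abbrev setElt : EltFun (Type w) where
  obj A := A
  map f a := f a
  map_id _ := rfl
  map_comp _ _ _ := rfl
  one := PUnit.unit
  tmul a b := (a, b)
  map_tmul _ _ _ _ := rfl
  map_assoc _ _ _ := rfl
  map_left _ := rfl
  map_right _ := rfl
  map_braid _ _ := rfl

/-- The components of an element of an iterated product of sets. -/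
def untens : (k : ℕ) → {X : Fin k → Type w} → tens k X → ∀ i, X i
  | 0, _, _ => fun i => i.elim0
  | k + 1, X, e => Fin.cases (motive := X) (e : X 0 × tens k (fun i => X i.succ)).1
      (untens k (e : X 0 × tens k (fun i => X i.succ)).2)

lemma tens_untens (k : ℕ) {X : Fin k → Type w} (e : tens k X) :
    setElt.tens k (untens k e) = e := by
  induction k with
  | zero => rfl
  | succ k ih => exact Prod.ext rfl (ih (X := fun i => X i.succ) _)

lemma untens_tens (k : ℕ) {X : Fin k → Type w} (x : ∀ i, X i) :
    untens k (setElt.tens k x) = x := by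
  induction k with
  | zero => exact funext fun i => i.elim0
  | succ k ih =>
    funext i
    cases i using Fin.cases with
    | zero => rfl
    | succ i => exact congrFun (ih (fun i => x i.succ)) i

variable {O : Type} [FibredCategory O]

/-- The unit of an operad of sets. -/
abbrev OperadStr.sone {A : O → Type w} (a : OperadStr O A) : A U := a.one setElt

/-- The multiplication of an operad of sets. -/
abbrev OperadStr.scomp {A : O → Type w} (a : OperadStr O A) {T S : O} (σ : T ⟶ S) (x : A S)
    (y : ∀ i, A (fib σ i)) : A T := a.comp setElt σ x y

/-- The elements of the free operad on a collection of sets: trees labelled by generators. -/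
inductive FTree (X : O → Type w) : O → Type w
  | unit {T : O} (h : T = U) : FTree X T
  | node {T S : O} (σ : T ⟶ S) (x : X S) (c : ∀ i, FTree X (fib σ i)) : FTree X T

namespace FTree

variable {X Y Z : O → Type w}

/-- Relabelling. -/
def map (f : ∀ T, X T → Y T) : {T : O} → FTree X T → FTree Y T
  | _, .unit h => .unit h
  | _, .node σ x c => .node σ (f _ x) (fun i => map f (c i))

/-- The value of a labelled tree in an operad. -/
def eval {A : O → Type w} (a : OperadStr O A) (g : ∀ T, X T → A T) : {T : O} → FTree X T → A T
  | _, .unit h => setElt.tr A h.symm a.sone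
  | _, .node σ x c => a.scomp σ (g _ x) (fun i => eval a g (c i))

variable {A B : O → Type w} {a : OperadStr O A} {b : OperadStr O B}

lemma eval_map (f : ∀ T, X T → Y T) (g : ∀ T, Y T → A T) {T : O} (t : FTree X T) :
    eval a g (map f t) = eval a (fun T x => g T (f T x)) t := by
  induction t with
  | unit h => rfl
  | node σ x c ih => exact congrArg (a.scomp σ _) (funext ih)

lemma map_map (f : ∀ T, X T → Y T) (g : ∀ T, Y T → Z T) {T : O} (t : FTree X T) :
    map g (map f t) = map (fun T x => g T (f T x)) t := by
  induction t with
  | unit h => rfl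
  | node σ x c ih => exact congrArg (node σ _) (funext ih)

lemma hom_eval {u : ∀ T, A T ⟶ B T} (hu : a.IsHom b u) (g : ∀ T, X T → A T) {T : O}
    (t : FTree X T) : u T (eval a g t) = eval b (fun T x => u T (g T x)) t := by
  induction t with
  | unit h => exact (setElt.map_tr u _ _).trans (congrArg (setElt.tr B h.symm) (hu.map_one setElt))
  | node σ x c ih =>
    exact (hu.map_comp setElt σ _ _).trans (congrArg (b.scomp σ _) (funext ih))

lemma node_inj {T S : O} {σ : T ⟶ S} {x x' : X S} {c c' : ∀ i, FTree X (fib σ i)}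
    (h : node σ x c = node σ x' c') : x = x' ∧ c = c' := by
  cases h
  exact ⟨rfl, rfl⟩

end FTree

/-- An operad of sets is free on a map from a collection of generators if each of its elements is
the value of a unique labelled tree. -/
def OperadStr.IsFree {X A : O → Type w} (a : OperadStr O A) (g : ∀ T, X T → A T) : Prop :=
  ∀ T, Function.Bijective (fun t : FTree X T => FTree.eval a g t)

lemma OperadStr.IsFree.of_bijective {X A B : O → Type w} {a : OperadStr O A} {b : OperadStr O B}
    {g : ∀ T, X T → A T} (h : a.IsFree g) {u : ∀ T, A T ⟶ B T} (hu : a.IsHom b u)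
    (hb : ∀ T, Function.Bijective (u T)) {g' : ∀ T, X T → B T} (hg : ∀ T x, u T (g T x) = g' T x) :
    b.IsFree g' := fun T => by
  obtain rfl : (fun T x => u T (g T x)) = g' := funext fun T => funext fun x => hg T x
  have h1 := (hb T).comp (h T)
  rwa [show (u T ∘ fun t : FTree X T => FTree.eval a g t) = _ from
    funext fun t => FTree.hom_eval hu g t] at h1

/-- A commutative square of sets that is a pullback. -/
structure IsPb {P A B D : Type w} (t : P → A) (l : P → B) (r : A → D) (b : B → D) : Prop where
  comm (x : P) : r (t x) = b (l x)
  inj (x y : P) : t x = t y → l x = l y → x = y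
  ex (x : A) (y : B) : r x = b y → ∃ p, t p = x ∧ l p = y

lemma IsPb.paste {P A B D A' D' : Type w} {t : P → A} {l : P → B} {r : A → D} {b : B → D}
    {t' : A → A'} {r' : A' → D'} {b' : D → D'} (h : IsPb t l r b) (h' : IsPb t' r r' b') :
    IsPb (fun x => t' (t x)) l r' (fun y => b' (b y)) where
  comm x := by rw [h'.comm, h.comm]
  inj x y hx hy := h.inj x y (h'.inj _ _ hx (by rw [h.comm, h.comm, hy])) hy
  ex x y hxy := by
    obtain ⟨p, rfl, hp⟩ := h'.ex _ _ hxy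
    obtain ⟨q, rfl, rfl⟩ := h.ex _ _ hp
    exact ⟨q, rfl, rfl⟩

lemma IsPb.congr {P A B D : Type w} {t : P → A} {l l' : P → B} {r r' : A → D} {b : B → D}
    (h : IsPb t l r b) (hl : ∀ x, l' x = l x) (hr : ∀ x, r' x = r x) : IsPb t l' r' b := by
  obtain rfl := funext hl
  obtain rfl := funext hr
  exact h

lemma IsPb.symm {P A B D : Type w} {t : P → A} {l : P → B} {r : A → D} {b : B → D}
    (h : IsPb t l r b) : IsPb l t b r where
  comm x := (h.comm x).symm
  inj x y hx hy := h.inj x y hy hx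
  ex x y hxy := by
    obtain ⟨p, hp, hq⟩ := h.ex y x hxy.symm
    exact ⟨p, hq, hp⟩

/-- A map of operads of sets is cartesian if the naturality squares of the units and of the
multiplications are pullbacks: a decomposition of the image of an element lifts uniquely to a
decomposition of the element. -/
structure OperadStr.IsCart {A B : O → Type w} (a : OperadStr O A) (b : OperadStr O B)
    (u : ∀ T, A T ⟶ B T) : Prop where
  isHom : a.IsHom b u
  one (z : A U) : u U z = b.sone → z = a.sone
  exists_comp {T S : O} (σ : T ⟶ S) (z : A T) (x : B S) (y : ∀ i, B (fib σ i)) :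
    u T z = b.scomp σ x y → ∃ p q, a.scomp σ p q = z ∧ u S p = x ∧ ∀ i, u _ (q i) = y i
  comp_inj {T S : O} (σ : T ⟶ S) (x x' : A S) (y y' : ∀ i, A (fib σ i)) :
    a.scomp σ x y = a.scomp σ x' y' → u S x = u S x' → (∀ i, u _ (y i) = u _ (y' i)) →
      x = x' ∧ y = y'

/-- If the square on generators is a pullback, then so is the square on labelled trees over a
cartesian map of operads. -/
lemma FTree.isPb {X' X A B : O → Type w} {a : OperadStr O A} {b : OperadStr O B}
    {u : ∀ T, A T ⟶ B T} (hu : a.IsCart b u) {f : ∀ T, X' T → X T} {g' : ∀ T, X' T → A T}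
    {g : ∀ T, X T → B T} (h : ∀ T, IsPb (f T) (g' T) (g T) (u T)) (T : O) :
    IsPb (FTree.map f (T := T)) (FTree.eval a g') (FTree.eval b g) (u T) where
  comm t := by
    rw [hom_eval hu.isHom, eval_map]
    congr 1
    exact funext fun T => funext fun x => (h T).comm x
  inj t t' := by
    intro h1 h2
    induction t with
    | unit e =>
      cases t' with
      | unit => rfl
      | node => cases h1
    | @node T S σ x c ih =>
      cases t' with
      | unit => cases h1
      | @node _ S' σ' x' c' =>
        have h3 : S = S' := by
          injection h1
        subst h3
        obtain rfl : σ = σ' := by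
          injection h1 with _ _ h4
        obtain ⟨hx, hc⟩ := node_inj h1
        have hc' : ∀ i, map f (c i) = map f (c' i) := congrFun hc
        have key := hu.comp_inj σ (g' _ x) (g' _ x') (fun i => eval a g' (c i))
          (fun i => eval a g' (c' i)) h2 (by rw [← (h _).comm, ← (h _).comm, hx]) (fun i => by
            rw [hom_eval hu.isHom, hom_eval hu.isHom]
            have := congrArg (eval b g) (hc' i)
            rw [eval_map, eval_map] at this
            simpa only [(h _).comm] using this)
        obtain rfl := (h _).inj _ _ hx key.1
        obtain rfl : c = c' := funext fun i => ih i _ (hc' i) (congrFun key.2 i)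
        rfl
  ex t z := by
    intro hz
    induction t with
    | @unit T e =>
      subst e
      refine ⟨.unit rfl, rfl, ?_⟩
      rw [hu.one z (hz.symm.trans (setElt.tr_rfl _ _))]
      exact setElt.tr_rfl _ _
    | @node T S σ x c ih =>
      obtain ⟨p, q, rfl, hp, hq⟩ := hu.exists_comp σ z _ _ hz.symm
      obtain ⟨x', rfl, rfl⟩ := (h _).ex _ _ hp.symm
      choose c' hc hc' using fun i => ih i (q i) (hq i).symm
      exact ⟨.node σ x' c', congrArg (node σ _) (funext hc), congrArg (a.scomp σ _) (funext hc')⟩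

/-- If two operads are free, then a square of operad maps with a cartesian map on one side is a
pullback if its restriction to the generators is one. -/
lemma OperadStr.IsFree.isPb {X' X C' C A B : O → Type w} {c' : OperadStr O C'} {c : OperadStr O C}
    {a : OperadStr O A} {b : OperadStr O B} {γ' : ∀ T, X' T → C' T} {γ : ∀ T, X T → C T}
    (hc' : c'.IsFree γ') (hc : c.IsFree γ) {u : ∀ T, A T ⟶ B T} (hu : a.IsCart b u)
    {φ : ∀ T, C' T ⟶ C T} (hφ : c'.IsHom c φ) {ψ' : ∀ T, C' T ⟶ A T} (hψ' : c'.IsHom a ψ')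
    {ψ : ∀ T, C T ⟶ B T} (hψ : c.IsHom b ψ) {f : ∀ T, X' T → X T}
    (hf : ∀ T x, φ T (γ' T x) = γ T (f T x))
    (h : ∀ T, IsPb (f T) (fun x => ψ' T (γ' T x)) (fun x => ψ T (γ T x)) (u T)) (T : O) :
    IsPb (φ T) (ψ' T) (ψ T) (u T) := by
  have key := FTree.isPb hu h T
  have h1 : ∀ t, φ T (FTree.eval c' γ' t) = FTree.eval c γ (FTree.map f t) := fun t => by
    rw [FTree.hom_eval hφ, FTree.eval_map]
    simp only [hf]
  have h2 : ∀ t, ψ' T (FTree.eval c' γ' t) = FTree.eval a (fun T x => ψ' T (γ' T x)) t :=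
    fun t => FTree.hom_eval hψ' γ' t
  have h3 : ∀ t, ψ T (FTree.eval c γ t) = FTree.eval b (fun T x => ψ T (γ T x)) t :=
    fun t => FTree.hom_eval hψ γ t
  constructor
  · intro x
    obtain ⟨t, rfl⟩ := (hc' T).2 x
    dsimp only
    rw [h1, h2, h3]
    exact key.comm t
  · intro x y
    obtain ⟨t, rfl⟩ := (hc' T).2 x
    obtain ⟨s, rfl⟩ := (hc' T).2 y
    dsimp only
    rw [h1, h1, h2, h2]
    intro e e'
    rw [key.inj t s ((hc T).1 e) e']
  · intro x y
    obtain ⟨t, rfl⟩ := (hc T).2 x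
    dsimp only
    rw [h3]
    intro e
    obtain ⟨p, rfl, rfl⟩ := key.ex t y e
    exact ⟨FTree.eval c' γ' p, h1 p, h2 p⟩

end Sets

/-! ### Maps between free operads of sets are cartesian -/

section

variable {O : Type} {A B : O → Type w}

lemma tr_injective {T T' : O} (h : T = T') :
    Function.Injective (fun x : A T => (setElt.tr A h x : A T')) := by
  subst h
  intro x y hxy
  simpa using hxy

lemma apply_tr (u : ∀ T, A T ⟶ B T) {T T' : O} (h : T = T') (x : A T) :
    u T' (setElt.tr A h x) = setElt.tr B h (u T x) :=
  setElt.map_tr u h x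

/-- A dependent family indexed by a disjoint union can be reindexed along a bijection. -/
lemma exists_of_bijective {I : Type} {m : I → ℕ} {l : ℕ} {φ : ∀ i, Fin (m i) → Fin l}
    (h : Function.Bijective (fun p : Σ i, Fin (m i) => φ p.1 p.2)) {D : Fin l → Type w}
    (r : ∀ i j, D (φ i j)) : ∃ q : ∀ s, D s, ∀ i j, q (φ i j) = r i j := by
  choose p hp using h.2
  refine ⟨fun s => cast (congrArg D (hp s)) (r (p s).1 (p s).2), fun i j => ?_⟩
  have h1 : p (φ i j) = ⟨i, j⟩ := h.1 (hp (φ i j))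
  refine eq_of_heq ((cast_heq _ _).trans ?_)
  rw [h1]

end

section

variable {O : Type} [FibredCategory O]

lemma OperadStr.scomp_assoc {A : O → Type w} (a : OperadStr O A) {T S R : O} (f : T ⟶ S) (g : S ⟶ R)
    (x : A R) (y : ∀ i, A (fib g i)) (z : ∀ s, A (fib f s)) :
    a.scomp f (a.scomp g x y) z = a.scomp (f ≫ g) x (fun i => a.scomp (fibMor f g i) (y i)
      (fun j => setElt.tr A (fib_fibMor f g i j).symm (z (fibTip g i j)))) :=
  a.comp_assoc setElt f g x y z

/-- The unit law of an operad of sets, for any map to an object equal to `U`. -/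
lemma OperadStr.scomp_one [Levelled O] {A : O → Type w} (a : OperadStr O A) {T S : O} (h : S = U)
    (σ : T ⟶ S) (c : ∀ s, A (fib σ s)) (s : Fin (card S)) :
    a.scomp σ (setElt.tr A h.symm a.sone) c = setElt.tr A (Free.fib_eq_of_U h σ s) (c s) :=
  a.comp_one setElt h σ c s

namespace OperadStr.IsFree

variable {X' X A B : O → Type w} {a : OperadStr O A} {b : OperadStr O B}
  {γ' : ∀ T, X' T → A T} {γ : ∀ T, X T → B T} {u : ∀ T, A T ⟶ B T} {f : ∀ T, X' T → X T}

/-- A map of free operads that is induced by a map of generators reflects the unit. -/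
lemma eq_one (ha : a.IsFree γ') (hb : b.IsFree γ) (hu : a.IsHom b u)
    (hf : ∀ T x, u T (γ' T x) = γ T (f T x)) {T : O} (h : T = U) (z : A T)
    (hz : u T z = setElt.tr B h.symm b.sone) : z = setElt.tr A h.symm a.sone := by
  obtain ⟨t, rfl⟩ := (ha T).2 z
  dsimp only at hz
  rw [FTree.hom_eval hu] at hz
  simp only [hf] at hz
  rw [← FTree.eval_map] at hz
  have h1 := (hb T).1 (a₁ := FTree.map f t) (a₂ := .unit h) hz
  cases t with
  | unit => rfl
  | node => cases h1

/-- In a free operad, an outermost generator and the elements composed into it are determined by the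
composite. -/
lemma gen_inj (ha : a.IsFree γ') {T S : O} (σ : T ⟶ S) {x x' : X' S} {y y' : ∀ i, A (fib σ i)}
    (h : a.scomp σ (γ' S x) y = a.scomp σ (γ' S x') y') : x = x' ∧ y = y' := by
  choose t ht using fun i => (ha _).2 (y i)
  choose t' ht' using fun i => (ha _).2 (y' i)
  obtain rfl := funext ht
  obtain rfl := funext ht'
  obtain ⟨h1, h2⟩ := FTree.node_inj ((ha T).1 (show FTree.eval a γ' (.node σ x t) =
    FTree.eval a γ' (.node σ x' t') from h))
  subst h1 h2
  exact ⟨rfl, rfl⟩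

/-- A decomposition of the image of an element with a generator outermost lifts to the element. -/
lemma exists_gen (ha : a.IsFree γ') (hb : b.IsFree γ) (hu : a.IsHom b u)
    (hf : ∀ T x, u T (γ' T x) = γ T (f T x)) {T S : O} (σ : T ⟶ S) (z : A T) (x : X S)
    (y : ∀ i, B (fib σ i)) (hz : u T z = b.scomp σ (γ S x) y) :
    ∃ x' y', a.scomp σ (γ' S x') y' = z ∧ f S x' = x ∧ ∀ i, u _ (y' i) = y i := by
  obtain ⟨t, rfl⟩ := (ha T).2 z
  choose s hs using fun i => (hb _).2 (y i)
  obtain rfl := funext hs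
  dsimp only at hz
  rw [FTree.hom_eval hu] at hz
  simp only [hf] at hz
  rw [← FTree.eval_map] at hz
  have h1 := (hb T).1 (a₁ := FTree.map f t) (a₂ := .node σ x s) hz
  cases t with
  | unit => cases h1
  | @node _ S' σ' x' c =>
    obtain rfl : S' = S := by injection h1
    obtain rfl : σ' = σ := by injection h1
    obtain ⟨hx, rfl⟩ := FTree.node_inj h1
    refine ⟨x', fun i => FTree.eval a γ' (c i), rfl, hx, fun i => ?_⟩
    dsimp only
    rw [FTree.hom_eval hu, FTree.eval_map]
    simp only [hf]

variable [Levelled O]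

/-- Any decomposition of the image of an element lifts to the element. The induction is on the
labelled tree `t` of the outer element: its outermost generator is lifted by `exists_gen`, and the
rest by the induction hypothesis for the maps of fibres. -/
lemma exists_scomp (ha : a.IsFree γ') (hb : b.IsFree γ) (hu : a.IsHom b u)
    (hf : ∀ T x, u T (γ' T x) = γ T (f T x)) {S : O} (t : FTree X S) {T : O} (σ : T ⟶ S) (z : A T)
    (y : ∀ i, B (fib σ i)) (hz : u T z = b.scomp σ (FTree.eval b γ t) y) :
    ∃ p q, a.scomp σ p q = z ∧ u S p = FTree.eval b γ t ∧ ∀ i, u _ (q i) = y i := by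
  induction t generalizing T with
  | @unit S h =>
    refine ⟨setElt.tr A h.symm a.sone,
      fun i => setElt.tr A (Free.fib_eq_of_U h σ i).symm z, ?_, ?_, fun i => ?_⟩
    · subst h
      rw [a.scomp_one rfl σ _ (Fin.cast card_U.symm 0), EltFun.tr_tr, EltFun.tr_rfl]
    · rw [apply_tr]
      exact congrArg (setElt.tr B h.symm) (hu.map_one setElt)
    · dsimp only
      rw [apply_tr, hz]
      change setElt.tr B _ (b.scomp σ (setElt.tr B h.symm b.sone) y) = _
      rw [b.scomp_one h σ y i, EltFun.tr_tr, EltFun.tr_rfl]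
  | @node S R ω x c ih =>
    change u T z = b.scomp σ (b.scomp ω (γ R x) _) y at hz
    rw [b.scomp_assoc] at hz
    obtain ⟨x', w, rfl, rfl, hw⟩ := exists_gen ha hb hu hf _ z x _ hz
    choose p q hpq hp hq using fun i => ih i (fibMor σ ω i) (w i) _ (hw i)
    have e : ∀ i j, fib (fibMor σ ω i) j = fib σ (fibTip ω i j) := fun i j => fib_fibMor σ ω i j
    obtain ⟨r, hr⟩ := exists_of_bijective (fibTip_bijective ω) (D := fun s => A (fib σ s))
      (fun i j => setElt.tr A (e i j) (q i j))
    refine ⟨a.scomp ω (γ' R x') p, r, ?_, ?_, fun s => ?_⟩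
    · rw [a.scomp_assoc]
      congr 1
      funext i
      rw [← hpq i]
      congr 1
      funext j
      rw [hr]
      exact (setElt.tr_tr _ _ _).trans (setElt.tr_rfl _ _)
    · refine (hu.map_comp setElt ω _ _).trans ?_
      change b.scomp ω (u _ (γ' R x')) (fun i => u _ (p i)) = b.scomp ω _ _
      rw [hf]
      simp only [hp]
    · obtain ⟨⟨i, j⟩, rfl⟩ := (fibTip_bijective ω).2 s
      dsimp only
      rw [hr, apply_tr, hq]
      exact (setElt.tr_tr _ _ _).trans (setElt.tr_rfl _ _)

/-- The lift of a decomposition is unique. The induction is on the labelled tree `t` of the image of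
the outer element. -/
lemma scomp_inj (ha : a.IsFree γ') (hb : b.IsFree γ) (hu : a.IsHom b u)
    (hf : ∀ T x, u T (γ' T x) = γ T (f T x)) {S : O} (t : FTree X S) {T : O} (σ : T ⟶ S)
    (x x' : A S) (y y' : ∀ i, A (fib σ i)) (hx : u S x = FTree.eval b γ t)
    (hx' : u S x' = FTree.eval b γ t) (h : a.scomp σ x y = a.scomp σ x' y')
    (hy : ∀ i, u _ (y i) = u _ (y' i)) : x = x' ∧ y = y' := by
  induction t generalizing T with
  | @unit S e =>
    obtain rfl := eq_one ha hb hu hf e x hx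
    obtain rfl := eq_one ha hb hu hf e x' hx'
    refine ⟨rfl, funext fun i => tr_injective (Free.fib_eq_of_U e σ i) ?_⟩
    rwa [a.scomp_one e σ y i, a.scomp_one e σ y' i] at h
  | @node S R ω g c ih =>
    obtain ⟨g₁, e₁, rfl, hg₁, he₁⟩ := exists_gen ha hb hu hf ω x g _ hx
    obtain ⟨g₂, e₂, rfl, hg₂, he₂⟩ := exists_gen ha hb hu hf ω x' g _ hx'
    rw [a.scomp_assoc, a.scomp_assoc] at h
    obtain ⟨rfl, h2⟩ := gen_inj ha _ h
    have h3 := fun i => ih i (fibMor σ ω i) (e₁ i) (e₂ i) _ _ (he₁ i) (he₂ i) (congrFun h2 i)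
      (fun j => (apply_tr u _ _).trans ((congrArg (setElt.tr B _) (hy (fibTip ω i j))).trans
        (apply_tr u _ _).symm))
    obtain rfl : e₁ = e₂ := funext fun i => (h3 i).1
    refine ⟨rfl, funext fun s => ?_⟩
    obtain ⟨⟨i, j⟩, rfl⟩ := (fibTip_bijective ω).2 s
    exact tr_injective _ (congrFun (h3 i).2 j)

/-- A map between free operads of sets that is induced by a map of generators is cartesian. -/
lemma isCart (ha : a.IsFree γ') (hb : b.IsFree γ) (hu : a.IsHom b u)
    (hf : ∀ T x, u T (γ' T x) = γ T (f T x)) : a.IsCart b u where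
  isHom := hu
  one z hz := (eq_one ha hb hu hf rfl z (hz.trans (setElt.tr_rfl _ _).symm)).trans
    (setElt.tr_rfl _ _)
  exists_comp σ z x y h := by
    obtain ⟨t, rfl⟩ := (hb _).2 x
    exact exists_scomp ha hb hu hf t σ z y h
  comp_inj σ x x' y y' h hx hy := by
    obtain ⟨t, ht⟩ := (hb _).2 (u _ x')
    exact scomp_inj ha hb hu hf t σ x x' y y' (hx.trans ht.symm) ht.symm h hy

lemma gen_injective (ha : a.IsFree γ') (T : O) : Function.Injective (γ' T) := fun x y h =>
  (gen_inj ha (𝟙 T) (congrArg (fun t => a.scomp (𝟙 T) t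
    (fun i => setElt.tr A (fib_id T i).symm a.sone)) h)).1

/-- The inclusion of the generators of a free operad of sets is cartesian. -/
lemma isPb_gen (ha : a.IsFree γ') (hb : b.IsFree γ) (hu : a.IsHom b u)
    (hf : ∀ T x, u T (γ' T x) = γ T (f T x)) (T : O) : IsPb (f T) (γ' T) (γ T) (u T) where
  comm x := (hf T x).symm
  inj x y _ h := gen_injective ha T h
  ex x z h := by
    have h1 : u T z = b.scomp (𝟙 T) (γ T x) (fun i => setElt.tr B (fib_id T i).symm b.sone) :=
      h.symm.trans (b.comp_id setElt T _).symm
    obtain ⟨x', y, rfl, rfl, hy⟩ := exists_gen ha hb hu hf (𝟙 T) z x _ h1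
    refine ⟨x', rfl, ?_⟩
    obtain rfl : y = fun i => setElt.tr A (fib_id T i).symm a.sone :=
      funext fun i => eq_one ha hb hu hf (fib_id T i) _ (hy i)
    exact (a.comp_id setElt T _).symm

end OperadStr.IsFree

/-! ### Labelled trees and the free operad -/

namespace Free

variable {X : O → Type w}

lemma exists_ι {T : O} (z : F X T) : ∃ (t : Tree O T) (e : ev X t), ι X t e = z := by
  obtain ⟨⟨t⟩, e, h⟩ := Limits.Types.jointly_surjective _
    (coproductIsCoproduct fun t : Tree O T => ev X t) z
  exact ⟨t, e, h⟩

/-- The labelled tree given by an element of a summand of the free operad. -/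
def label : {T : O} → (t : Tree O T) → ev X t → FTree X T
  | _, .unit h, _ => .unit h
  | _, .node (S := S) σ b, e =>
    .node σ (e : X S × tens (card S) (fun i => ev X (b i))).1 (fun i => label (b i)
      (untens _ (e : X S × tens (card S) (fun i => ev X (b i))).2 i))

/-- The labelled tree of an element of the free operad. -/
noncomputable def toFTree (T : O) : F X T ⟶ FTree X T :=
  (isCoprod_ι X T).desc (fun t => ↾(label t))

lemma toFTree_ι {T : O} (t : Tree O T) (e : ev X t) : toFTree T (ι X t e) = label t e :=
  congrArg (fun f => f e) ((isCoprod_ι X T).ι_desc (fun t => ↾(label (X := X) t)) t)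

variable [Levelled O]

lemma ι_node {T S : O} (σ : T ⟶ S) (b : ∀ i, Tree O (fib σ i)) (x : X S) (e : ∀ i, ev X (b i)) :
    ι X (.node σ b) (x, setElt.tens _ e) =
      (str X).scomp σ (η X S x) (fun i => ι X (b i) (e i)) :=
  (map_ι_node X setElt σ b x e).trans (mul_η X setElt σ x _).symm

/-- Every element of the free operad is the value of its labelled tree. -/
lemma eval_label {T : O} (t : Tree O T) (e : ev X t) :
    FTree.eval (str X) (fun S x => η X S x) (label t e) = ι X t e := by
  induction t with
  | unit h => subst h; exact setElt.tr_rfl _ _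
  | @node T S σ b ih =>
    have h := ι_node σ b (e : X S × tens (card S) (fun i => ev X (b i))).1
      (untens _ (e : X S × tens (card S) (fun i => ev X (b i))).2)
    rw [tens_untens] at h
    refine Eq.trans ?_ h.symm
    exact congrArg ((str X).scomp σ _) (funext fun i => ih i _)

/-- The labelled tree of the value of a labelled tree is that tree. -/
lemma toFTree_eval {T : O} (t : FTree X T) :
    toFTree T (FTree.eval (str X) (fun S x => η X S x) t) = t := by
  induction t with
  | unit h =>
    subst h
    exact (congrArg (toFTree U) (setElt.tr_rfl rfl (str X).sone)).trans (toFTree_ι (.unit rfl) _)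
  | @node T S σ x c ih =>
    choose b e he using fun i => exists_ι (FTree.eval (str X) (fun S x => η X S x) (c i))
    have h := ι_node σ b x e
    simp only [he] at h
    refine (congrArg (toFTree T) h.symm).trans ((toFTree_ι _ _).trans ?_)
    refine congrArg (FTree.node σ x) (funext fun i => ?_)
    refine (congrArg (fun y => label (b i) (y i)) (untens_tens _ e)).trans ?_
    rw [← toFTree_ι, he, ih]

/-- The free operad on a collection of sets consists of the labelled trees. -/
lemma isFree_str : (str X).IsFree (fun S x => η X S x) := fun T =>
  ⟨Function.LeftInverse.injective (g := toFTree T) toFTree_eval, fun z => by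
    obtain ⟨t, e, rfl⟩ := exists_ι z
    exact ⟨label t e, eval_label t e⟩⟩

end Free

/-- The operads given by a left adjoint of the forgetful functor are free. -/
lemma isFree_of_adjunction [Levelled O] {L : (O → Type w) ⥤ Operad (Type w) O}
    (adj : L ⊣ Operad.forget (Type w) O) (X : O → Type w) :
    (L.obj X).str.IsFree (fun S x => adj.unit.app X S x) := by
  let e := (Free.adjunction O (Type w)).leftAdjointUniq adj
  refine (Free.isFree_str (X := X)).of_bijective (Operad.isHom (e.hom.app X)) (fun T => ?_)
    (fun T x => ?_)
  · have h1 : Operad.app (e.hom.app X) T ≫ Operad.app (e.inv.app X) T = 𝟙 _ :=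
      congrArg (fun f => Operad.app f T) (e.hom_inv_id_app X)
    have h2 : Operad.app (e.inv.app X) T ≫ Operad.app (e.hom.app X) T = 𝟙 _ :=
      congrArg (fun f => Operad.app f T) (e.inv_hom_id_app X)
    exact ((Iso.mk _ _ h1 h2).toEquiv).bijective
  · have h := Adjunction.unit_leftAdjointUniq_hom_app (Free.adjunction O (Type w)) adj X
    have h1 := congrFun h T
    have h2 := congrArg (fun f => f x) h1
    exact h2

end

/-! ### Pullbacks of families of sets -/

section Pullbacks

variable {I : Type} {P A B D : I → Type w} {t : P ⟶ A} {l : P ⟶ B} {r : A ⟶ D} {b : B ⟶ D}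

lemma isPullback_of_isPb (h : ∀ k, IsPb (t k) (l k) (r k) (b k)) : IsPullback t l r b := by
  have hk : ∀ k, IsPullback (t k) (l k) (r k) (b k) := fun k =>
    (Types.isPullback_iff _ _ _ _).2 ⟨by ext x; exact (h k).comm x,
      fun x y hxy => (h k).inj x y hxy.1 hxy.2, (h k).ex⟩
  have w : t ≫ r = l ≫ b := funext fun k => (hk k).w
  refine ⟨⟨w⟩, ⟨PullbackCone.IsLimit.mk w
    (fun s k => (hk k).lift (s.fst k) (s.snd k) (congrFun s.condition k))
    (fun s => funext fun k => (hk k).lift_fst _ _ _)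
    (fun s => funext fun k => (hk k).lift_snd _ _ _) (fun s m h1 h2 => funext fun k =>
      (hk k).hom_ext ?_ ?_)⟩⟩
  · rw [(hk k).lift_fst]
    exact congrFun h1 k
  · rw [(hk k).lift_snd]
    exact congrFun h2 k

/-- A pullback of families of sets is a pullback at each index. -/
lemma isPb_of_isPullback (h : IsPullback t l r b) (k : I) : IsPb (t k) (l k) (r k) (b k) := by
  -- the pullback is compared with the family of sets of compatible pairs
  let Q : I → Type w := fun k => {p : A k × B k // r k p.1 = b k p.2}
  let q₁ : Q ⟶ A := fun k => ↾fun p => p.1.1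
  let q₂ : Q ⟶ B := fun k => ↾fun p => p.1.2
  have hq : q₁ ≫ r = q₂ ≫ b := funext fun k => by ext p; exact p.2
  let p : P ⟶ Q := fun k => ↾fun x => ⟨(t k x, l k x),
    congrArg (fun f => f x) (congrFun h.w k)⟩
  have hp : p ≫ h.lift q₁ q₂ hq = 𝟙 P := h.hom_ext
    (by rw [Category.assoc, h.lift_fst]; rfl) (by rw [Category.assoc, h.lift_snd]; rfl)
  refine ⟨fun x => congrArg (fun f => f x) (congrFun h.w k), fun x y h1 h2 => ?_,
    fun x y hxy => ⟨h.lift q₁ q₂ hq k ⟨(x, y), hxy⟩, ?_, ?_⟩⟩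
  · have h3 : p k x = p k y := Subtype.ext (Prod.ext h1 h2)
    have h4 : ∀ z, h.lift q₁ q₂ hq k (p k z) = z := fun z =>
      congrArg (fun f => f z) (congrFun hp k)
    rw [← h4 x, h3, h4]
  · exact congrArg (fun f => f ⟨(x, y), hxy⟩) (congrFun (h.lift_fst q₁ q₂ hq) k)
  · exact congrArg (fun f => f ⟨(x, y), hxy⟩) (congrFun (h.lift_snd q₁ q₂ hq) k)

end Pullbacks

/-! ### Free symmetric operads of sets -/

section FreeSym

variable {Finf : (ℕ → Type w) ⥤ SymOperad (Type w)} (adjInf : Finf ⊣ forgetInf (Type w))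

/-- The free symmetric operad functor as a left adjoint of the forgetful functor from operads over
`FinAll`. -/
noncomputable def adjToAll : Finf ⋙ SymOperad.toAll (Type w) ⊣ Operad.forget (Type w) FinAll :=
  (adjInf.comp (SymOperad.toAll (Type w)).asEquivalence.toAdjunction).ofNatIsoRight
    (Functor.isoWhiskerRight (SymOperad.toAll (Type w)).asEquivalence.counitIso
      (Operad.forget (Type w) FinAll))

lemma adjToAll_unit (X : ℕ → Type w) : (adjToAll adjInf).unit.app X = adjInf.unit.app X := by
  have h := (SymOperad.toAll (Type w)).asEquivalence.functor_unit_comp (Finf.obj X)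
  have h' := congrArg (Operad.forget (Type w) FinAll).map h
  rw [CategoryTheory.Functor.map_comp, CategoryTheory.Functor.map_id] at h'
  refine ((Adjunction.homEquiv_id _ _).symm.trans
    (Adjunction.homEquiv_ofNatIsoRight_apply _ _ _)).trans ?_
  refine (congrArg (fun t => t ≫ _) ((Adjunction.homEquiv_id (adjInf.comp
    (SymOperad.toAll (Type w)).asEquivalence.toAdjunction) X).trans
      (Adjunction.comp_unit_app _ _ _))).trans ((Category.assoc _ _ _).trans ?_)
  exact (congrArg (fun t => adjInf.unit.app X ≫ t) h').trans (Category.comp_id _)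

/-- A free symmetric operad is free as an operad over `FinAll`. -/
lemma isFree_toAll (X : ℕ → Type w) :
    ((SymOperad.toAll (Type w)).obj (Finf.obj X)).str.IsFree
      (fun k x => adjInf.unit.app X k x) := by
  rw [← adjToAll_unit]
  exact isFree_of_adjunction (adjToAll adjInf) X

section

variable (A : SymOperad (Type w)) {O : Type} [FibredCategory O]

lemma sone_desStr : (A.desStr O).sone =
    setElt.tr (O := ℕ) A.ob (card_U (O := O)).symm (A.desStr FinAll).sone := by
  change setElt.map (A.str.unit ≫ eqToHom _) _ =
    setElt.map (eqToHom _) (setElt.map (A.str.unit ≫ 𝟙 _) _)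
  rw [Category.comp_id, setElt.map_comp]

/-- The multiplication of a desymmetrisation for `σ` is the multiplication, over all maps of finite
ordinals, for the map of tips of `σ`. -/
lemma scomp_desStr {T S : O} (σ : T ⟶ S) (x : A.ob (card S)) (y : ∀ i, A.ob (card (fib σ i))) :
    (A.desStr O).scomp σ x y = (A.desStr FinAll).scomp (T := card T) (S := card S) (tips σ) x
      (fun i => setElt.tr (O := ℕ) A.ob (card_fib σ i) (y i)) := by
  have h : (A.desStr FinAll).mul (T := card T) (S := card S) (tips σ) = A.mapMul (tips σ) :=
    A.desStr_mapMul (tips σ)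
  change setElt.map ((_ ◁ tensMap _ _) ≫ A.mapMul (tips σ)) _ =
    setElt.map ((A.desStr FinAll).mul (T := card T) (S := card S) (tips σ)) _
  rw [h, setElt.map_comp]
  refine congrArg (setElt.map (A.mapMul (tips σ))) ?_
  refine (setElt.map_whiskerLeft _ _ _ _).trans (congrArg (setElt.tmul x) ?_)
  exact setElt.map_tensMap _ _ _

end

/-- The desymmetrisation of a cartesian map is cartesian. -/
lemma isCart_des {A B : SymOperad (Type w)} (α : A ⟶ B)
    (h : (A.desStr FinAll).IsCart (B.desStr FinAll)
      (Operad.app ((SymOperad.toAll (Type w)).map α)))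
    (O : Type) [FibredCategory O] : (A.desStr O).IsCart (B.desStr O)
      (Operad.app ((SymOperad.des (Type w) O).map α)) :=
  let v : ∀ k : ℕ, A.ob k ⟶ B.ob k := Operad.app ((SymOperad.toAll (Type w)).map α)
  { isHom := Operad.isHom ((SymOperad.des (Type w) O).map α)
    one z hz := by
      rw [sone_desStr] at hz ⊢
      refine tr_injective (O := ℕ) (card_U (O := O)) ?_
      refine Eq.trans ?_ ((setElt.tr_tr _ _ _).trans (setElt.tr_rfl _ _)).symm
      refine h.one _ ((apply_tr (O := ℕ) v _ _).trans ?_)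
      exact (congrArg (setElt.tr (O := ℕ) B.ob (card_U (O := O))) hz).trans
        ((setElt.tr_tr _ _ _).trans (setElt.tr_rfl _ _))
    exists_comp {T S} σ z x y hz := by
      rw [scomp_desStr] at hz
      obtain ⟨p, q, h1, h2, h3⟩ := h.exists_comp (T := card T) (S := card S) (tips σ) z x _ hz
      refine ⟨p, fun i => setElt.tr (O := ℕ) A.ob (card_fib σ i).symm (q i), ?_, h2, fun i => ?_⟩
      · rw [scomp_desStr]
        refine Eq.trans ?_ h1
        congr 1
        funext i
        exact (setElt.tr_tr _ _ _).trans (setElt.tr_rfl _ _)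
      · refine (apply_tr (O := ℕ) v _ _).trans ?_
        exact (congrArg _ (h3 i)).trans ((setElt.tr_tr _ _ _).trans (setElt.tr_rfl _ _))
    comp_inj {T S} σ x x' y y' e hx hy := by
      have e' := (scomp_desStr A σ x y).symm.trans (e.trans (scomp_desStr A σ x' y'))
      have h1 := h.comp_inj (T := card T) (S := card S) (tips σ) x x' _ _ e' hx (fun i =>
        (apply_tr (O := ℕ) v _ _).trans ((congrArg _ (hy i)).trans (apply_tr (O := ℕ) v _ _).symm))
      exact ⟨h1.1, funext fun i => tr_injective (O := ℕ) (card_fib σ i) (congrFun h1.2 i)⟩ }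

end FreeSym

/-! ### The monad for symmetric operads of sets is cartesian -/

section CartesianMonad

variable {Finf : (ℕ → Type w) ⥤ SymOperad (Type w)}

lemma map_unit (adjInf : Finf ⊣ forgetInf (Type w)) {X Y : ℕ → Type w} (f : X ⟶ Y) (k : ℕ)
    (x : X k) : (forgetInf (Type w)).map (Finf.map f) k (adjInf.unit.app X k x) =
      adjInf.unit.app Y k (f k x) :=
  (congrArg (fun g => g x) (congrFun (adjInf.unit.naturality f) k)).symm

lemma isCart_map (adjInf : Finf ⊣ forgetInf (Type w)) {X Y : ℕ → Type w} (f : X ⟶ Y) :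
    ((Finf.obj X).desStr FinAll).IsCart ((Finf.obj Y).desStr FinAll)
      (Operad.app ((SymOperad.toAll (Type w)).map (Finf.map f))) :=
  (isFree_toAll adjInf X).isCart (isFree_toAll adjInf Y)
    (Operad.isHom ((SymOperad.toAll (Type w)).map (Finf.map f))) (map_unit adjInf f)

/-- A square of maps of symmetric operads, of which two parallel ones are induced by maps of
generators, is a pullback if its restriction to the generators is one. -/
lemma isPb_sym (adjInf : Finf ⊣ forgetInf (Type w)) {X' X Y' Y : ℕ → Type w} (f : X' ⟶ X)
    (g : Y' ⟶ Y) (ψ' : Finf.obj X' ⟶ Finf.obj Y') (ψ : Finf.obj X ⟶ Finf.obj Y)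
    (h : ∀ k, IsPb (f k) (fun x => (forgetInf (Type w)).map ψ' k (adjInf.unit.app X' k x))
      (fun x => (forgetInf (Type w)).map ψ k (adjInf.unit.app X k x))
      ((forgetInf (Type w)).map (Finf.map g) k)) (k : ℕ) :
    IsPb ((forgetInf (Type w)).map (Finf.map f) k) ((forgetInf (Type w)).map ψ' k)
      ((forgetInf (Type w)).map ψ k) ((forgetInf (Type w)).map (Finf.map g) k) :=
  (isFree_toAll adjInf X').isPb (isFree_toAll adjInf X) (isCart_map adjInf g)
    (Operad.isHom ((SymOperad.toAll (Type w)).map (Finf.map f)))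
    (Operad.isHom ((SymOperad.toAll (Type w)).map ψ'))
    (Operad.isHom ((SymOperad.toAll (Type w)).map ψ)) (map_unit adjInf f) h k

lemma isPb_unit (adjInf : Finf ⊣ forgetInf (Type w)) {X Y : ℕ → Type w} (f : X ⟶ Y) (k : ℕ) :
    IsPb (f k) (adjInf.unit.app X k) (adjInf.unit.app Y k)
      ((forgetInf (Type w)).map (Finf.map f) k) :=
  (isFree_toAll adjInf X).isPb_gen (isFree_toAll adjInf Y)
    (Operad.isHom ((SymOperad.toAll (Type w)).map (Finf.map f))) (map_unit adjInf f) k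

/-- The free symmetric operad monad preserves pullbacks: on generators, the image of a pullback
square is pasted from that square and a naturality square of the unit. -/
lemma isPullback_map (adjInf : Finf ⊣ forgetInf (Type w)) {P X Y Z : ℕ → Type w} {t : P ⟶ X}
    {l : P ⟶ Y} {r : X ⟶ Z} {b : Y ⟶ Z} (h : IsPullback t l r b) :
    IsPullback ((Finf ⋙ forgetInf (Type w)).map t) ((Finf ⋙ forgetInf (Type w)).map l)
      ((Finf ⋙ forgetInf (Type w)).map r) ((Finf ⋙ forgetInf (Type w)).map b) :=
  isPullback_of_isPb fun k => isPb_sym adjInf t b (Finf.map l) (Finf.map r) (fun k => by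
    have h1 := ((isPb_of_isPullback h k).symm.paste (isPb_unit adjInf b k).symm).symm
    simp only [map_unit]
    exact h1) k

lemma counit_unit (adjInf : Finf ⊣ forgetInf (Type w)) (A : SymOperad (Type w)) (k : ℕ)
    (x : (forgetInf (Type w)).obj A k) : (forgetInf (Type w)).map (adjInf.counit.app A) k
      (adjInf.unit.app ((forgetInf (Type w)).obj A) k x) = x :=
  congrArg (fun g => g x) (congrFun (adjInf.right_triangle_components A) k)

lemma isCartesianMonad (adjInf : Finf ⊣ forgetInf (Type w)) : IsCartesianMonad adjInf.toMonad where
  preserves := ⟨fun {K} => by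
    have : PreservesLimit (cospan (K.map WalkingCospan.Hom.inl) (K.map WalkingCospan.Hom.inr))
        (Finf ⋙ forgetInf (Type w)) := ⟨fun {c} hc => by
      have h := IsPullback.of_isLimit hc
      have := preservesLimit_of_preserves_limit_cone h.isLimit
        ((isLimitMapConePullbackConeEquiv _ h.w).symm (isPullback_map adjInf h).isLimit)
      exact this.preserves hc⟩
    change PreservesLimit K (Finf ⋙ forgetInf (Type w))
    exact preservesLimit_of_iso_diagram _ (diagramIsoCospan K).symm⟩
  unit X Y f := isPullback_of_isPb fun k => isPb_unit adjInf f k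
  mul X Y f := isPullback_of_isPb fun k =>
    isPb_sym adjInf ((forgetInf (Type w)).map (Finf.map f)) f (adjInf.counit.app (Finf.obj X))
      (adjInf.counit.app (Finf.obj Y)) (fun k => by
        -- on generators the multiplication is the identity
        have h1 := counit_unit adjInf (Finf.obj X) k
        have h2 := counit_unit adjInf (Finf.obj Y) k
        exact ⟨fun x => (h2 _).trans (congrArg _ (h1 x).symm),
          fun x y _ h => (h1 x).symm.trans (h.trans (h1 y)),
          fun x y h => ⟨y, h.symm.trans (h2 x), h1 y⟩⟩) k

end CartesianMonad

/-! ### The right action on the free symmetric operads is cartesian -/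

section Coproducts

variable {I : Type} {B' B : I → Type w}

lemma exists_sigma_ι (z : ∐ B) : ∃ i x, Sigma.ι B i x = z := by
  obtain ⟨⟨i⟩, x, h⟩ := Limits.Types.jointly_surjective _ (coproductIsCoproduct B) z
  exact ⟨i, x, h⟩

lemma sigma_ι_inj {i j : I} {x : B i} {y : B j} (h : Sigma.ι B i x = Sigma.ι B j y) :
    (⟨i, x⟩ : Σ i, B i) = ⟨j, y⟩ := by
  let g : ∀ i, B i ⟶ Σ i, B i := fun i => ↾fun x => ⟨i, x⟩
  have h1 : ∀ i x, Sigma.desc g (Sigma.ι B i x) = ⟨i, x⟩ := fun i x =>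
    congrArg (fun f => f x) (Sigma.ι_desc g i)
  rw [← h1, ← h1, h]

/-- Coproducts of sets are universal and disjoint, so the naturality squares of the coprojections
are pullbacks. -/
lemma isPb_sigma_ι (f : ∀ i, B' i ⟶ B i) (i : I) :
    IsPb (f i) (Sigma.ι B' i) (Sigma.ι B i) (Limits.Sigma.map f) where
  comm x := (congrArg (fun f => f x) (Limits.Sigma.ι_map f i)).symm
  inj x y _ h := by
    cases sigma_ι_inj h
    rfl
  ex x z h := by
    obtain ⟨j, y, rfl⟩ := exists_sigma_ι z
    have h1 := h.trans (congrArg (fun f => f y) (Limits.Sigma.ι_map f j))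
    have h2 := sigma_ι_inj h1
    cases h2
    exact ⟨y, rfl, rfl⟩

/-- Coproducts of sets are extensive: pullback squares over a common map assemble to a pullback
square on the coproduct. -/
lemma isPb_sigma_desc {E' E : Type w} (f : ∀ i, B' i ⟶ B i) (h' : ∀ i, B' i ⟶ E')
    (h : ∀ i, B i ⟶ E) (v : E' ⟶ E) (H : ∀ i, IsPb (f i) (h' i) (h i) v) :
    IsPb (Limits.Sigma.map f) (Sigma.desc h') (Sigma.desc h) v := by
  have e : ∀ i x, Limits.Sigma.map f (Sigma.ι B' i x) = Sigma.ι B i (f i x) := fun i x =>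
    congrArg (fun f => f x) (Limits.Sigma.ι_map f i)
  have e' : ∀ i x, Sigma.desc h' (Sigma.ι B' i x) = h' i x := fun i x =>
    congrArg (fun f => f x) (Sigma.ι_desc h' i)
  have e'' : ∀ i x, Sigma.desc h (Sigma.ι B i x) = h i x := fun i x =>
    congrArg (fun f => f x) (Sigma.ι_desc h i)
  constructor
  · intro z
    obtain ⟨i, x, rfl⟩ := exists_sigma_ι z
    rw [e, e', e'', (H i).comm]
  · intro z z' h1 h2
    obtain ⟨i, x, rfl⟩ := exists_sigma_ι z
    obtain ⟨j, y, rfl⟩ := exists_sigma_ι z'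
    rw [e, e] at h1
    rw [e', e'] at h2
    have h3 := sigma_ι_inj h1
    obtain rfl : i = j := congrArg Sigma.fst h3
    rw [(H i).inj x y (eq_of_heq (Sigma.mk.inj h3).2) h2]
  · intro z y hz
    obtain ⟨i, x, rfl⟩ := exists_sigma_ι z
    rw [e''] at hz
    obtain ⟨p, rfl, rfl⟩ := (H i).ex x y hz
    exact ⟨Sigma.ι B' i p, e i p, e' i p⟩

variable {n : ℕ}

lemma isPb_descC {X' X : LevelTree n → Type w} (f : X' ⟶ X) {D' D : ℕ → Type w} (v : D' ⟶ D)
    (h' : X' ⟶ (collW n (Type w)).obj D') (h : X ⟶ (collW n (Type w)).obj D)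
    (H : ∀ T, IsPb (f T) (h' T) (h T) (v T.tipCard)) (k : ℕ) :
    IsPb ((collC n (Type w)).map f k) (descC h' k) (descC h k) (v k) :=
  isPb_sigma_desc _ _ _ _ (by rintro ⟨T, rfl⟩; exact H T)

end Coproducts

section Action

variable {n : ℕ} {Finf : (ℕ → Type w) ⥤ SymOperad (Type w)}
  {F : (LevelTree n → Type w) ⥤ NOperad n (Type w)}

/-- The naturality squares of `freeToDes` are pullbacks. On generators, they are pasted from a
naturality square of the coprojections and one of the unit of `Finf`. -/
lemma isPb_freeToDes (adjInf : Finf ⊣ forgetInf (Type w)) (adj : F ⊣ forgetN n (Type w))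
    {X' X : LevelTree n → Type w} (f : X' ⟶ X) (T : LevelTree n) :
    IsPb ((forgetN n (Type w)).map (F.map f) T)
      ((forgetN n (Type w)).map (freeToDes adjInf adj X') T)
      ((forgetN n (Type w)).map (freeToDes adjInf adj X) T)
      ((forgetInf (Type w)).map (Finf.map ((collC n (Type w)).map f)) T.tipCard) := by
  have e : ∀ (X : LevelTree n → Type w) (T : LevelTree n) (x : X T),
      (forgetN n (Type w)).map (freeToDes adjInf adj X) T (adj.unit.app X T x) =
        adjInf.unit.app ((collC n (Type w)).obj X) T.tipCard (inc X T x) := fun X T x => by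
    have h := homEquiv_freeToDes adjInf adj X
    rw [Adjunction.homEquiv_unit, Adjunction.comp_unit_app] at h
    exact congrArg (fun g => g x) (congrFun h T)
  refine (isFree_of_adjunction adj X').isPb (isFree_of_adjunction adj X)
    (isCart_des _ (isCart_map adjInf ((collC n (Type w)).map f)) (LevelTree n))
    (Operad.isHom (F.map f)) (Operad.isHom (freeToDes adjInf adj X'))
    (Operad.isHom (freeToDes adjInf adj X)) (f := fun T => f T)
    (fun T x => (congrArg (fun g => g x) (congrFun (adj.unit.naturality f) T)).symm)
    (fun T => ?_) T
  have h := ((isPb_sigma_ι (fun S : {S : LevelTree n // S.tipCard = T.tipCard} => f S.1)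
    ⟨T, rfl⟩).symm.paste (isPb_unit adjInf ((collC n (Type w)).map f) T.tipCard).symm).symm
  exact h.congr (e X' T) (e X T)

/-- The restriction of the right action to the generators of its source. -/
lemma unit_rightAction_sym (adjInf : Finf ⊣ forgetInf (Type w)) (adj : F ⊣ forgetN n (Type w))
    (X : LevelTree n → Type w) :
    adjInf.unit.app _ ≫ (forgetInf (Type w)).map ((rightAction adjInf adj).app X) =
      descC ((forgetN n (Type w)).map (freeToDes adjInf adj X)) := by
  have h := homEquiv_rightAction adjInf adj X
  rw [Adjunction.homEquiv_unit, Adjunction.comp_unit_app] at h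
  exact hom_ext_C fun T => (congrFun h T).trans (inc_descC _ T).symm

/-- The right action is cartesian: its naturality squares are maps of free operads, so it suffices
to consider generators, where they are given by `isPb_freeToDes`. -/
lemma equifibered_rightAction (adjInf : Finf ⊣ forgetInf (Type w)) (adj : F ⊣ forgetN n (Type w)) :
    NatTrans.Equifibered (rightAction adjInf adj) := fun X' X f => by
  have := SymOperad.monadicForgetInf (Type w)
  have : CreatesLimitsOfSize.{0, 0} (forgetInf (Type w)) := monadicCreatesLimits _
  refine IsPullback.of_map (forgetInf (Type w)) ((rightAction adjInf adj).naturality f) ?_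
  refine isPullback_of_isPb fun k => isPb_sym adjInf
    ((collC n (Type w)).map ((forgetN n (Type w)).map (F.map f))) ((collC n (Type w)).map f)
    ((rightAction adjInf adj).app X') ((rightAction adjInf adj).app X) (fun k => ?_) k
  have e : ∀ (X : LevelTree n → Type w) (x : (collC n (Type w)).obj ((forgetN n (Type w)).obj
      (F.obj X)) k), (forgetInf (Type w)).map ((rightAction adjInf adj).app X) k
        (adjInf.unit.app _ k x) = descC (A := (forgetInf (Type w)).obj
          (Finf.obj ((collC n (Type w)).obj X))) (B := (forgetN n (Type w)).obj (F.obj X))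
          ((forgetN n (Type w)).map (freeToDes adjInf adj X)) k x :=
    fun X x => congrArg (fun g => g x) (congrFun (unit_rightAction_sym adjInf adj X) k)
  exact (isPb_descC ((forgetN n (Type w)).map (F.map f)) ((forgetInf (Type w)).map
    (Finf.map ((collC n (Type w)).map f))) ((forgetN n (Type w)).map (freeToDes adjInf adj X'))
    ((forgetN n (Type w)).map (freeToDes adjInf adj X)) (isPb_freeToDes adjInf adj f) k).congr
    (e X') (e X)

end Action

/-! ### The monad for symmetric operads of sets is finitary -/

section Filtered

/-- Finitely many properties that hold eventually hold simultaneously at some stage. -/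
lemma exists_forall_fin {J : Type*} [Category J] [IsFiltered J] {n : ℕ} (P : Fin n → J → Prop)
    (mono : ∀ i {j j' : J}, (j ⟶ j') → P i j → P i j') (h : ∀ i, ∃ j, P i j) :
    ∃ j, ∀ i, P i j := by
  classical
  choose j hj using h
  obtain ⟨s, hs⟩ := IsFiltered.sup_objs_exists (Finset.univ.image j)
  exact ⟨s, fun i => mono i (hs (Finset.mem_image_of_mem j (Finset.mem_univ i))).some (hj i)⟩

variable {J : Type w} [Category.{w} J]

lemma map_map_apply {I : Type} (K : J ⥤ (I → Type w)) {i j k : J} (f : i ⟶ j) (g : j ⟶ k) (a : I)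
    (x : K.obj i a) : K.map g a (K.map f a x) = K.map (f ≫ g) a x :=
  (congrArg (fun h => h x) (congrFun (K.map_comp f g) a)).symm

lemma cocone_apply {I : Type} {K : J ⥤ (I → Type w)} (c : Cocone K) {i j : J} (f : i ⟶ j) (a : I)
    (x : K.obj i a) : c.ι.app j a (K.map f a x) = c.ι.app i a x :=
  congrArg (fun h => h x) (congrFun (c.w f) a)

/-- A cocone of families of sets is a filtered colimit if each element of its vertex comes from
some stage, and if two elements of a stage that become equal in the vertex become so at a later
stage. -/
structure IsFilteredColimit {I : Type} {K : J ⥤ (I → Type w)} (c : Cocone K) : Prop where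
  surj (a : I) (x : c.pt a) : ∃ j y, c.ι.app j a y = x
  eq (a : I) (j : J) (y y' : K.obj j a) : c.ι.app j a y = c.ι.app j a y' →
    ∃ (j' : J) (f : j ⟶ j'), K.map f a y = K.map f a y'

section

variable {O : Type} [FibredCategory O] {K : J ⥤ (O → Type w)} {c : Cocone K}

lemma FTree.map_cocone {i j : J} (f : i ⟶ j) {T : O} (s : FTree (K.obj i) T) :
    FTree.map (fun T x => c.ι.app j T x) (FTree.map (fun T x => K.map f T x) s) =
      FTree.map (fun T x => c.ι.app i T x) s := by
  rw [FTree.map_map]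
  simp only [cocone_apply]

lemma FTree.map_map_apply {i j k : J} (f : i ⟶ j) (g : j ⟶ k) {T : O} (s : FTree (K.obj i) T) :
    FTree.map (fun T x => K.map g T x) (FTree.map (fun T x => K.map f T x) s) =
      FTree.map (fun T x => K.map (f ≫ g) T x) s := by
  rw [FTree.map_map]
  simp only [HigherOperads.map_map_apply]

end

variable [IsFiltered J]

lemma isFilteredColimit_iff {I : Type} {K : J ⥤ (I → Type w)} (c : Cocone K) :
    Nonempty (IsColimit c) ↔ IsFilteredColimit c := by
  let E := piEquivalenceFunctorDiscrete I (Type w)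
  constructor
  · rintro ⟨hc⟩
    have h1 : ∀ a : I, IsColimit ((E.functor ⋙ (evaluation _ _).obj ⟨a⟩).mapCocone c) := fun a =>
      isColimitOfPreserves _ hc
    constructor
    · intro a x
      exact Types.jointly_surjective _ (h1 a) x
    · intro a j y y' h
      obtain ⟨k, f, g, e⟩ := (Types.FilteredColimit.isColimit_eq_iff _ (h1 a)).1 h
      have e' : K.map f a y = K.map g a y' := e
      obtain ⟨l, p, hp⟩ := IsFilteredOrEmpty.cocone_maps f g
      refine ⟨l, f ≫ p, ?_⟩
      rw [← map_map_apply, e', map_map_apply, ← hp]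
  · rintro ⟨h1, h2⟩
    have h3 : ∀ (a : I) (i j : J) (x : K.obj i a) (y : K.obj j a),
        c.ι.app i a x = c.ι.app j a y →
          ∃ (k : J) (f : i ⟶ k) (g : j ⟶ k), K.map f a x = K.map g a y := fun a i j x y h => by
      obtain ⟨k, f, g, -⟩ := IsFilteredOrEmpty.cocone_objs i j
      obtain ⟨l, p, hp⟩ := h2 a k (K.map f a x) (K.map g a y) (by
        rw [cocone_apply, cocone_apply, h])
      rw [map_map_apply, map_map_apply] at hp
      exact ⟨l, f ≫ p, g ≫ p, hp⟩
    exact ⟨isColimitOfReflects E.functor (evaluationJointlyReflectsColimits _ fun ⟨a⟩ =>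
      Types.FilteredColimit.isColimitOf _ _
        (fun x => (h1 a x).imp fun j ⟨y, h⟩ => ⟨y, h.symm⟩) (h3 a))⟩

variable {O : Type} [FibredCategory O] {K : J ⥤ (O → Type w)} {c : Cocone K}

/-- A labelled tree has finitely many labels, so that it comes from some stage of a filtered
colimit. -/
lemma FTree.exists_map_eq (h : IsFilteredColimit c) {T : O} (t : FTree c.pt T) :
    ∃ j s, FTree.map (fun T x => c.ι.app j T x) s = t := by
  induction t with
  | unit e =>
    obtain ⟨j⟩ : Nonempty J := IsFiltered.nonempty
    exact ⟨j, .unit e, rfl⟩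
  | @node T S σ x b ih =>
    obtain ⟨j, hj⟩ := exists_forall_fin
      (fun i j => ∃ s, FTree.map (fun T x => c.ι.app j T x) s = b i)
      (fun i j j' f ⟨s, hs⟩ => ⟨_, (FTree.map_cocone f s).trans hs⟩) ih
    choose s hs using hj
    obtain ⟨j', y, rfl⟩ := h.surj S x
    obtain ⟨k, f, g, -⟩ := IsFilteredOrEmpty.cocone_objs j j'
    refine ⟨k, .node σ (K.map g S y) (fun i => FTree.map (fun T x => K.map f T x) (s i)), ?_⟩
    simp only [FTree.map, cocone_apply, FTree.map_cocone, hs]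

/-- Labelled trees that become equal in a filtered colimit become so at a later stage. -/
lemma FTree.exists_map_eq_map (h : IsFilteredColimit c) {j : J} {T : O} (s s' : FTree (K.obj j) T)
    (hs : FTree.map (fun T x => c.ι.app j T x) s = FTree.map (fun T x => c.ι.app j T x) s') :
    ∃ (j' : J) (f : j ⟶ j'),
      FTree.map (fun T x => K.map f T x) s = FTree.map (fun T x => K.map f T x) s' := by
  induction s with
  | unit e =>
    cases s' with
    | unit => exact ⟨j, 𝟙 j, rfl⟩
    | node => cases hs
  | @node T S σ x b ih =>
    cases s' with
    | unit => cases hs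
    | @node _ S' σ' x' b' =>
      obtain rfl : S = S' := by injection hs
      obtain rfl : σ = σ' := by injection hs
      obtain ⟨hx, hb⟩ := FTree.node_inj hs
      -- the stages over `j` form a filtered category, as the equalities concern maps out of `j`
      obtain ⟨u, hu⟩ := exists_forall_fin (J := Under j) (fun i u =>
        FTree.map (fun T x => K.map u.hom T x) (b i) =
          FTree.map (fun T x => K.map u.hom T x) (b' i))
        (fun i u u' f hf => by
          rw [← Under.w f, ← FTree.map_map_apply, hf, FTree.map_map_apply])
        (fun i => by
          obtain ⟨k, f, hf⟩ := ih i (b' i) (congrFun hb i)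
          exact ⟨Under.mk f, hf⟩)
      obtain ⟨k, f, hf⟩ := h.eq S j x x' hx
      obtain ⟨l, p, q, e⟩ := IsFiltered.span u.hom f
      refine ⟨l, u.hom ≫ p, ?_⟩
      have h1 : K.map (u.hom ≫ p) S x = K.map (u.hom ≫ p) S x' := by
        rw [e, ← HigherOperads.map_map_apply, hf, HigherOperads.map_map_apply]
      have h2 : ∀ i, FTree.map (fun T x => K.map (u.hom ≫ p) T x) (b i) =
          FTree.map (fun T x => K.map (u.hom ≫ p) T x) (b' i) := fun i => by
        rw [← FTree.map_map_apply, hu, FTree.map_map_apply]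
      simp only [FTree.map, h1, h2]

end Filtered

/-- The free symmetric operad on a collection of sets consists of labelled trees, and these commute
with filtered colimits of the sets of labels. -/
lemma isFinitaryMonad {Finf : (ℕ → Type w) ⥤ SymOperad (Type w)}
    (adjInf : Finf ⊣ forgetInf (Type w)) : IsFinitaryMonad adjInf.toMonad where
  preserves_filtered_colimits J _ _ := ⟨fun {K} => ⟨fun {c} hc => by
    have h := (isFilteredColimit_iff c).1 ⟨hc⟩
    have e : ∀ {X Y : ℕ → Type w} (f : X ⟶ Y) (k : FinAll) (t : FTree (O := FinAll) X k),
        (forgetInf (Type w)).map (Finf.map f) k (FTree.eval ((Finf.obj X).desStr FinAll)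
          (fun k x => adjInf.unit.app X k x) t) = FTree.eval ((Finf.obj Y).desStr FinAll)
            (fun k x => adjInf.unit.app Y k x) (FTree.map (fun k x => f k x) t) :=
      fun {X Y} f k t => by
        refine (FTree.hom_eval (Operad.isHom ((SymOperad.toAll (Type w)).map (Finf.map f)))
          _ t).trans (Eq.trans ?_ (FTree.eval_map (O := FinAll) _ _ t).symm)
        congr 1
        exact funext fun k => funext fun x => map_unit adjInf f k x
    refine (isFilteredColimit_iff _).2 ⟨fun k z => ?_, fun k j z z' hz => ?_⟩
    · obtain ⟨t, rfl⟩ := (isFree_toAll adjInf c.pt k).2 z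
      obtain ⟨j, s, rfl⟩ := FTree.exists_map_eq (O := FinAll) h t
      exact ⟨j, _, e (c.ι.app j) k s⟩
    · obtain ⟨s, rfl⟩ := (isFree_toAll adjInf (K.obj j) k).2 z
      obtain ⟨s', rfl⟩ := (isFree_toAll adjInf (K.obj j) k).2 z'
      have h1 := (e (c.ι.app j) k s).symm.trans (hz.trans (e (c.ι.app j) k s'))
      obtain ⟨j', f, hf⟩ := FTree.exists_map_eq_map (O := FinAll) h s s'
        ((isFree_toAll adjInf c.pt k).1 h1)
      exact ⟨j', f, (e (K.map f) k s).trans ((congrArg _ hf).trans (e (K.map f) k s').symm)⟩⟩⟩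

end HigherOperads

open HigherOperads

theorem mainTheorem2 :
    -- an arbitrary cocomplete symmetric monoidal category `V`
    (∀ (V : Type u) [Category.{v} V] [MonoidalCategory V] [SymmetricCategory V] [HasColimits V]
        [∀ X : V, PreservesColimits (tensorLeft X)],
      Nonempty (MonadicRightAdjoint (forgetInf V)) ∧
      ∀ n : ℕ,
        Des n V ⋙ forgetN n V = forgetInf V ⋙ collW n V ∧
        (forgetN n V).IsRightAdjoint ∧
        (Des n V).IsRightAdjoint ∧
        ∀ (Finf : (ℕ → V) ⥤ SymOperad V) (adjInf : Finf ⊣ forgetInf V)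
          (F : (LevelTree n → V) ⥤ NOperad n V) (adj : F ⊣ forgetN n V)
          (Sym : NOperad n V ⥤ SymOperad V) (adjSym : Sym ⊣ Des n V),
          ∃ e : F ⋙ Sym ≅ collC n V ⋙ Finf,
            conjugateIsoEquiv ((adjCollCW n V).comp adjInf) (adj.comp adjSym) e =
              (squareIso n V).symm) ∧
    -- the category of sets
    (∀ (Finf : (ℕ → Type w) ⥤ SymOperad (Type w)) (adjInf : Finf ⊣ forgetInf (Type w)),
      IsFinitaryMonad adjInf.toMonad ∧
      IsCartesianMonad adjInf.toMonad ∧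
      ∀ (n : ℕ) (F : (LevelTree n → Type w) ⥤ NOperad n (Type w)) (adj : F ⊣ forgetN n (Type w)),
        IsRightAction adj.toMonad (collC n (Type w) ⋙ Finf) (rightAction adjInf adj) ∧
        NatTrans.Equifibered (rightAction adjInf adj)) := by
  refine ⟨?_, ?_⟩
  · intro V _ _ _ _ _
    exact ⟨⟨SymOperad.monadicForgetInf V⟩, fun n => ⟨des_forget n V,
      Free.isRightAdjoint_forget (LevelTree n) V, isRightAdjoint_des n V,
      fun Finf adjInf F adj Sym adjSym =>
        ⟨(conjugateIsoEquiv ((adjCollCW n V).comp adjInf) (adj.comp adjSym)).symm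
          (squareIso n V).symm, Equiv.apply_symm_apply _ _⟩⟩⟩
  · intro Finf adjInf
    exact ⟨isFinitaryMonad adjInf, isCartesianMonad adjInf, fun n F adj =>
      ⟨isRightAction_rightAction adjInf adj, equifibered_rightAction adjInf adj⟩⟩
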